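/- Let $E$ be a Euclidean space of finite dimension $n\ge 1$, let $\mathrm{Sim}\,E$ be the group of its similarity transformations, and let $A\cong\mathbb R^+$ be the group of dilations $x\mapsto ax$, $a>0$. Subgroups and homomorphisms are meant in the sense of Lie groups: a connected subgroup is a connected, not necessarily closed Lie subgroup $G$, i.e. it is generated by $\exp\mathfrak g$, where its Lie algebra $\mathfrak g=\{X:\exp(tX)\in G\ \forall t\in\mathbb R\}$; homomorphisms are continuous. A linear subspace $W\subseteq E$ is also regarded as the group of translations by its vectors, and $SO(W)\subseteq SO(E)$ as the group of rotations that fix $W^\perp$ pointwise. Let $V=\mathbb Rp\oplus E\oplus\mathbb Rq$ be the Minkowski space with the form $\eta$ for which $p,q$ are isotropic, $\eta(p,q)=1$, $E\perp p,q$, and $\eta|_E$ is the Euclidean inner product. Let $SO(V)_{\mathbb Rp}$ be the group of linear automorphisms of $V$ of determinant $1$ that preserve $\eta$, the line $\mathbb Rp$ and the sheet $L=\{v:\eta(v,v)=-1,\ v_0>0\}$, where $v_0$ is the coordinate along $(p-q)/\sqrt2$; let $\mathfrak{so}(V)_{\mathbb Rp}$ be the Lie algebra of the $\eta$-skew endomorphisms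 preserving $\mathbb Rp$. Its elements are the triples $(a,A,X)$, $a\in\mathbb R$, $A\in\mathfrak{so}(E)$, $X\in E$, acting by $p\mapsto ap$, $Y\mapsto -\langle X,Y\rangle p+AY$ for $Y\in E$, $q\mapsto X-aq$. Put $\mathcal A=\{(a,0,0)\}$, $\mathcal N_W=\{(0,0,X):X\in W\}$ for $W\subseteq E$, $\mathcal N=\mathcal N_E$. Identifying $Y\in E$ with the isotropic line spanned by $-\tfrac12|Y|^2p+Y+q$, one identifies $E$ with the set of isotropic lines different from $\mathbb Rp$, so that $SO(V)_{\mathbb Rp}$ acts on $E$ by similarity transformations. Let $G\subseteq\mathrm{Sim}\,E$ be a connected subgroup. Then every element of $G$ is induced by exactly one element of $SO(V)_{\mathbb Rp}$; the elements so obtained form a connected Lie subgroup of $SO(V)_{\mathbb Rp}$ with a Lie algebra $\mathfrak g\subseteq\mathfrak{so}(V)_{\mathbb Rp}$. The group $G$ acts transitively on $E$ if and only if $\mathfrak g$ is weakly irreducible (it preserves no proper nonzero subspace of $V$ on which $\eta$ is nondegenerate) and not irreducible. If $G$ acts transitively, then it belongs to exactly one of the following types, where $H\subseteq SO(E)$ denotes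 a connected Lie subgroup and the products are internal direct and semidirect products: 1. $G=(A\times H)\ltimes E$; 2. $G=H\ltimes E$; 3. $G=(A^\Phi\times H)\ltimes E$, where $\Phi:A\to SO(E)$ is a homomorphism with $\Phi(A)\not\subseteq H$ and $A^\Phi=\{\Phi(a)\cdot a:a\in A\}$ is a group of screw dilations; 4. $G=(H\times U^\Psi)\ltimes W$, where $E=U\oplus W$ is an orthogonal decomposition, $\Psi:U\to SO(W)$ is a homomorphism with $\Psi(U)\not\subseteq H$, and $U^\Psi=\{\Psi(u)\cdot u:u\in U\}$ is a group of screw isometries. Moreover, for each $i=1,2,3,4$, $G$ is of type $i$ if and only if $\mathfrak g$ is of the $i$-th of the following Bérard Bergery–Ikemakhen types, where $\mathcal B\subseteq\mathfrak{so}(E)$ is a subalgebra with commutant $\mathcal B'$ and centre $\mathfrak z(\mathcal B)$: 1. $\mathfrak g=(\mathcal A\oplus\mathcal B)\ltimes\mathcal N$; 2. $\mathfrak g=\mathcal B\ltimes\mathcal N$; 3. $\mathfrak g=(\mathcal B'\oplus\{\varphi(Z)+Z:Z\in\mathfrak z(\mathcal B)\})\ltimes\mathcal N$, where $\varphi:\mathfrak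 z(\mathcal B)\to\mathcal A$ is a nonzero linear map; 4. $\mathfrak g=(\mathcal B'\oplus\{\psi(Z)+Z:Z\in\mathfrak z(\mathcal B)\})\ltimes\mathcal N_W$, where $E=U\oplus W$ is an orthogonal decomposition with $U,W\neq0$, $\mathcal B\subseteq\mathfrak{so}(W)$, and $\psi:\mathfrak z(\mathcal B)\to\mathcal N_U$ is a surjective linear map. -/

import Mathlib

/- Associative algebras are Lie algebras with the commutator bracket. -/
attribute [local instance] LieRing.ofAssociativeRing LieAlgebra.ofAssociativeAlgebra

/-! ### Linear Lie groups -/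

section LinearLie

variable {F : Type*} [NormedAddCommGroup F] [NormedSpace ℝ F]

/-- The tangent vectors at the identity of the one-parameter subgroups contained in `G`. -/
def lieSet (G : Subgroup (F →L[ℝ] F)ˣ) : Set (F →L[ℝ] F) :=
  {X | ∀ t : ℝ, ∃ g ∈ G, (g : F →L[ℝ] F) = NormedSpace.exp (t • X)}

/-- `G` is a connected (not necessarily closed) Lie subgroup of the general linear group of `F`, and
`𝔤` is its Lie algebra: `𝔤` consists of all `X` with `exp (tX) ∈ G` for all `t`, and the group `G` is
generated by `exp 𝔤`. -/
structure IsConnectedLieSubgroupWith (G : Subgroup (F →L[ℝ] F)ˣ)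
    (𝔤 : LieSubalgebra ℝ (F →L[ℝ] F)) : Prop where
  lie_eq : (𝔤 : Set (F →L[ℝ] F)) = lieSet G
  generates : G = Subgroup.closure
    {g : (F →L[ℝ] F)ˣ | ∃ X ∈ 𝔤, (g : F →L[ℝ] F) = NormedSpace.exp X}

end LinearLie

/-! ### Internal direct and semidirect products of subgroups -/

section Products

variable {S : Type*} [Group S]

/-- `G = K × L`. -/
def IsInternalDirect (K L G : Subgroup S) : Prop :=
  (∀ k ∈ K, ∀ l ∈ L, k * l = l * k) ∧ K ⊓ L = ⊥ ∧ K ⊔ L = G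

/-- `G = K ⋉ N`, with `N` normal in `G`. -/
def IsInternalSemidirect (K N G : Subgroup S) : Prop :=
  (∀ g ∈ G, ∀ x ∈ N, g * x * g⁻¹ ∈ N) ∧ K ⊓ N = ⊥ ∧ K ⊔ N = G

end Products

noncomputable section

/-! ### The similarity group of a Euclidean space -/

section Similarity

variable (E : Type*) [NormedAddCommGroup E] [InnerProductSpace ℝ E]

/-- The group of similarity transformations of `E`. -/
abbrev Sim : Type _ := E ≃ᵈ E

variable {E}

/-- The group `G` of similarity transformations written in homogeneous coordinates: the linear
automorphisms of `E × ℝ` that restrict to elements of `G` on the affine hyperplane `E × {1}`. -/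
def homogeneous (G : Subgroup (Sim E)) : Subgroup ((E × ℝ) →L[ℝ] (E × ℝ))ˣ where
  carrier := {M | ∃ f ∈ G, ∀ x : E, (M : (E × ℝ) →L[ℝ] (E × ℝ)) (x, 1) = (f x, 1)}
  one_mem' := ⟨1, G.one_mem, fun x => rfl⟩
  mul_mem' := by
    rintro M N ⟨f, hf, h⟩ ⟨g, hg, k⟩
    refine ⟨f * g, G.mul_mem hf hg, fun x => ?_⟩
    simp [k, h]
  inv_mem' := by
    rintro M ⟨f, hf, h⟩
    refine ⟨f⁻¹, G.inv_mem hf, fun x => ?_⟩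
    have h1 := h (f⁻¹ x)
    have h2 : f (f⁻¹ x) = x := f.apply_symm_apply x
    rw [h2] at h1
    rw [← h1, ← mul_apply_eq_comp]
    simp

/-- A connected Lie subgroup of `Sim E`. -/
def IsConnectedSimSubgroup (G : Subgroup (Sim E)) : Prop :=
  ∃ 𝔤 : LieSubalgebra ℝ ((E × ℝ) →L[ℝ] (E × ℝ)), IsConnectedLieSubgroupWith (homogeneous G) 𝔤

/-- `G` acts transitively on `E`. -/
def ActsTransitively (G : Subgroup (Sim E)) : Prop :=
  ∀ x y : E, ∃ g ∈ G, g x = y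

/-- `SO(W)`, as the group of the rotations of `E` that fix the orthogonal complement of `W`
pointwise. In particular `rotations ⊤` is `SO(E)`. -/
def rotations (W : Submodule ℝ E) : Subgroup (E ≃ₗᵢ[ℝ] E) where
  carrier := {f | LinearMap.det (f.toLinearEquiv : E →ₗ[ℝ] E) = 1 ∧ ∀ x ∈ Wᗮ, f x = x}
  one_mem' := ⟨LinearMap.det_id, fun x _ => rfl⟩
  mul_mem' := by
    rintro f g ⟨hf, hf'⟩ ⟨hg, hg'⟩
    refine ⟨?_, fun x hx => by simp [hg' x hx, hf' x hx]⟩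
    have : ((f * g).toLinearEquiv : E →ₗ[ℝ] E)
        = (f.toLinearEquiv : E →ₗ[ℝ] E) ∘ₗ (g.toLinearEquiv : E →ₗ[ℝ] E) := rfl
    rw [this, LinearMap.det_comp, hf, hg, one_mul]
  inv_mem' := by
    rintro f ⟨hf, hf'⟩
    refine ⟨?_, fun x hx => ?_⟩
    · have := LinearEquiv.det_symm_mul_det f.toLinearEquiv
      rw [hf, mul_one] at this
      exact this
    · conv_lhs => rw [← hf' x hx]
      exact f.symm_apply_apply x

/-- `SO(E)` as a subgroup of `Sim E`. -/
def linearRotations (E : Type*) [NormedAddCommGroup E] [InnerProductSpace ℝ E] :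
    Subgroup (Sim E) where
  carrier := {g | ∃ f ∈ rotations (⊤ : Submodule ℝ E), ∀ x, g x = f x}
  one_mem' := ⟨1, Subgroup.one_mem _, fun _ => rfl⟩
  mul_mem' := by
    rintro g g' ⟨f, hf, h⟩ ⟨f', hf', h'⟩
    exact ⟨f * f', Subgroup.mul_mem _ hf hf', fun x => by simp [h, h']⟩
  inv_mem' := by
    rintro g ⟨f, hf, h⟩
    refine ⟨f⁻¹, Subgroup.inv_mem _ hf, fun x => ?_⟩
    apply g.injective
    rw [h (f⁻¹ x)]
    exact (g.apply_symm_apply x).trans (f.apply_symm_apply x).symm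

/-- The group of the translations of `E` by the vectors of `W`. -/
def translations (W : Submodule ℝ E) : Subgroup (Sim E) where
  carrier := {g | ∃ w ∈ W, ∀ x, g x = x + w}
  one_mem' := ⟨0, W.zero_mem, fun x => by simp⟩
  mul_mem' := by
    rintro g g' ⟨w, hw, h⟩ ⟨w', hw', h'⟩
    exact ⟨w' + w, W.add_mem hw' hw, fun x => by simp [h, h', add_assoc]⟩
  inv_mem' := by
    rintro g ⟨w, hw, h⟩
    refine ⟨-w, W.neg_mem hw, fun x => ?_⟩
    apply g.injective
    rw [h (x + -w)]
    exact (g.apply_symm_apply x).trans (by simp)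

/-- `A^Φ = {Φ(a) ∘ a : a ∈ A}`, where `A = ℝ⁺` is the group of dilations about the origin with
positive ratio. -/
def screwDilations (Φ : {a : ℝ // 0 < a} →* rotations (⊤ : Submodule ℝ E)) :
    Subgroup (Sim E) where
  carrier := {g | ∃ a : {a : ℝ // 0 < a}, ∀ x, g x = (Φ a : E ≃ₗᵢ[ℝ] E) ((a : ℝ) • x)}
  one_mem' := ⟨1, fun x => by simp⟩
  mul_mem' := by
    rintro g g' ⟨a, h⟩ ⟨a', h'⟩
    refine ⟨a * a', fun x => ?_⟩
    simp [h, h', mul_smul]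
  inv_mem' := by
    rintro g ⟨a, h⟩
    refine ⟨a⁻¹, fun x => ?_⟩
    apply g.injective
    refine Eq.trans ?_ (h _).symm
    refine (g.apply_symm_apply x).trans ?_
    have ha : (a : ℝ) ≠ 0 := a.2.ne'
    have : (Φ a : E ≃ₗᵢ[ℝ] E) ((Φ a⁻¹ : E ≃ₗᵢ[ℝ] E) x) = x := by
      rw [map_inv]
      exact (Φ a : E ≃ₗᵢ[ℝ] E).apply_symm_apply x
    simp only [map_smul, this, smul_smul]
    simp [ha]

/-- The group `A = ℝ⁺` of the dilations of `E` about the origin with positive ratio. -/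
def dilations (E : Type*) [NormedAddCommGroup E] [InnerProductSpace ℝ E] : Subgroup (Sim E) :=
  screwDilations (E := E) 1

/-- `U^Ψ = {Ψ(u) ∘ u : u ∈ U}`, where `u` acts as a translation and `Ψ : U → SO(W)`, `W = Uᗮ`. -/
def screwIsometries (U : Submodule ℝ E) (Ψ : Multiplicative U →* rotations Uᗮ) :
    Subgroup (Sim E) where
  carrier := {g | ∃ u : U, ∀ x, g x = (Ψ (Multiplicative.ofAdd u) : E ≃ₗᵢ[ℝ] E) (x + u)}
  one_mem' := ⟨0, fun x => by simp⟩
  mul_mem' := by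
    rintro g g' ⟨u, h⟩ ⟨u', h'⟩
    refine ⟨u + u', fun x => ?_⟩
    have fix : (Ψ (Multiplicative.ofAdd u') : E ≃ₗᵢ[ℝ] E) u = u :=
      (Ψ (Multiplicative.ofAdd u')).2.2 u (Submodule.le_orthogonal_orthogonal U u.2)
    simp [h, h', ofAdd_add, fix]
    abel
  inv_mem' := by
    rintro g ⟨u, h⟩
    refine ⟨-u, fun x => ?_⟩
    apply g.injective
    refine Eq.trans ?_ (h _).symm
    refine (g.apply_symm_apply x).trans ?_
    have fix : (Ψ (Multiplicative.ofAdd u) : E ≃ₗᵢ[ℝ] E) u = u :=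
      (Ψ (Multiplicative.ofAdd u)).2.2 u (Submodule.le_orthogonal_orthogonal U u.2)
    have inv : ∀ y, (Ψ (Multiplicative.ofAdd u) : E ≃ₗᵢ[ℝ] E)
        ((Ψ (Multiplicative.ofAdd (-u)) : E ≃ₗᵢ[ℝ] E) y) = y := by
      intro y
      rw [ofAdd_neg, map_inv]
      exact (Ψ (Multiplicative.ofAdd u) : E ≃ₗᵢ[ℝ] E).apply_symm_apply y
    rw [map_add, inv, fix]
    simp

/-- Labels of the four types. -/
inductive FourTypes
  | type1
  | type2
  | type3
  | type4

/-- The four types of groups of similarity transformations. In all of them `H` is a connected Lie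
subgroup of `SO(E)`, and homomorphisms of Lie groups are continuous. The last condition in types 3
and 4 says that the screw parts of the motions are not all contained in `H`; if they were, then `G`
would be of type 1 or 2. -/
def SimType (G : Subgroup (Sim E)) : FourTypes → Prop
  -- `G = (A × H) ⋉ E`
  | .type1 => ∃ H K : Subgroup (Sim E), H ≤ linearRotations E ∧ IsConnectedSimSubgroup H ∧
      IsInternalDirect (dilations E) H K ∧ IsInternalSemidirect K (translations ⊤) G
  -- `G = H ⋉ E`
  | .type2 => ∃ H : Subgroup (Sim E), H ≤ linearRotations E ∧ IsConnectedSimSubgroup H ∧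
      IsInternalSemidirect H (translations ⊤) G
  -- `G = (A^Φ × H) ⋉ E`
  | .type3 => ∃ (H K : Subgroup (Sim E))
      (Φ : {a : ℝ // 0 < a} →* rotations (⊤ : Submodule ℝ E)),
      H ≤ linearRotations E ∧ IsConnectedSimSubgroup H ∧
      (∀ x : E, Continuous fun a => (Φ a : E ≃ₗᵢ[ℝ] E) x) ∧
      IsInternalDirect (screwDilations Φ) H K ∧ IsInternalSemidirect K (translations ⊤) G ∧
      ∃ a, ¬ ∃ h ∈ H, ∀ x, h x = (Φ a : E ≃ₗᵢ[ℝ] E) x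
  -- `G = (H × U^Ψ) ⋉ W`, `E = U ⊕ W`
  | .type4 => ∃ (H K : Subgroup (Sim E)) (U : Submodule ℝ E)
      (Ψ : Multiplicative U →* rotations Uᗮ),
      H ≤ linearRotations E ∧ IsConnectedSimSubgroup H ∧
      (∀ x : E, Continuous fun u : U => (Ψ (Multiplicative.ofAdd u) : E ≃ₗᵢ[ℝ] E) x) ∧
      IsInternalDirect H (screwIsometries U Ψ) K ∧ IsInternalSemidirect K (translations Uᗮ) G ∧
      ∃ u, ¬ ∃ h ∈ H, ∀ x, h x = (Ψ u : E ≃ₗᵢ[ℝ] E) x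

end Similarity

/-! ### Minkowski space -/

section Minkowski

variable (E : Type*) [NormedAddCommGroup E] [InnerProductSpace ℝ E]

/-- The Minkowski space `V = ℝp ⊕ E ⊕ ℝq`; the triple `(x, Y, z)` stands for `x p + Y + z q`. -/
abbrev Mink : Type _ := ℝ × E × ℝ

variable {E}

/-- The Lorentzian form on `V`: `p`, `q` are isotropic, `η(p, q) = 1`, and `E` is orthogonal to `p`
and `q` and carries its Euclidean inner product. -/
def eta : LinearMap.BilinForm ℝ (Mink E) :=
  LinearMap.mk₂ ℝ (fun v w => v.1 * w.2.2 + inner ℝ v.2.1 w.2.1 + v.2.2 * w.1)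
    (by intro v v' w; simp [inner_add_left]; ring)
    (by intro c v w; simp [real_inner_smul_left]; ring)
    (by intro v w w'; simp [inner_add_right]; ring)
    (by intro c v w; simp [real_inner_smul_right]; ring)

/-- The isotropic vector `p`. -/
def vecP : Mink E := (1, 0, 0)

/-- The vector model `{v : η(v, v) = -1, v₀ > 0}` of Lobachevskian space, where `v₀` is the
coordinate of `v` along `e₀ = (p - q) / √2`. -/
def lobachevsky (E : Type*) [NormedAddCommGroup E] [InnerProductSpace ℝ E] : Set (Mink E) :=
  {v | eta v v = -1 ∧ 0 < (v.1 - v.2.2) / √2}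

/-- The group `SO(V)_{ℝp}`: the linear automorphisms of `V` of determinant one that preserve `η`,
the Lobachevskian space and the line `ℝp`. -/
def specialOrthogonalP (E : Type*) [NormedAddCommGroup E] [InnerProductSpace ℝ E] :
    Subgroup (Mink E →L[ℝ] Mink E)ˣ where
  carrier := {M | (M : Mink E →L[ℝ] Mink E).det = 1 ∧
    (∀ v w, eta ((M : Mink E →L[ℝ] Mink E) v) ((M : Mink E →L[ℝ] Mink E) w) = eta v w) ∧
    (∀ v, (M : Mink E →L[ℝ] Mink E) v ∈ lobachevsky E ↔ v ∈ lobachevsky E) ∧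
    (∀ v, (M : Mink E →L[ℝ] Mink E) v ∈ Submodule.span ℝ {vecP (E := E)} ↔
      v ∈ Submodule.span ℝ {vecP (E := E)})}
  one_mem' := ⟨LinearMap.det_id, fun _ _ => rfl, fun _ => Iff.rfl, fun _ => Iff.rfl⟩
  mul_mem' := by
    rintro M N ⟨h1, h2, h3, h4⟩ ⟨k1, k2, k3, k4⟩
    refine ⟨?_, fun v w => ?_, fun v => ?_, fun v => ?_⟩
    · have : (((M * N : (Mink E →L[ℝ] Mink E)ˣ) : Mink E →L[ℝ] Mink E)).det
          = (M : Mink E →L[ℝ] Mink E).det * (N : Mink E →L[ℝ] Mink E).det :=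
        LinearMap.det_comp _ _
      rw [this, h1, k1, one_mul]
    · simp [h2, k2]
    · simp [h3, k3]
    · simp [h4, k4]
  inv_mem' := by
    rintro M ⟨h1, h2, h3, h4⟩
    have inv : ∀ v, (M : Mink E →L[ℝ] Mink E)
        (((M⁻¹ : (Mink E →L[ℝ] Mink E)ˣ) : Mink E →L[ℝ] Mink E) v) = v := by
      intro v
      rw [← mul_apply_eq_comp]
      simp
    refine ⟨?_, fun v w => ?_, fun v => ?_, fun v => ?_⟩
    · have : ((M * M⁻¹ : (Mink E →L[ℝ] Mink E)ˣ) : Mink E →L[ℝ] Mink E).det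
          = (M : Mink E →L[ℝ] Mink E).det *
            ((M⁻¹ : (Mink E →L[ℝ] Mink E)ˣ) : Mink E →L[ℝ] Mink E).det :=
        LinearMap.det_comp _ _
      rw [h1, one_mul, mul_inv_cancel] at this
      rw [← this]
      exact LinearMap.det_id
    · rw [← h2, inv, inv]
    · rw [← h3, inv]
    · rw [← h4, inv]

/-- The identification of `E` with the set of the isotropic lines of `V` other than `ℝp`. -/
def isotropicLine (Y : E) : Submodule ℝ (Mink E) :=
  Submodule.span ℝ {((-(1 / 2) * ‖Y‖ ^ 2, Y, 1) : Mink E)}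

/-- The automorphism `M` of `V` acts on the isotropic lines other than `ℝp` as `f` acts on `E`. -/
def Induces (M : (Mink E →L[ℝ] Mink E)ˣ) (f : Sim E) : Prop :=
  ∀ Y : E, (isotropicLine Y).map ((M : Mink E →L[ℝ] Mink E) : Mink E →ₗ[ℝ] Mink E)
    = isotropicLine (f Y)

/-- The subgroup of `SO(V)_{ℝp}` that corresponds to the subgroup `G` of `Sim E`. -/
def lorentzGroup (G : Subgroup (Sim E)) : Subgroup (Mink E →L[ℝ] Mink E)ˣ where
  carrier := {M | M ∈ specialOrthogonalP E ∧ ∃ f ∈ G, Induces M f}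
  one_mem' := ⟨Subgroup.one_mem _, 1, G.one_mem, fun Y => Submodule.map_id _⟩
  mul_mem' := by
    rintro M N ⟨hM, f, hf, h⟩ ⟨hN, g, hg, k⟩
    refine ⟨Subgroup.mul_mem _ hM hN, f * g, G.mul_mem hf hg, fun Y => ?_⟩
    have := h (g Y)
    rw [← k, ← Submodule.map_comp] at this
    exact this
  inv_mem' := by
    rintro M ⟨hM, f, hf, h⟩
    refine ⟨Subgroup.inv_mem _ hM, f⁻¹, G.inv_mem hf, fun Y => ?_⟩
    have h1 := h (f⁻¹ Y)
    have h2 : f (f⁻¹ Y) = Y := f.apply_symm_apply Y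
    rw [h2] at h1
    rw [← h1, ← Submodule.map_comp]
    have : (((M⁻¹ : (Mink E →L[ℝ] Mink E)ˣ) : Mink E →L[ℝ] Mink E) : Mink E →ₗ[ℝ] Mink E) ∘ₗ
        ((M : Mink E →L[ℝ] Mink E) : Mink E →ₗ[ℝ] Mink E) = LinearMap.id := by
      ext1 <;> ext <;> simp [← mul_apply_eq_comp]
    rw [this, Submodule.map_id]

/-! ### Subalgebras of `𝔰𝔬(V)_{ℝp}` -/

/-- `𝔤 ⊆ 𝔰𝔬(V)_{ℝp}`: the elements of `𝔤` are `η`-skew and preserve the line `ℝp`. -/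
def IsSubalgebraOfSOP (𝔤 : LieSubalgebra ℝ (Mink E →L[ℝ] Mink E)) : Prop :=
  ∀ T ∈ 𝔤, (∀ v w, eta (T v) w = -eta v (T w)) ∧ T vecP ∈ Submodule.span ℝ {vecP (E := E)}

/-- `𝔤` preserves the subspace `F` of `V`. -/
def Preserves (𝔤 : LieSubalgebra ℝ (Mink E →L[ℝ] Mink E)) (F : Submodule ℝ (Mink E)) : Prop :=
  ∀ T ∈ 𝔤, ∀ v ∈ F, T v ∈ F

/-- `𝔤` preserves no proper subspace. -/
def IsIrreducibleAlg (𝔤 : LieSubalgebra ℝ (Mink E →L[ℝ] Mink E)) : Prop :=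
  ∀ F : Submodule ℝ (Mink E), Preserves 𝔤 F → F = ⊥ ∨ F = ⊤

/-- `𝔤` preserves no nondegenerate proper subspace. -/
def IsWeaklyIrreducibleAlg (𝔤 : LieSubalgebra ℝ (Mink E →L[ℝ] Mink E)) : Prop :=
  ∀ F : Submodule ℝ (Mink E), Preserves 𝔤 F → (eta.restrict F).Nondegenerate → F = ⊥ ∨ F = ⊤

/-- The element `(a, A, X)` of `𝔰𝔬(V)_{ℝp}`: the endomorphism of `V = ℝp ⊕ E ⊕ ℝq` with block matrix
`(a, -Xᵗ, 0; 0, A, X; 0, 0, -a)`. -/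
def triple (a : ℝ) (A : E →L[ℝ] E) (X : E) : Mink E →L[ℝ] Mink E :=
  (a • ContinuousLinearMap.fst ℝ ℝ (E × ℝ)
      - innerSL ℝ X ∘L ContinuousLinearMap.fst ℝ E ℝ ∘L ContinuousLinearMap.snd ℝ ℝ (E × ℝ)).prod
    ((A ∘L ContinuousLinearMap.fst ℝ E ℝ ∘L ContinuousLinearMap.snd ℝ ℝ (E × ℝ)
      + (ContinuousLinearMap.snd ℝ E ℝ ∘L
          ContinuousLinearMap.snd ℝ ℝ (E × ℝ)).smulRight X).prod
      (-(a • (ContinuousLinearMap.snd ℝ E ℝ ∘L ContinuousLinearMap.snd ℝ ℝ (E × ℝ)))))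

theorem triple_apply (a : ℝ) (A : E →L[ℝ] E) (X : E) (x : ℝ) (Y : E) (z : ℝ) :
    triple a A X (x, Y, z) = (a * x - inner ℝ X Y, A Y + z • X, -(a * z)) := by
  simp [triple]

/-- `ℬ ⊆ 𝔰𝔬(W)`: the elements of `ℬ` are skew-symmetric and vanish on the orthogonal complement of
`W`. -/
def IsSkewOn (W : Submodule ℝ E) (ℬ : LieSubalgebra ℝ (E →L[ℝ] E)) : Prop :=
  ∀ A ∈ ℬ, (∀ Y Z : E, inner ℝ (A Y) Z = -inner ℝ Y (A Z)) ∧ ∀ Y ∈ Wᗮ, A Y = 0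

/-- The commutant `ℬ'`. -/
abbrev commutant (ℬ : LieSubalgebra ℝ (E →L[ℝ] E)) : LieIdeal ℝ ℬ :=
  ⁅(⊤ : LieIdeal ℝ ℬ), (⊤ : LieIdeal ℝ ℬ)⁆

/-- The four Bérard Bergery–Ikemakhen types of subalgebras of `𝔰𝔬(V)_{ℝp}`. -/
def AlgType (𝔤 : LieSubalgebra ℝ (Mink E →L[ℝ] Mink E)) : FourTypes → Prop
  -- `𝔤 = (𝒜 ⊕ ℬ) ⋉ 𝒩`
  | .type1 => ∃ ℬ : LieSubalgebra ℝ (E →L[ℝ] E), IsSkewOn ⊤ ℬ ∧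
      ∀ T, T ∈ 𝔤 ↔ ∃ (a : ℝ) (A : ℬ) (X : E), T = triple a A X
  -- `𝔤 = ℬ ⋉ 𝒩`
  | .type2 => ∃ ℬ : LieSubalgebra ℝ (E →L[ℝ] E), IsSkewOn ⊤ ℬ ∧
      ∀ T, T ∈ 𝔤 ↔ ∃ (A : ℬ) (X : E), T = triple 0 A X
  -- `𝔤 = (ℬ' ⊕ {φ(A) + A : A ∈ 𝔷(ℬ)}) ⋉ 𝒩`
  | .type3 => ∃ (ℬ : LieSubalgebra ℝ (E →L[ℝ] E)) (φ : LieAlgebra.center ℝ ℬ →ₗ[ℝ] ℝ),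
      IsSkewOn ⊤ ℬ ∧ φ ≠ 0 ∧
      ∀ T, T ∈ 𝔤 ↔ ∃ (C : commutant ℬ) (A : LieAlgebra.center ℝ ℬ) (X : E),
        T = triple 0 ((C : ℬ) : E →L[ℝ] E) 0 + triple (φ A) ((A : ℬ) : E →L[ℝ] E) 0 + triple 0 0 X
  -- `𝔤 = (ℬ' ⊕ {ψ(A) + A : A ∈ 𝔷(ℬ)}) ⋉ 𝒩_W`
  | .type4 => ∃ (U : Submodule ℝ E) (ℬ : LieSubalgebra ℝ (E →L[ℝ] E))
      (ψ : LieAlgebra.center ℝ ℬ →ₗ[ℝ] U),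
      U ≠ ⊥ ∧ Uᗮ ≠ ⊥ ∧ IsSkewOn Uᗮ ℬ ∧ Function.Surjective ψ ∧
      ∀ T, T ∈ 𝔤 ↔ ∃ (C : commutant ℬ) (A : LieAlgebra.center ℝ ℬ) (X : Uᗮ),
        T = triple 0 ((C : ℬ) : E →L[ℝ] E) 0 + triple 0 ((A : ℬ) : E →L[ℝ] E) (ψ A : E)
          + triple 0 0 (X : E)

end Minkowski

end

/-!
On the isotropic lines other than `ℝp` the element `(a, A, X)` of `𝔰𝔬(V)_{ℝp}` induces the affine
vector field `x ↦ a x + A x + X`, so `G` and its lift to `SO(V)_{ℝp}` are generated by exponentials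
of the same fields. If `G` is transitive and its lift preserves a nondegenerate subspace `F`, then
the components of `p` along `F` and `Fᗮ` lie in `ℝp`, which forces `F` to be trivial.

Let `𝔤` be weakly irreducible. If some element of `𝔤` has `a ≠ 0`, it may be chosen with `A` central
in the skew part; it then has a fixed point, and weak irreducibility puts all translations into `𝔤`.
If `a = 0` throughout, the translation part is a cocycle on the skew part with values in `E`, a
coboundary up to a map into the common kernel. This gives the four types of algebras, and
exponentiating a central section `A` of the parameter `a` (type 3) or of the translation along `U`
(type 4) gives the factors `A^Φ` and `U^Ψ` of the group, which make its transitivity visible.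

The types exclude each other because they are told apart by whether dilations occur, whether the
pure dilations `(1, 0, 0)` belong to `𝔤`, and whether all translations do. These are properties of
`G` as well as of `𝔤`, so the type of the group is that of the algebra.
-/

noncomputable section

open NormedSpace (exp)
set_option maxSynthPendingDepth 3

local instance completeSpace_of_finiteDimensional {F : Type*} [NormedAddCommGroup F]
    [NormedSpace ℝ F] [FiniteDimensional ℝ F] : CompleteSpace F :=
  FiniteDimensional.complete ℝ F

/-! ### The exponential of an operator -/

section BanachAlgebra

variable {𝔸 : Type*} [NormedRing 𝔸] [NormedAlgebra ℝ 𝔸] [CompleteSpace 𝔸]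

theorem exp_add_of_commute {x y : 𝔸} (h : Commute x y) : exp (x + y) = exp x * exp y := by
  let _ : NormedAlgebra ℚ 𝔸 := NormedAlgebra.restrictScalars ℚ ℝ 𝔸
  exact NormedSpace.exp_add_of_commute h

theorem continuous_exp : Continuous (exp : 𝔸 → 𝔸) := by
  let _ : NormedAlgebra ℚ 𝔸 := NormedAlgebra.restrictScalars ℚ ℝ 𝔸
  exact NormedSpace.exp_continuous

theorem exp_neg_mul_exp (x : 𝔸) : exp (-x) * exp x = 1 := by
  rw [← exp_add_of_commute (Commute.refl x).neg_left, neg_add_cancel, NormedSpace.exp_zero]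

theorem exp_mul_exp_neg (x : 𝔸) : exp x * exp (-x) = 1 := by
  simpa using exp_neg_mul_exp (-x)

theorem exp_smul_one_add (a : ℝ) (x : 𝔸) : exp (a • (1 : 𝔸) + x) = Real.exp a • exp x := by
  have exp_smul_one : exp (a • (1 : 𝔸)) = Real.exp a • (1 : 𝔸) := by
    rw [← Algebra.algebraMap_eq_smul_one, ← Algebra.algebraMap_eq_smul_one, Real.exp_eq_exp_ℝ,
      NormedSpace.algebraMap_exp_comm]
  rw [exp_add_of_commute ((Commute.one_left x).smul_left a), exp_smul_one, smul_mul_assoc, one_mul]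

/-- The exponential `exp x` as an invertible element, in the form in which one-parameter groups
enter the definition of a linear Lie group. -/
def expUnit (x : 𝔸) : 𝔸ˣ where
  val := exp x
  inv := exp (-x)
  val_inv := exp_mul_exp_neg x
  inv_val := exp_neg_mul_exp x

@[simp]
theorem coe_expUnit (x : 𝔸) : (expUnit x : 𝔸) = exp x := rfl

end BanachAlgebra

theorem mem_submodule_of_hasDerivAt {F : Type*} [NormedAddCommGroup F] [NormedSpace ℝ F]
    {f : ℝ → F} {f' : F} {t : ℝ} (hf : HasDerivAt f f' t)
    {W : Submodule ℝ F} (hW : IsClosed (W : Set F)) (hfW : ∀ s, f s ∈ W) : f' ∈ W := by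
  have hspan : f' ∈ closure (Submodule.span ℝ (f '' Set.univ) : Set F) :=
    hf.deriv ▸ range_deriv_subset_closure_span_image f dense_univ (Set.mem_range_self t)
  refine closure_minimal (Submodule.span_le.2 ?_) hW hspan
  rintro _ ⟨s, -, rfl⟩
  exact hfW s

section Operators

variable {F F₂ : Type*} [NormedAddCommGroup F] [NormedSpace ℝ F] [CompleteSpace F]
  [NormedAddCommGroup F₂] [NormedSpace ℝ F₂] [CompleteSpace F₂]

theorem exp_neg_apply_exp_apply (T : F →L[ℝ] F) (v : F) : exp (-T) (exp T v) = v := by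
  rw [← mul_apply_eq_comp, exp_neg_mul_exp, one_apply_eq_self]

theorem hasSum_exp_apply (T : F →L[ℝ] F) (v : F) :
    HasSum (fun n : ℕ => ((n.factorial : ℝ)⁻¹) • (T ^ n) v) (exp T v) := by
  simpa using (ContinuousLinearMap.apply ℝ F v).hasSum
    (NormedSpace.exp_series_hasSum_exp' (𝕂 := ℝ) T)

theorem map_exp_apply_of_intertwines {P : F →L[ℝ] F₂} {S : F →L[ℝ] F} {T : F₂ →L[ℝ] F₂}
    (h : ∀ v, P (S v) = T (P v)) (v : F) : P (exp S v) = exp T (P v) := by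
  have map_pow (n : ℕ) : P ((S ^ n) v) = (T ^ n) (P v) := by
    induction n with
    | zero => simp
    | succ n ih => rw [pow_succ', pow_succ', mul_apply_eq_comp, mul_apply_eq_comp, h, ih]
  have hsum := P.hasSum (hasSum_exp_apply S v)
  simp only [map_smul, map_pow] at hsum
  exact hsum.unique (hasSum_exp_apply T (P v))

theorem exp_apply_mem_of_invariant {T : F →L[ℝ] F} {W : Submodule ℝ F}
    (hW : IsClosed (W : Set F)) (h : ∀ v ∈ W, T v ∈ W) {v : F} (hv : v ∈ W) : exp T v ∈ W := by
  have pow_mem (n : ℕ) : (T ^ n) v ∈ W := by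
    induction n with
    | zero => simpa using hv
    | succ n ih => simpa [pow_succ'] using h _ ih
  exact hW.mem_of_tendsto (hasSum_exp_apply T v)
    (Filter.Eventually.of_forall fun s => W.sum_mem fun n _ => W.smul_mem _ (pow_mem n))

theorem exp_apply_mem_iff_of_invariant {T : F →L[ℝ] F} {W : Submodule ℝ F}
    (hW : IsClosed (W : Set F)) (h : ∀ v ∈ W, T v ∈ W) {v : F} : exp T v ∈ W ↔ v ∈ W := by
  refine ⟨fun hv => ?_, exp_apply_mem_of_invariant hW h⟩
  rw [← exp_neg_apply_exp_apply T v]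
  exact exp_apply_mem_of_invariant hW (fun w hw => W.neg_mem (h w hw)) hv

theorem exp_apply_of_apply_eq_zero {T : F →L[ℝ] F} {v : F} (h : T v = 0) : exp T v = v := by
  simpa using (map_exp_apply_of_intertwines (P := ContinuousLinearMap.toSpanSingleton ℝ v)
    (S := 0) (T := T) (by simp [h]) 1).symm

theorem exp_apply_of_sq_apply_eq_zero {T : F →L[ℝ] F} {v : F} (h : T (T v) = 0) :
    exp T v = v + T v := by
  have pow_apply_eq_zero : ∀ n ∉ Finset.range 2, ((n.factorial : ℝ)⁻¹) • (T ^ n) v = 0 := by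
    intro n hn
    obtain ⟨k, rfl⟩ := Nat.exists_eq_add_of_le (not_lt.1 (mt Finset.mem_range.2 hn))
    rw [add_comm, pow_add, mul_apply_eq_comp, pow_two, mul_apply_eq_comp, h, map_zero, smul_zero]
  simpa [Finset.sum_range_succ] using (hasSum_exp_apply T v).unique
    (hasSum_sum_of_ne_finset_zero pow_apply_eq_zero)

theorem hasDerivAt_exp_smul_apply_zero (T : F →L[ℝ] F) (v : F) :
    HasDerivAt (fun t : ℝ => exp (t • T) v) (T v) 0 := by
  simpa using (hasDerivAt_exp_smul_const' (𝕂 := ℝ) T 0).clm_apply (hasDerivAt_const 0 v)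

theorem apply_mem_of_forall_exp_mem {T : F →L[ℝ] F} {W : Submodule ℝ F}
    (hW : IsClosed (W : Set F)) {v : F} (h : ∀ t : ℝ, exp (t • T) v ∈ W) : T v ∈ W :=
  mem_submodule_of_hasDerivAt (hasDerivAt_exp_smul_apply_zero T v) hW h

theorem mem_lieSet_iff {G : Subgroup (F →L[ℝ] F)ˣ} {X : F →L[ℝ] F} :
    X ∈ lieSet G ↔ ∀ t : ℝ, expUnit (t • X) ∈ G := by
  refine forall_congr' fun t => ⟨?_, fun h => ⟨_, h, rfl⟩⟩
  rintro ⟨g, hg, hgexp⟩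
  rwa [show expUnit (t • X) = g from Units.ext hgexp.symm]

end Operators

section BilinForms

variable {F : Type*} [NormedAddCommGroup F] [NormedSpace ℝ F] [FiniteDimensional ℝ F]

theorem bilin_exp_apply_eq_of_adjoint {B : LinearMap.BilinForm ℝ F} {S T : F →L[ℝ] F}
    (h : ∀ v w, B (S v) w = B v (T w)) (v w : F) : B (exp S v) w = B v (exp T w) := by
  have bilin_pow (n : ℕ) : ∀ v w, B ((S ^ n) v) w = B v ((T ^ n) w) := by
    induction n with
    | zero => simp
    | succ n ih =>
      intro v w
      rw [pow_succ', pow_succ, mul_apply_eq_comp, mul_apply_eq_comp, h, ih]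
  have hS := (LinearMap.toContinuousLinearMap (B.flip w)).hasSum (hasSum_exp_apply S v)
  have hT := (LinearMap.toContinuousLinearMap (B v)).hasSum (hasSum_exp_apply T w)
  simp only [LinearMap.coe_toContinuousLinearMap', map_smul] at hS hT
  exact hS.unique (hT.congr_fun fun n => congrArg _ (bilin_pow n v w))

theorem bilin_exp_exp_of_skew {B : LinearMap.BilinForm ℝ F} {T : F →L[ℝ] F}
    (h : ∀ v w, B (T v) w = -B v (T w)) (v w : F) : B (exp T v) (exp T w) = B v w := by
  rw [bilin_exp_apply_eq_of_adjoint (T := -T) (fun v w => by simp [h]), exp_neg_apply_exp_apply]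

theorem hasDerivAt_bilin_exp (B : LinearMap.BilinForm ℝ F) (T : F →L[ℝ] F) (v w : F) :
    HasDerivAt (fun t : ℝ => B (exp (t • T) v) (exp (t • T) w)) (B (T v) w + B v (T w)) 0 := by
  let L : F →L[ℝ] F →L[ℝ] ℝ := LinearMap.toContinuousLinearMap
    ((LinearMap.toContinuousLinearMap : (F →ₗ[ℝ] ℝ) ≃ₗ[ℝ] (F →L[ℝ] ℝ)).toLinearMap ∘ₗ B)
  simpa [L] using (L.hasFDerivAt.comp_hasDerivAt (0 : ℝ)
    (hasDerivAt_exp_smul_apply_zero T v)).clm_apply (hasDerivAt_exp_smul_apply_zero T w)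

theorem bilin_skew_of_forall_exp {B : LinearMap.BilinForm ℝ F} {T : F →L[ℝ] F}
    (h : ∀ (t : ℝ) v w, B (exp (t • T) v) (exp (t • T) w) = B v w) (v w : F) :
    B (T v) w = -B v (T w) := by
  have hderiv := hasDerivAt_bilin_exp B T v w
  simp only [h] at hderiv
  linarith [hderiv.unique (hasDerivAt_const 0 _)]

theorem det_mul_self_eq_one_of_isometry {K V : Type*} [Field K] [AddCommGroup V] [Module K V]
    [FiniteDimensional K V] {B : LinearMap.BilinForm K V} (hB : B.Nondegenerate) {M : V →ₗ[K] V}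
    (hM : ∀ v w, B (M v) (M w) = B v w) : LinearMap.det M * LinearMap.det M = 1 := by
  let b := Module.finBasis K V
  have gram := congrArg Matrix.det (LinearMap.BilinForm.toMatrix_comp b b B M M)
  rw [show B.comp M M = B from LinearMap.ext₂ hM, Matrix.det_mul, Matrix.det_mul,
    Matrix.det_transpose, LinearMap.det_toMatrix] at gram
  refine mul_right_cancel₀ ((LinearMap.BilinForm.nondegenerate_iff_det_ne_zero b).1 hB) ?_
  linear_combination -gram

-- `exp T` is the square of the isometry `exp (T / 2)`, whose determinant is `±1`.
theorem det_exp_of_skew {B : LinearMap.BilinForm ℝ F} (hB : B.Nondegenerate)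
    {T : F →L[ℝ] F} (h : ∀ v w, B (T v) w = -B v (T w)) : (exp T).det = 1 := by
  let S := (1 / 2 : ℝ) • T
  have exp_eq : exp T = exp S * exp S := by
    rw [← exp_add_of_commute (Commute.refl S), ← add_smul, add_halves, one_smul]
  rw [exp_eq]
  exact (LinearMap.det_comp _ _).trans <| det_mul_self_eq_one_of_isometry hB
    (bilin_exp_exp_of_skew fun v w => by simp [S, h])

end BilinForms

/-! ### Skew-symmetric operators -/

section Skew

variable {E : Type*} [NormedAddCommGroup E] [InnerProductSpace ℝ E]

variable (E) in
/-- The Lie algebra `𝔰𝔬(E)` of the skew-symmetric operators on `E`. -/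
def skewOperators : LieSubalgebra ℝ (E →L[ℝ] E) where
  carrier := {A | ∀ Y Z : E, inner ℝ (A Y) Z = -inner ℝ Y (A Z)}
  zero_mem' Y Z := by simp
  add_mem' hA hB Y Z := by simp [inner_add_left, inner_add_right, hA Y Z, hB Y Z, add_comm]
  smul_mem' t A hA Y Z := by simp [real_inner_smul_left, real_inner_smul_right, hA Y Z]
  lie_mem' hA hB Y Z := by
    simp only [LieRing.of_associative_ring_bracket, sub_apply, mul_apply_eq_comp, inner_sub_left,
      inner_sub_right]
    rw [hA, hB, hB, hA]
    ring

theorem mem_skewOperators_iff_inner_self {A : E →L[ℝ] E} :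
    A ∈ skewOperators E ↔ ∀ x, inner ℝ (A x) x = 0 := by
  refine ⟨fun hA x => ?_, fun h Y Z => ?_⟩
  · linarith [hA x x, real_inner_comm (A x) x]
  · have polarization := h (Y + Z)
    simp only [map_add, inner_add_left, inner_add_right, h] at polarization
    linarith [real_inner_comm Y (A Z)]

theorem apply_mem_orthogonal_of_skew {A : E →L[ℝ] E} (hA : A ∈ skewOperators E)
    {W : Submodule ℝ E} (hW : ∀ x ∈ W, A x ∈ W) {u : E} (hu : u ∈ Wᗮ) : A u ∈ Wᗮ := by
  intro w hw
  linarith [hA w u, hu _ (hW w hw)]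

theorem norm_exp_apply_of_skew [FiniteDimensional ℝ E] {A : E →L[ℝ] E} (hA : A ∈ skewOperators E)
    (x : E) : ‖exp A x‖ = ‖x‖ := by
  have inner_exp : inner ℝ (exp A x) (exp A x) = inner ℝ x x :=
    bilin_exp_exp_of_skew (B := innerₗ E) hA x x
  rw [norm_eq_sqrt_real_inner, inner_exp, ← norm_eq_sqrt_real_inner]

-- The scalar is the common value of the quotients `⟪l x, x⟫ / ‖x‖²`.
theorem exists_eq_smul_one_add_skew [Nontrivial E] {l : E →L[ℝ] E}
    (hl : ∀ x y : E, inner ℝ (l x) x * ‖y‖ ^ 2 = inner ℝ (l y) y * ‖x‖ ^ 2) :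
    ∃ a : ℝ, ∃ A ∈ skewOperators E, l = a • 1 + A := by
  obtain ⟨y, hy⟩ := exists_ne (0 : E)
  refine ⟨inner ℝ (l y) y / ‖y‖ ^ 2, l - (inner ℝ (l y) y / ‖y‖ ^ 2) • 1,
    mem_skewOperators_iff_inner_self.2 fun x => ?_, by simp⟩
  rw [sub_apply, smul_apply, one_apply_eq_self, inner_sub_left, real_inner_smul_left,
    real_inner_self_eq_norm_sq, div_mul_eq_mul_div, ← hl,
    mul_div_cancel_right₀ _ (pow_ne_zero 2 (norm_ne_zero_iff.2 hy)), sub_self]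

end Skew

/-! ### Infinitesimal similarities -/

section Affine

theorem Sim.norm_sub {E : Type*} [NormedAddCommGroup E] (f : E ≃ᵈ E) (x y : E) :
    ‖f x - f y‖ = Dilation.ratio f * ‖x - y‖ := by
  simpa only [dist_eq_norm] using Dilation.dist_eq f x y

variable {E : Type*} [NormedAddCommGroup E] [InnerProductSpace ℝ E]

/-- The affine vector field `x ↦ l x + X` in homogeneous coordinates. -/
def affineField (l : E →L[ℝ] E) (X : E) : (E × ℝ) →L[ℝ] (E × ℝ) :=
  (l ∘L ContinuousLinearMap.fst ℝ E ℝ + (ContinuousLinearMap.snd ℝ E ℝ).smulRight X).prod 0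

@[simp]
theorem affineField_apply (l : E →L[ℝ] E) (X : E) (v : E × ℝ) :
    affineField l X v = (l v.1 + v.2 • X, 0) := by
  simp [affineField]

theorem smul_affineField (t : ℝ) (l : E →L[ℝ] E) (X : E) :
    t • affineField l X = affineField (t • l) (t • X) :=
  ContinuousLinearMap.ext fun v => by simp [smul_smul, mul_comm]

theorem add_affineField (l m : E →L[ℝ] E) (X Y : E) :
    affineField l X + affineField m Y = affineField (l + m) (X + Y) :=
  ContinuousLinearMap.ext fun v => by simp [add_add_add_comm]

theorem lie_affineField (l m : E →L[ℝ] E) (X Y : E) :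
    ⁅affineField l X, affineField m Y⁆ = affineField ⁅l, m⁆ (l Y - m X) := by
  refine ContinuousLinearMap.ext fun v => ?_
  simp only [LieRing.of_associative_ring_bracket, sub_apply, mul_apply_eq_comp, affineField_apply,
    map_add, map_smul, zero_smul, add_zero, smul_sub, Prod.mk_sub_mk, sub_zero, Prod.mk.injEq,
    and_true]
  abel

theorem exists_eq_affineField {T : (E × ℝ) →L[ℝ] (E × ℝ)} (h : ∀ x : E, (T (x, 1)).2 = 0) :
    ∃ (l : E →L[ℝ] E) (X : E), T = affineField l X := by
  have snd_linear (x : E) : (T (x, 0)).2 = 0 := by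
    rw [show ((x, 0) : E × ℝ) = (x, 1) - (0, 1) by simp, map_sub, Prod.snd_sub, h, h, sub_zero]
  refine ⟨ContinuousLinearMap.fst ℝ E ℝ ∘L T ∘L ContinuousLinearMap.inl ℝ E ℝ, (T (0, 1)).1,
    ContinuousLinearMap.ext fun v => ?_⟩
  rw [show v = (v.1, 0) + v.2 • ((0, 1) : E × ℝ) by ext <;> simp, map_add, map_smul]
  ext <;> simp [h, snd_linear]

section Exp

variable [CompleteSpace E]

theorem exp_affineField_linear (l : E →L[ℝ] E) (X x : E) :
    exp (affineField l X) (x, 0) = (exp l x, 0) := by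
  simpa using (map_exp_apply_of_intertwines (P := ContinuousLinearMap.inl ℝ E ℝ) (S := l)
    (T := affineField l X) (by simp) x).symm

theorem exp_affineField_apply (l : E →L[ℝ] E) (X x : E) :
    exp (affineField l X) (x, 1) = (exp l x + (exp (affineField l X) (0, 1)).1, 1) := by
  have snd_eq : (exp (affineField l X) (0, 1)).2 = 1 := by
    simpa using map_exp_apply_of_intertwines (P := ContinuousLinearMap.snd ℝ E ℝ)
      (S := affineField l X) (T := 0) (by simp) (0, 1)
  rw [show ((x, 1) : E × ℝ) = (x, 0) + (0, 1) by simp, map_add, exp_affineField_linear]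
  ext <;> simp [snd_eq]

theorem exp_affineField_zero (X x : E) :
    exp (affineField (0 : E →L[ℝ] E) X) (x, 1) = (x + X, 1) := by
  rw [exp_apply_of_sq_apply_eq_zero] <;> simp

theorem mem_lieSet_homogeneous_iff {G : Subgroup (Sim E)} {T : (E × ℝ) →L[ℝ] (E × ℝ)} :
    T ∈ lieSet (homogeneous G) ↔ ∀ t : ℝ, ∃ f ∈ G, ∀ x : E, exp (t • T) (x, 1) = (f x, 1) :=
  mem_lieSet_iff

theorem affineField_mem_lieSet_iff {G : Subgroup (Sim E)} {l : E →L[ℝ] E} {X : E} :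
    affineField l X ∈ lieSet (homogeneous G) ↔
      ∀ t : ℝ, ∃ f ∈ G, ∀ x : E, exp (affineField (t • l) (t • X)) (x, 1) = (f x, 1) := by
  simp_rw [mem_lieSet_homogeneous_iff, smul_affineField]

theorem exists_affineField_of_mem_lieSet {G : Subgroup (Sim E)} {T : (E × ℝ) →L[ℝ] (E × ℝ)}
    (hT : T ∈ lieSet (homogeneous G)) : ∃ (l : E →L[ℝ] E) (X : E), T = affineField l X := by
  refine exists_eq_affineField fun x => ?_
  have hderiv := (ContinuousLinearMap.snd ℝ E ℝ).hasFDerivAt.comp_hasDerivAt (0 : ℝ)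
    (hasDerivAt_exp_smul_apply_zero T (x, 1))
  have snd_const : ContinuousLinearMap.snd ℝ E ℝ ∘ (fun t : ℝ => exp (t • T) (x, 1)) =
      fun _ => 1 := by
    funext t
    obtain ⟨f, -, hf⟩ := mem_lieSet_homogeneous_iff.1 hT t
    simp [hf]
  rw [snd_const] at hderiv
  exact hderiv.unique (hasDerivAt_const 0 _)

theorem exists_norm_exp_linear_eq_mul {G : Subgroup (Sim E)} {l : E →L[ℝ] E} {X : E}
    (hT : affineField l X ∈ lieSet (homogeneous G)) (t : ℝ) :
    ∃ r : ℝ, ∀ x, ‖exp (t • l) x‖ = r * ‖x‖ := by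
  obtain ⟨f, -, hf⟩ := affineField_mem_lieSet_iff.1 hT t
  have apply_eq (x : E) : f x = exp (t • l) x + (exp (affineField (t • l) (t • X)) (0, 1)).1 :=
    congrArg Prod.fst ((hf x).symm.trans (exp_affineField_apply _ _ x))
  exact ⟨Dilation.ratio f, fun x => by simpa [apply_eq] using Sim.norm_sub f x 0⟩

end Exp

variable [FiniteDimensional ℝ E]

-- Both sides are derivatives at `0` of `‖exp (t l) x‖² ‖y‖² = ‖exp (t l) y‖² ‖x‖²`.
theorem inner_apply_self_mul_eq_of_norm_exp {l : E →L[ℝ] E}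
    (h : ∀ t : ℝ, ∃ r : ℝ, ∀ x, ‖exp (t • l) x‖ = r * ‖x‖) (x y : E) :
    inner ℝ (l x) x * ‖y‖ ^ 2 = inner ℝ (l y) y * ‖x‖ ^ 2 := by
  have hasDerivAt_normSq (x : E) :
      HasDerivAt (fun t : ℝ => ‖exp (t • l) x‖ ^ 2) (2 * inner ℝ (l x) x) 0 := by
    simpa [real_inner_comm (l x) x, two_mul] using hasDerivAt_bilin_exp (innerₗ E) l x x
  have normSq_mul_eq : (fun t : ℝ => ‖exp (t • l) x‖ ^ 2 * ‖y‖ ^ 2) =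
      fun t : ℝ => ‖exp (t • l) y‖ ^ 2 * ‖x‖ ^ 2 := by
    funext t
    obtain ⟨r, hr⟩ := h t
    rw [hr, hr]
    ring
  have hx := (hasDerivAt_normSq x).mul_const (‖y‖ ^ 2)
  rw [normSq_mul_eq] at hx
  linarith [hx.unique ((hasDerivAt_normSq y).mul_const (‖x‖ ^ 2))]

theorem exists_of_mem_lieSet_homogeneous [Nontrivial E] {G : Subgroup (Sim E)}
    {T : (E × ℝ) →L[ℝ] (E × ℝ)} (hT : T ∈ lieSet (homogeneous G)) :
    ∃ a : ℝ, ∃ A ∈ skewOperators E, ∃ X : E, T = affineField (a • 1 + A) X := by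
  obtain ⟨l, X, rfl⟩ := exists_affineField_of_mem_lieSet hT
  obtain ⟨a, A, hA, rfl⟩ := exists_eq_smul_one_add_skew
    (inner_apply_self_mul_eq_of_norm_exp (exists_norm_exp_linear_eq_mul hT))
  exact ⟨a, A, hA, X, rfl⟩

end Affine

/-! ### The Lorentzian form and the Lie algebra of the stabilizer of `ℝp` -/

section Lorentz

variable {E : Type*} [NormedAddCommGroup E] [InnerProductSpace ℝ E]

theorem eta_apply (v w : Mink E) :
    eta v w = v.1 * w.2.2 + inner ℝ v.2.1 w.2.1 + v.2.2 * w.1 := rfl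

theorem eta_comm (v w : Mink E) : eta v w = eta w v := by
  rw [eta_apply, eta_apply, real_inner_comm]
  ring

theorem eta_isRefl : (eta (E := E)).IsRefl := fun v w h => by rw [eta_comm, h]

theorem eta_vecP (v : Mink E) : eta v vecP = v.2.2 := by simp [eta_apply, vecP]

theorem eta_separatingLeft : (eta (E := E)).SeparatingLeft := by
  rintro ⟨x, Y, z⟩ h
  have hx := h (0, 0, 1)
  have hY := h (0, Y, 0)
  have hz := h (1, 0, 0)
  simp only [eta_apply, mul_one, mul_zero, inner_zero_right, add_zero, zero_add,
    inner_self_eq_zero] at hx hY hz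
  simp [hx, hY, hz]

theorem eta_nondegenerate : (eta (E := E)).Nondegenerate :=
  ⟨eta_separatingLeft, fun v h => eta_separatingLeft v fun w => by rw [eta_comm, h]⟩

theorem add_triple (a b : ℝ) (A B : E →L[ℝ] E) (X Y : E) :
    triple a A X + triple b B Y = triple (a + b) (A + B) (X + Y) := by
  refine ContinuousLinearMap.ext fun ⟨x, y, z⟩ => ?_
  simp only [add_apply, triple_apply, Prod.mk_add_mk, inner_add_left, smul_add, Prod.mk.injEq]
  exact ⟨by ring, by abel, by ring⟩

theorem smul_triple (t a : ℝ) (A : E →L[ℝ] E) (X : E) :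
    t • triple a A X = triple (t * a) (t • A) (t • X) := by
  refine ContinuousLinearMap.ext fun ⟨x, y, z⟩ => ?_
  simp only [smul_apply, triple_apply, Prod.smul_mk, real_inner_smul_left, smul_add, smul_eq_mul,
    smul_smul, Prod.mk.injEq]
  exact ⟨by ring, by rw [mul_comm], by ring⟩

theorem sub_triple (a b : ℝ) (A B : E →L[ℝ] E) (X Y : E) :
    triple a A X - triple b B Y = triple (a - b) (A - B) (X - Y) := by
  rw [sub_eq_iff_eq_add, add_triple, sub_add_cancel, sub_add_cancel, sub_add_cancel]

theorem triple_zero : triple 0 (0 : E →L[ℝ] E) (0 : E) = 0 := by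
  simpa using (smul_triple 0 0 (0 : E →L[ℝ] E) 0).symm

theorem triple_inj {a b : ℝ} {A B : E →L[ℝ] E} {X Y : E} :
    triple a A X = triple b B Y ↔ a = b ∧ A = B ∧ X = Y := by
  refine ⟨fun h => ?_, by rintro ⟨rfl, rfl, rfl⟩; rfl⟩
  have happly (v : Mink E) : triple a A X v = triple b B Y v := by rw [h]
  refine ⟨?_, ContinuousLinearMap.ext fun y => ?_, ?_⟩
  · simpa [triple_apply] using congrArg Prod.fst (happly (1, 0, 0))
  · simpa [triple_apply] using congrArg (fun v => v.2.1) (happly (0, y, 0))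
  · simpa [triple_apply] using congrArg (fun v => v.2.1) (happly (0, 0, 1))

theorem lie_triple {a b : ℝ} {A B : E →L[ℝ] E} (hA : A ∈ skewOperators E)
    (hB : B ∈ skewOperators E) (X Y : E) :
    ⁅triple a A X, triple b B Y⁆ = triple 0 ⁅A, B⁆ ((a • 1 + A) Y - (b • 1 + B) X) := by
  refine ContinuousLinearMap.ext fun ⟨x, y, z⟩ => ?_
  simp only [LieRing.of_associative_ring_bracket, sub_apply, add_apply, smul_apply,
    one_apply_eq_self, mul_apply_eq_comp, triple_apply, map_add, map_smul, Prod.mk_sub_mk,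
    inner_add_right, inner_add_left, inner_sub_left, real_inner_smul_left, real_inner_smul_right,
    hA Y y, hB X y, real_inner_comm X Y, Prod.mk.injEq]
  exact ⟨by ring, by module, by ring⟩

theorem eta_triple_apply_of_skew {A : E →L[ℝ] E} (hA : A ∈ skewOperators E) (a : ℝ) (X : E)
    (v w : Mink E) : eta (triple a A X v) w = -eta v (triple a A X w) := by
  obtain ⟨x, y, z⟩ := v
  obtain ⟨x', y', z'⟩ := w
  simp only [eta_apply, triple_apply, inner_add_left, inner_add_right, real_inner_smul_left,
    real_inner_smul_right, hA y y', real_inner_comm X y]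
  ring

theorem triple_vecP (a : ℝ) (A : E →L[ℝ] E) (X : E) : triple a A X vecP = a • vecP := by
  simp [vecP, triple_apply]

theorem mk_eq_smul_vecP_add (x : ℝ) (Y : E) (z : ℝ) :
    ((x, Y, z) : Mink E) = x • vecP + (0, Y, 0) + z • ((0, 0, 1) : Mink E) := by
  simp [vecP]

-- With `T p = a p`, skewness leaves only `A = π_E ∘ T|_E` and `X = π_E (T q)` undetermined.
theorem exists_eq_triple_of_skew {T : Mink E →L[ℝ] Mink E}
    (h : ∀ v w, eta (T v) w = -eta v (T w)) (hp : T vecP ∈ Submodule.span ℝ {vecP (E := E)}) :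
    ∃ a : ℝ, ∃ A ∈ skewOperators E, ∃ X : E, T = triple a A X := by
  obtain ⟨a, ha⟩ := Submodule.mem_span_singleton.1 hp
  let ι : E →L[ℝ] Mink E := ContinuousLinearMap.inr ℝ ℝ (E × ℝ) ∘L ContinuousLinearMap.inl ℝ E ℝ
  let π : Mink E →L[ℝ] E := ContinuousLinearMap.fst ℝ E ℝ ∘L ContinuousLinearMap.snd ℝ ℝ (E × ℝ)
  let A : E →L[ℝ] E := π ∘L T ∘L ι
  have hA : A ∈ skewOperators E := fun Y Z => by
    simpa [eta_apply, A, ι, π] using h (0, Y, 0) (0, Z, 0)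
  have snd_snd (v : Mink E) : (T v).2.2 = -(a * v.2.2) := by
    rw [← eta_vecP, h, ← ha, map_smul, eta_vecP, smul_eq_mul]
  have fst_q : (T (0, 0, 1)).1 = 0 := by
    have skew_q := h (0, 0, 1) (0, 0, 1)
    simp only [eta_apply, zero_mul, mul_one, inner_zero_left, inner_zero_right, mul_zero] at skew_q
    linarith
  have fst_E (Y : E) : (T (0, Y, 0)).1 = -inner ℝ (T (0, 0, 1)).2.1 Y := by
    simpa [eta_apply, real_inner_comm] using h (0, Y, 0) (0, 0, 1)
  refine ⟨a, A, hA, (T (0, 0, 1)).2.1, ContinuousLinearMap.ext fun ⟨x, Y, z⟩ => ?_⟩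
  rw [triple_apply]
  refine Prod.ext ?_ (Prod.ext ?_ (snd_snd _))
  all_goals rw [mk_eq_smul_vecP_add, map_add, map_add, map_smul, map_smul, ← ha]
  · simp [vecP, fst_q, fst_E]
    ring
  · simp [vecP, A, ι, π]

/-! ### The isotropic vectors and the stabilizer of `ℝp` -/

theorem mem_lobachevsky_iff {v : Mink E} : v ∈ lobachevsky E ↔ eta v v = -1 ∧ v.2.2 < 0 := by
  refine and_congr_right fun h => ?_
  rw [div_pos_iff_of_pos_right (by positivity : (0 : ℝ) < √2)]
  have mul_neg : v.1 * v.2.2 < 0 := by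
    rw [eta_apply] at h
    nlinarith [real_inner_self_nonneg (x := v.2.1)]
  rcases mul_neg_iff.1 mul_neg with ⟨hpos, hneg⟩ | ⟨hneg, hpos⟩
  · exact iff_of_true (by linarith) hneg
  · exact iff_of_false (by linarith) (by linarith)

/-- The isotropic vector `-½|Y|²p + Y + q` spanning the line that corresponds to the point `Y`. -/
def nullVec (Y : E) : Mink E := (-(1 / 2) * ‖Y‖ ^ 2, Y, 1)

theorem eta_nullVec (Y Z : E) : eta (nullVec Y) (nullVec Z) = -(1 / 2) * ‖Y - Z‖ ^ 2 := by
  simp only [eta_apply, nullVec, norm_sub_sq_real]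
  ring

theorem vecP_eq_smul_nullVec {Y : E} (hY : Y ≠ 0) :
    vecP = (-(‖Y‖ ^ 2)⁻¹) • (nullVec Y + nullVec (-Y) - (2 : ℝ) • nullVec (0 : E)) := by
  have : ‖Y‖ ≠ 0 := norm_ne_zero_iff.2 hY
  simp only [nullVec, vecP, Prod.mk_add_mk, Prod.smul_mk, Prod.mk_sub_mk, norm_neg, norm_zero]
  refine Prod.ext ?_ (Prod.ext ?_ ?_)
  · simp
    field_simp
    norm_num
  · simp
  · simp
    norm_num

theorem span_range_nullVec [Nontrivial E] :
    Submodule.span ℝ (Set.range (nullVec (E := E))) = ⊤ := by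
  have nullVec_mem (Y : E) : nullVec Y ∈ Submodule.span ℝ (Set.range (nullVec (E := E))) :=
    Submodule.subset_span ⟨Y, rfl⟩
  obtain ⟨Y, hY⟩ := exists_ne (0 : E)
  have vecP_mem : vecP ∈ Submodule.span ℝ (Set.range (nullVec (E := E))) := by
    rw [vecP_eq_smul_nullVec hY]
    exact Submodule.smul_mem _ _ (sub_mem (add_mem (nullVec_mem _) (nullVec_mem _))
      (Submodule.smul_mem _ _ (nullVec_mem _)))
  refine eq_top_iff.2 fun v _ => ?_
  have decomposition : v = (v.1 + (1 / 2) * ‖v.2.1‖ ^ 2) • vecP + nullVec v.2.1 +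
      (v.2.2 - 1) • nullVec 0 := by
    obtain ⟨x, Y, z⟩ := v
    simp [nullVec, vecP]
  rw [decomposition]
  exact add_mem (add_mem (Submodule.smul_mem _ _ vecP_mem) (nullVec_mem _))
    (Submodule.smul_mem _ _ (nullVec_mem _))

theorem clm_ext_nullVec [Nontrivial E] {S T : Mink E →L[ℝ] Mink E}
    (h : ∀ Y, S (nullVec Y) = T (nullVec Y)) : S = T :=
  ContinuousLinearMap.coe_injective (LinearMap.ext_on_range span_range_nullVec h)

theorem eq_of_eta_self_eq_of_snd_eq {v w : Mink E} (h : eta v v = eta w w) (hsnd : v.2 = w.2)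
    (hw : w.2.2 ≠ 0) : v = w := by
  refine Prod.ext (mul_right_cancel₀ hw ?_) hsnd
  rw [eta_apply, eta_apply, hsnd] at h
  linarith

theorem exists_pos_of_mem_specialOrthogonalP {M : (Mink E →L[ℝ] Mink E)ˣ}
    (hM : M ∈ specialOrthogonalP E) : ∃ c : ℝ, 0 < c ∧ ∀ v, (M.val v).2.2 = c⁻¹ * v.2.2 := by
  obtain ⟨-, isometry, mem_lobachevsky, mem_line⟩ := hM
  obtain ⟨c, hc⟩ := Submodule.mem_span_singleton.1
    ((mem_line vecP).2 (Submodule.mem_span_singleton_self _))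
  have mul_snd_snd (v : Mink E) : c * (M.val v).2.2 = v.2.2 := by
    have isometry_p := isometry v vecP
    rwa [← hc, map_smul, eta_vecP, eta_vecP] at isometry_p
  have hpos : 0 < c := by
    have mem : ((1, 0, -(1 / 2)) : Mink E) ∈ lobachevsky E := by
      rw [mem_lobachevsky_iff, eta_apply]
      norm_num
    have image_neg := (mem_lobachevsky_iff.1 ((mem_lobachevsky _).2 mem)).2
    refine pos_of_mul_neg_left ?_ image_neg.le
    rw [mul_snd_snd]
    norm_num
  refine ⟨c, hpos, fun v => ?_⟩
  rw [← mul_snd_snd v, inv_mul_cancel_left₀ hpos.ne']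

theorem induces_iff {M : (Mink E →L[ℝ] Mink E)ˣ} {f : Sim E} {c : ℝ} (hc : 0 < c)
    (hM : ∀ v, (M.val v).2.2 = c⁻¹ * v.2.2) :
    Induces M f ↔ ∀ Y, M.val (nullVec Y) = c⁻¹ • nullVec (f Y) := by
  refine forall_congr' fun Y => ?_
  rw [isotropicLine, isotropicLine, Submodule.map_span, Set.image_singleton]
  change Submodule.span ℝ {M.val (nullVec Y)} = Submodule.span ℝ {nullVec (f Y)} ↔ _
  refine ⟨fun h => ?_, fun h => ?_⟩
  · obtain ⟨d, hd⟩ := Submodule.mem_span_singleton.1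
      (h ▸ Submodule.mem_span_singleton_self (M.val (nullVec Y)))
    have snd_snd := hM (nullVec Y)
    rw [← hd] at snd_snd ⊢
    rw [show d = c⁻¹ by simpa [nullVec] using snd_snd]
  · rw [h]
    exact Submodule.span_singleton_smul_eq (IsUnit.mk0 _ (inv_pos.2 hc).ne') _

theorem Induces.apply_nullVec [Nontrivial E] {M : (Mink E →L[ℝ] Mink E)ˣ} {f : Sim E}
    (hM : M ∈ specialOrthogonalP E) (h : Induces M f) (Y : E) :
    M.val (nullVec Y) = (Dilation.ratio f : ℝ)⁻¹ • nullVec (f Y) := by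
  obtain ⟨c, hc, hMc⟩ := exists_pos_of_mem_specialOrthogonalP hM
  have apply_eq := (induces_iff hc hMc).1 h
  obtain ⟨Z, hZ⟩ := exists_ne (0 : E)
  have isometry_Z := hM.2.1 (nullVec Z) (nullVec 0)
  simp only [apply_eq, map_smul, LinearMap.smul_apply, eta_nullVec, smul_eq_mul, sub_zero]
    at isometry_Z
  have norm_eq : c⁻¹ * ‖f Z - f 0‖ = ‖Z‖ := by
    rw [← sq_eq_sq₀ (by positivity) (norm_nonneg _), mul_pow]
    linarith
  have ratio_eq : (Dilation.ratio f : ℝ) = c := by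
    rw [Sim.norm_sub, sub_zero, ← mul_assoc, mul_eq_right₀ (norm_ne_zero_iff.2 hZ),
      inv_mul_eq_one₀ hc.ne'] at norm_eq
    exact norm_eq.symm
  rw [ratio_eq, apply_eq]

theorem Induces.unique [Nontrivial E] {M N : (Mink E →L[ℝ] Mink E)ˣ} {f : Sim E}
    (hM : M ∈ specialOrthogonalP E) (hN : N ∈ specialOrthogonalP E)
    (h : Induces M f) (k : Induces N f) : M = N :=
  Units.ext (clm_ext_nullVec fun Y => by rw [h.apply_nullVec hM, k.apply_nullVec hN])

section Exp

variable [FiniteDimensional ℝ E]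

theorem snd_exp_triple_apply (a : ℝ) (A : E →L[ℝ] E) (X : E) (v : Mink E) :
    (exp (triple a A X) v).2 = Real.exp (-a) • exp (affineField (a • 1 + A) X) v.2 := by
  have hexp := map_exp_apply_of_intertwines (P := ContinuousLinearMap.snd ℝ ℝ (E × ℝ))
    (S := triple a A X) (T := (-a) • 1 + affineField (a • 1 + A) X) (by
      rintro ⟨x, Y, z⟩
      simp [triple_apply]
      abel) v
  rwa [exp_smul_one_add] at hexp

theorem snd_snd_exp_triple_apply (a : ℝ) (A : E →L[ℝ] E) (X : E) (v : Mink E) :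
    (exp (triple a A X) v).2.2 = (Real.exp a)⁻¹ * v.2.2 := by
  have snd_exp : (exp (affineField (a • 1 + A) X) v.2).2 = v.2.2 := by
    simpa using map_exp_apply_of_intertwines (P := ContinuousLinearMap.snd ℝ E ℝ)
      (S := affineField (a • 1 + A) X) (T := 0) (by simp) v.2
  rw [snd_exp_triple_apply, Prod.smul_snd, snd_exp, Real.exp_neg, smul_eq_mul]

theorem expUnit_triple_mem {A : E →L[ℝ] E} (hA : A ∈ skewOperators E) (a : ℝ) (X : E) :
    expUnit (triple a A X) ∈ specialOrthogonalP E := by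
  have isometry := bilin_exp_exp_of_skew (eta_triple_apply_of_skew hA a X)
  refine ⟨det_exp_of_skew eta_nondegenerate (eta_triple_apply_of_skew hA a X), isometry,
    fun v => ?_, fun v => ?_⟩
  · rw [mem_lobachevsky_iff, mem_lobachevsky_iff, coe_expUnit, isometry, snd_snd_exp_triple_apply]
    exact and_congr_right fun _ => smul_neg_iff_of_pos_left (inv_pos.2 (Real.exp_pos a))
  · refine exp_apply_mem_iff_of_invariant (Submodule.closed_of_finiteDimensional _) fun w hw => ?_
    obtain ⟨c, rfl⟩ := Submodule.mem_span_singleton.1 hw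
    rw [map_smul, triple_vecP]
    exact Submodule.smul_mem _ _ (Submodule.smul_mem _ _ (Submodule.mem_span_singleton_self _))

theorem expUnit_triple_induces_iff {A : E →L[ℝ] E} (hA : A ∈ skewOperators E) (a : ℝ) (X : E)
    (f : Sim E) : Induces (expUnit (triple a A X)) f ↔
      ∀ x : E, exp (affineField (a • 1 + A) X) (x, 1) = (f x, 1) := by
  rw [induces_iff (Real.exp_pos a) (snd_snd_exp_triple_apply a A X)]
  have snd_exp (x : E) : (exp (triple a A X) (nullVec x)).2 =
      (Real.exp a)⁻¹ • exp (affineField (a • 1 + A) X) (x, 1) := by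
    rw [snd_exp_triple_apply, Real.exp_neg]
    rfl
  have hpos := inv_pos.2 (Real.exp_pos a)
  refine forall_congr' fun x => ⟨fun h => ?_, fun h => ?_⟩
  · exact smul_right_injective _ hpos.ne' ((snd_exp x).symm.trans (congrArg Prod.snd h))
  · refine eq_of_eta_self_eq_of_snd_eq ?_ ((snd_exp x).trans (by rw [h]; rfl)) ?_
    · rw [coe_expUnit, bilin_exp_exp_of_skew (eta_triple_apply_of_skew hA a X)]
      simp [eta_nullVec]
    · simp [nullVec]

end Exp

end Lorentz

/-! ### The Lie algebra of the Lorentzian group of a connected group of similarities -/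

section Correspondence

variable {E : Type*} [NormedAddCommGroup E] [InnerProductSpace ℝ E]

theorem Sim.exists_linear (f : Sim E) :
    ∃ r : ℝ, 0 < r ∧ ∃ R : E ≃ₗᵢ[ℝ] E, ∀ x, f x = r • R x + f 0 := by
  have hr : (0 : ℝ) < Dilation.ratio f := by exact_mod_cast Dilation.ratio_pos f
  let g : E ≃ᵢ E :=
    { toEquiv := f.toEquiv.trans
        (LinearEquiv.smulOfNeZero ℝ E (Dilation.ratio f : ℝ)⁻¹ (inv_ne_zero hr.ne')).toEquiv
      isometry_toFun := by
        refine Isometry.of_dist_eq fun x y => ?_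
        change dist ((Dilation.ratio f : ℝ)⁻¹ • f x) ((Dilation.ratio f : ℝ)⁻¹ • f y) = _
        rw [dist_smul₀, dist_eq_norm (f x), Sim.norm_sub, dist_eq_norm, norm_inv,
          Real.norm_of_nonneg hr.le, inv_mul_cancel_left₀ hr.ne'] }
  have g_apply (x : E) : g x = (Dilation.ratio f : ℝ)⁻¹ • f x := rfl
  refine ⟨Dilation.ratio f, hr, g.toRealAffineIsometryEquiv.linearIsometryEquiv, fun x => ?_⟩
  have g_affine := g.toRealAffineIsometryEquiv.map_vadd 0 x
  simp only [vadd_eq_add, add_zero, IsometryEquiv.coeFn_toRealAffineIsometryEquiv, g_apply]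
    at g_affine
  simpa [smul_smul, hr.ne'] using congrArg (fun y => (Dilation.ratio f : ℝ) • y) g_affine

theorem clm_ext_affine {E F : Type*} [NormedAddCommGroup E] [NormedSpace ℝ E]
    [NormedAddCommGroup F] [NormedSpace ℝ F] {S T : (E × ℝ) →L[ℝ] F}
    (h : ∀ x : E, S (x, 1) = T (x, 1)) : S = T := by
  refine ContinuousLinearMap.ext fun v => ?_
  rw [show v = ((v.1, 1) : E × ℝ) + (v.2 - 1) • ((0, 1) : E × ℝ) by ext <;> simp, map_add,
    map_add, map_smul, map_smul, h, h]

theorem Sim.exists_clm (f : Sim E) :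
    ∃ M : (E × ℝ) →L[ℝ] (E × ℝ), ∀ x : E, M (x, 1) = (f x, 1) := by
  obtain ⟨r, -, R, hf⟩ := f.exists_linear
  refine ⟨((r • (R.toContinuousLinearEquiv : E →L[ℝ] E)) ∘L ContinuousLinearMap.fst ℝ E ℝ +
    (ContinuousLinearMap.snd ℝ E ℝ).smulRight (f 0)).prod (ContinuousLinearMap.snd ℝ E ℝ),
    fun x => ?_⟩
  rw [hf x]
  simp

theorem Sim.exists_homogeneous (f : Sim E) :
    ∃ M : ((E × ℝ) →L[ℝ] (E × ℝ))ˣ, ∀ x : E, M.val (x, 1) = (f x, 1) := by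
  obtain ⟨M, hM⟩ := f.exists_clm
  obtain ⟨N, hN⟩ := f⁻¹.exists_clm
  refine ⟨⟨M, N, clm_ext_affine fun x => ?_, clm_ext_affine fun x => ?_⟩, hM⟩
  · rw [mul_apply_eq_comp, hN, hM]
    exact congrArg (·, (1 : ℝ)) (f.apply_symm_apply x)
  · rw [mul_apply_eq_comp, hM, hN]
    exact congrArg (·, (1 : ℝ)) (f.symm_apply_apply x)

theorem homogeneous_le_homogeneous_iff {G H : Subgroup (Sim E)} :
    homogeneous G ≤ homogeneous H ↔ G ≤ H := by
  refine ⟨fun h f hf => ?_, fun h M ⟨f, hf, hM⟩ => ⟨f, h hf, hM⟩⟩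
  obtain ⟨M, hM⟩ := f.exists_homogeneous
  obtain ⟨g, hg, hMg⟩ := h ⟨f, hf, hM⟩
  rwa [show f = g from DilationEquiv.ext fun x =>
    congrArg Prod.fst ((hM x).symm.trans (hMg x))]

theorem Induces.one : Induces (1 : (Mink E →L[ℝ] Mink E)ˣ) 1 := fun _ => Submodule.map_id _

theorem Induces.mul {M N : (Mink E →L[ℝ] Mink E)ˣ} {f g : Sim E} (h : Induces M f)
    (k : Induces N g) : Induces (M * N) (f * g) := by
  intro Y
  rw [show (f * g) Y = f (g Y) from rfl, ← h (g Y), ← k Y, ← Submodule.map_comp]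
  rfl

theorem Induces.inv {M : (Mink E →L[ℝ] Mink E)ˣ} {f : Sim E} (h : Induces M f) :
    Induces M⁻¹ f⁻¹ := by
  intro Y
  have inv_comp : (M⁻¹.val : Mink E →ₗ[ℝ] Mink E) ∘ₗ (M.val : Mink E →ₗ[ℝ] Mink E) =
      LinearMap.id := by
    ext1 <;> ext <;> simp [← mul_apply_eq_comp]
  rw [show isotropicLine Y = _ from (congrArg isotropicLine (f.apply_symm_apply Y)).symm.trans
    (h (f⁻¹ Y)).symm, ← Submodule.map_comp, inv_comp, Submodule.map_id]

/-- The subalgebra of `𝔰𝔬(V)_{ℝp}` that corresponds to the Lie algebra `𝔥` of infinitesimal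
similarities: the triple `(a, A, X)` corresponds to the vector field `x ↦ (a + A) x + X`. -/
def lorentzAlgebra (𝔥 : LieSubalgebra ℝ ((E × ℝ) →L[ℝ] (E × ℝ))) :
    LieSubalgebra ℝ (Mink E →L[ℝ] Mink E) where
  carrier := {T | ∃ (a : ℝ) (A : E →L[ℝ] E) (X : E),
    A ∈ skewOperators E ∧ affineField (a • 1 + A) X ∈ 𝔥 ∧ T = triple a A X}
  add_mem' := by
    rintro _ _ ⟨a, A, X, hA, hS, rfl⟩ ⟨b, B, Y, hB, hT, rfl⟩
    refine ⟨_, _, _, add_mem hA hB, ?_, add_triple ..⟩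
    rw [add_smul, add_add_add_comm, ← add_affineField]
    exact add_mem hS hT
  zero_mem' := by
    refine ⟨0, 0, 0, zero_mem _, ?_, triple_zero.symm⟩
    rw [zero_smul, zero_add, show affineField (0 : E →L[ℝ] E) 0 = 0 by ext <;> simp]
    exact zero_mem 𝔥
  smul_mem' := by
    rintro t _ ⟨a, A, X, hA, hS, rfl⟩
    refine ⟨_, _, _, (skewOperators E).smul_mem t hA, ?_, smul_triple ..⟩
    rw [mul_smul, ← smul_add, ← smul_affineField]
    exact 𝔥.smul_mem t hS
  lie_mem' := by
    rintro _ _ ⟨a, A, X, hA, hS, rfl⟩ ⟨b, B, Y, hB, hT, rfl⟩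
    refine ⟨_, _, _, (skewOperators E).lie_mem hA hB, ?_, lie_triple hA hB X Y⟩
    rw [zero_smul, zero_add, show ⁅A, B⁆ = ⁅a • 1 + A, b • 1 + B⁆ by
      simp only [LieRing.of_associative_ring_bracket, add_mul, mul_add, smul_mul_assoc,
        mul_smul_comm, one_mul, mul_one]
      module, ← lie_affineField]
    exact 𝔥.lie_mem hS hT

variable {G : Subgroup (Sim E)} {𝔥 : LieSubalgebra ℝ ((E × ℝ) →L[ℝ] (E × ℝ))}

theorem triple_mem_lorentzAlgebra {a : ℝ} {A : E →L[ℝ] E} {X : E} :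
    triple a A X ∈ lorentzAlgebra 𝔥 ↔
      A ∈ skewOperators E ∧ affineField (a • 1 + A) X ∈ 𝔥 := by
  refine ⟨fun ⟨b, B, Y, hB, hT, h⟩ => ?_, fun ⟨hA, hT⟩ => ⟨a, A, X, hA, hT, rfl⟩⟩
  obtain ⟨rfl, rfl, rfl⟩ := triple_inj.1 h
  exact ⟨hB, hT⟩

theorem lorentzAlgebra_isSubalgebraOfSOP : IsSubalgebraOfSOP (lorentzAlgebra 𝔥) := by
  rintro _ ⟨a, A, X, hA, -, rfl⟩
  refine ⟨eta_triple_apply_of_skew hA a X, ?_⟩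
  rw [triple_vecP]
  exact Submodule.smul_mem _ _ (Submodule.mem_span_singleton_self _)

variable [FiniteDimensional ℝ E]

theorem triple_mem_lieSet_iff {a : ℝ} {A : E →L[ℝ] E} (hA : A ∈ skewOperators E) {X : E} :
    triple a A X ∈ lieSet (lorentzGroup G) ↔
      affineField (a • 1 + A) X ∈ lieSet (homogeneous G) := by
  rw [mem_lieSet_iff, affineField_mem_lieSet_iff]
  refine forall_congr' fun t => ?_
  have htA := (skewOperators E).smul_mem t hA
  rw [smul_triple, smul_add, smul_smul]
  refine ⟨fun ⟨_, f, hf, h⟩ => ⟨f, hf, (expUnit_triple_induces_iff htA _ _ f).1 h⟩,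
    fun ⟨f, hf, h⟩ => ⟨expUnit_triple_mem htA _ _, f, hf,
      (expUnit_triple_induces_iff htA _ _ f).2 h⟩⟩

theorem exists_triple_of_mem_lieSet {T : Mink E →L[ℝ] Mink E}
    (hT : T ∈ lieSet (lorentzGroup G)) :
    ∃ a : ℝ, ∃ A ∈ skewOperators E, ∃ X : E, T = triple a A X := by
  rw [mem_lieSet_iff] at hT
  exact exists_eq_triple_of_skew (bilin_skew_of_forall_exp fun t v w => (hT t).1.2.1 v w)
    (apply_mem_of_forall_exp_mem (Submodule.closed_of_finiteDimensional _)
      fun t => ((hT t).1.2.2.2 vecP).2 (Submodule.mem_span_singleton_self _))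

theorem coe_lorentzAlgebra (h : (𝔥 : Set ((E × ℝ) →L[ℝ] (E × ℝ))) = lieSet (homogeneous G)) :
    (lorentzAlgebra 𝔥 : Set (Mink E →L[ℝ] Mink E)) = lieSet (lorentzGroup G) := by
  have mem_iff (T : (E × ℝ) →L[ℝ] (E × ℝ)) : T ∈ 𝔥 ↔ T ∈ lieSet (homogeneous G) :=
    Set.ext_iff.1 h T
  refine Set.Subset.antisymm ?_ fun T hT => ?_
  · rintro _ ⟨a, A, X, hA, hT, rfl⟩
    exact (triple_mem_lieSet_iff hA).2 ((mem_iff _).1 hT)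
  · obtain ⟨a, A, hA, X, rfl⟩ := exists_triple_of_mem_lieSet hT
    exact ⟨a, A, X, hA, (mem_iff _).2 ((triple_mem_lieSet_iff hA).1 hT), rfl⟩

theorem closure_exp_le_of_coe_eq_lieSet {F : Type*} [NormedAddCommGroup F] [NormedSpace ℝ F]
    [CompleteSpace F] {G : Subgroup (F →L[ℝ] F)ˣ} {𝔤 : LieSubalgebra ℝ (F →L[ℝ] F)}
    (h : (𝔤 : Set (F →L[ℝ] F)) = lieSet G) :
    Subgroup.closure {g : (F →L[ℝ] F)ˣ | ∃ X ∈ 𝔤, (g : F →L[ℝ] F) = exp X} ≤ G := by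
  rw [Subgroup.closure_le]
  rintro g ⟨X, hX, hg⟩
  have hexp := mem_lieSet_iff.1 (Set.ext_iff.1 h X |>.1 hX) 1
  rwa [one_smul, show expUnit X = g from Units.ext hg.symm] at hexp

variable [Nontrivial E]

-- The similarities induced by the group generated by `exp 𝔤` form a group that contains the
-- generators of `G`.
theorem exists_mem_closure_induces (h : IsConnectedLieSubgroupWith (homogeneous G) 𝔥) {f : Sim E}
    (hf : f ∈ G) : ∃ M ∈ Subgroup.closure {g : (Mink E →L[ℝ] Mink E)ˣ |
      ∃ T ∈ lorentzAlgebra 𝔥, (g : Mink E →L[ℝ] Mink E) = exp T}, Induces M f := by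
  let induced : Subgroup (Sim E) :=
    { carrier := {f | ∃ M ∈ Subgroup.closure {g : (Mink E →L[ℝ] Mink E)ˣ |
        ∃ T ∈ lorentzAlgebra 𝔥, (g : Mink E →L[ℝ] Mink E) = exp T}, Induces M f}
      one_mem' := ⟨1, one_mem _, Induces.one⟩
      mul_mem' := fun ⟨M, hM, h⟩ ⟨N, hN, k⟩ => ⟨M * N, mul_mem hM hN, h.mul k⟩
      inv_mem' := fun ⟨M, hM, h⟩ => ⟨M⁻¹, inv_mem hM, h.inv⟩ }
  suffices homogeneous G ≤ homogeneous induced from homogeneous_le_homogeneous_iff.1 this hf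
  rw [h.generates, Subgroup.closure_le]
  rintro N ⟨T, hT, hN⟩
  have hTG : T ∈ lieSet (homogeneous G) := h.lie_eq ▸ hT
  obtain ⟨a, A, hA, X, rfl⟩ := exists_of_mem_lieSet_homogeneous hTG
  obtain ⟨g, -, hg⟩ := affineField_mem_lieSet_iff.1 hTG 1
  simp only [one_smul] at hg
  refine ⟨g, ⟨expUnit (triple a A X), ?_, (expUnit_triple_induces_iff hA a X g).2 hg⟩, ?_⟩
  · exact Subgroup.subset_closure ⟨_, triple_mem_lorentzAlgebra.2 ⟨hA, hT⟩, rfl⟩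
  · rwa [hN]

theorem lorentzGroup_isConnected (h : IsConnectedLieSubgroupWith (homogeneous G) 𝔥) :
    IsConnectedLieSubgroupWith (lorentzGroup G) (lorentzAlgebra 𝔥) where
  lie_eq := coe_lorentzAlgebra h.lie_eq
  generates := by
    have closure_le := closure_exp_le_of_coe_eq_lieSet (coe_lorentzAlgebra h.lie_eq)
    refine le_antisymm (fun M ⟨hM, f, hf, hMf⟩ => ?_) closure_le
    obtain ⟨N, hN, hNf⟩ := exists_mem_closure_induces h hf
    rwa [hMf.unique hM (closure_le hN).1 hNf]

theorem existsUnique_induces (h : IsConnectedLieSubgroupWith (homogeneous G) 𝔥) {f : Sim E}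
    (hf : f ∈ G) : ∃! M, M ∈ lorentzGroup G ∧ Induces M f := by
  obtain ⟨N, hN, hNf⟩ := exists_mem_closure_induces h hf
  have hNG := closure_exp_le_of_coe_eq_lieSet (coe_lorentzAlgebra h.lie_eq) hN
  exact ⟨N, ⟨hNG, hNf⟩, fun M hM => hM.2.unique hM.1.1 hNG.1 hNf⟩

end Correspondence

/-! ### Transitivity and weak irreducibility -/

section Transitivity

theorem vecP_ne_zero {E : Type*} [NormedAddCommGroup E] : (vecP : Mink E) ≠ 0 := by simp [vecP]

variable {E : Type*} [NormedAddCommGroup E] [InnerProductSpace ℝ E]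

theorem IsSubalgebraOfSOP.exists_eq_triple [FiniteDimensional ℝ E]
    {𝔤 : LieSubalgebra ℝ (Mink E →L[ℝ] Mink E)} (hsub : IsSubalgebraOfSOP 𝔤)
    {T : Mink E →L[ℝ] Mink E} (hT : T ∈ 𝔤) :
    ∃ a : ℝ, ∃ A ∈ skewOperators E, ∃ X : E, T = triple a A X :=
  exists_eq_triple_of_skew (hsub T hT).1 (hsub T hT).2

/-- The linear subspace of `V` whose isotropic lines other than `ℝp` correspond to the points of
the affine subspace `u + S` of `E`. -/
def affineCone (u : E) (S : Submodule ℝ E) : Submodule ℝ (Mink E) where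
  carrier := {v | v.2.1 - v.2.2 • u ∈ S}
  add_mem' {v w} hv hw := by
    have sum_mem := S.add_mem hv hw
    rwa [sub_add_sub_comm, ← add_smul] at sum_mem
  zero_mem' := by simp
  smul_mem' c v hv := by simpa [smul_sub, smul_smul] using S.smul_mem c hv

theorem mem_affineCone {u : E} {S : Submodule ℝ E} {v : Mink E} :
    v ∈ affineCone u S ↔ v.2.1 - v.2.2 • u ∈ S := Iff.rfl

theorem eta_restrict_affineCone_nondegenerate (u : E) (S : Submodule ℝ E) :
    (eta.restrict (affineCone u S)).Nondegenerate := by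
  have separating (v : affineCone u S) (hv : ∀ w : affineCone u S, eta v.1 w.1 = 0) : v = 0 := by
    obtain ⟨⟨x, Y, z⟩, hmem⟩ := v
    have eta_p := hv ⟨(1, 0, 0), by simp [mem_affineCone]⟩
    have eta_u := hv ⟨(0, u, 1), by simp [mem_affineCone]⟩
    simp only [eta_apply, mul_zero, inner_zero_right, zero_add, mul_one, add_zero] at eta_p eta_u
    have hY : Y ∈ S := by simpa [mem_affineCone, eta_p] using hmem
    have eta_Y := hv ⟨(0, Y, 0), by simpa [mem_affineCone] using hY⟩
    simp only [eta_apply, mul_zero, zero_add, add_zero, inner_self_eq_zero] at eta_Y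
    rw [eta_Y, inner_zero_left, add_zero] at eta_u
    simp [eta_p, eta_u, eta_Y]
  exact ⟨separating, fun v hv => separating v fun w => (eta_comm _ _).trans (hv w)⟩

theorem IsWeaklyIrreducibleAlg.eq_top_of_invariant_affine [FiniteDimensional ℝ E]
    {𝔤 : LieSubalgebra ℝ (Mink E →L[ℝ] Mink E)} (hwi : IsWeaklyIrreducibleAlg 𝔤)
    (hsub : IsSubalgebraOfSOP 𝔤) (u : E) (S : Submodule ℝ E)
    (h : ∀ (a : ℝ) (A : E →L[ℝ] E) (X : E), triple a A X ∈ 𝔤 →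
      (∀ s ∈ S, A s ∈ S) ∧ a • u + A u + X ∈ S) : S = ⊤ := by
  have preserved : Preserves 𝔤 (affineCone u S) := by
    rintro T hT ⟨x, Y, z⟩ hv
    obtain ⟨a, A, -, X, rfl⟩ := hsub.exists_eq_triple hT
    obtain ⟨A_mem, field_mem⟩ := h a A X hT
    rw [triple_apply, mem_affineCone]
    convert S.add_mem (A_mem _ hv) (S.smul_mem z field_mem) using 1
    simp only [map_sub, map_smul]
    module
  rcases hwi _ preserved (eta_restrict_affineCone_nondegenerate u S) with hbot | htop
  · have vecP_mem : (vecP : Mink E) ∈ affineCone u S := by simp [mem_affineCone, vecP]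
    rw [hbot, Submodule.mem_bot] at vecP_mem
    exact absurd vecP_mem vecP_ne_zero
  · refine eq_top_iff.2 fun Y _ => ?_
    have mem_cone : ((0, Y, 0) : Mink E) ∈ affineCone u S := htop ▸ Submodule.mem_top
    simpa [mem_affineCone] using mem_cone

theorem IsSubalgebraOfSOP.not_isIrreducibleAlg {𝔤 : LieSubalgebra ℝ (Mink E →L[ℝ] Mink E)}
    (hsub : IsSubalgebraOfSOP 𝔤) : ¬ IsIrreducibleAlg 𝔤 := by
  intro hirr
  have preserved : Preserves 𝔤 (Submodule.span ℝ {vecP}) := by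
    intro T hT v hv
    obtain ⟨c, rfl⟩ := Submodule.mem_span_singleton.1 hv
    rw [map_smul]
    exact Submodule.smul_mem _ _ (hsub T hT).2
  rcases hirr _ preserved with hbot | htop
  · exact vecP_ne_zero (Submodule.span_singleton_eq_bot.1 hbot)
  · obtain ⟨c, hc⟩ := Submodule.mem_span_singleton.1
      (htop ▸ Submodule.mem_top : ((0, 0, 1) : Mink E) ∈ Submodule.span ℝ {vecP})
    simpa [vecP] using congrArg (fun v => v.2.2) hc

theorem Preserves.orthogonal {𝔤 : LieSubalgebra ℝ (Mink E →L[ℝ] Mink E)}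
    {F : Submodule ℝ (Mink E)} (hF : Preserves 𝔤 F) (hsub : IsSubalgebraOfSOP 𝔤) :
    Preserves 𝔤 (eta.orthogonal F) := by
  intro T hT v hv w hw
  have skew := (hsub T hT).1 w v
  rw [hv _ (hF T hT w hw)] at skew
  exact neg_eq_zero.1 skew.symm

theorem mem_span_vecP_of_eta_nullVec_eq [Nontrivial E] {v : Mink E}
    (h : ∀ Y, eta v (nullVec Y) = eta v (nullVec 0)) : v ∈ Submodule.span ℝ {vecP} := by
  obtain ⟨x, P, z⟩ := v
  simp only [eta_apply, nullVec, norm_zero, inner_zero_right] at h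
  obtain ⟨Y, hY⟩ := exists_ne (0 : E)
  have z_eq : z = 0 := by
    have h_neg := h (-Y)
    rw [inner_neg_right, norm_neg] at h_neg
    have mul_eq : z * ‖Y‖ ^ 2 = 0 := by linarith [h Y]
    exact (mul_eq_zero.1 mul_eq).resolve_right (by simpa using hY)
  have P_eq : P = 0 := by
    have h_P := h P
    rw [z_eq] at h_P
    exact inner_self_eq_zero (𝕜 := ℝ) |>.1 (by linarith)
  rw [z_eq, P_eq]
  exact Submodule.mem_span_singleton.2 ⟨x, by simp [vecP]⟩

variable [FiniteDimensional ℝ E]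

theorem Preserves.apply_mem_iff {Γ : Subgroup (Mink E →L[ℝ] Mink E)ˣ}
    {𝔤 : LieSubalgebra ℝ (Mink E →L[ℝ] Mink E)} (hΓ : IsConnectedLieSubgroupWith Γ 𝔤)
    {F : Submodule ℝ (Mink E)} (hF : Preserves 𝔤 F) {M : (Mink E →L[ℝ] Mink E)ˣ} (hM : M ∈ Γ)
    {v : Mink E} : M.val v ∈ F ↔ v ∈ F := by
  rw [hΓ.generates] at hM
  induction hM using Subgroup.closure_induction generalizing v with
  | mem M hM =>
    obtain ⟨T, hT, hexp⟩ := hM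
    rw [hexp]
    exact exp_apply_mem_iff_of_invariant (Submodule.closed_of_finiteDimensional F) (hF T hT)
  | one => exact Iff.rfl
  | mul M N _ _ hM hN => exact hM.trans hN
  | inv M _ hM => rw [← hM, ← mul_apply_eq_comp, M.mul_inv]; rfl

variable [Nontrivial E] {G : Subgroup (Sim E)} {𝔥 : LieSubalgebra ℝ ((E × ℝ) →L[ℝ] (E × ℝ))}

theorem ActsTransitively.exists_mem_lorentzGroup (htr : ActsTransitively G)
    (h : IsConnectedLieSubgroupWith (homogeneous G) 𝔥) (Y Z : E) :
    ∃ M ∈ lorentzGroup G, ∃ c : ℝ, c ≠ 0 ∧ M.val vecP = c⁻¹ • vecP ∧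
      M.val (nullVec Y) = c • nullVec Z := by
  obtain ⟨f, hf, rfl⟩ := htr Y Z
  obtain ⟨M, ⟨hM, hMf⟩, -⟩ := existsUnique_induces h hf
  have apply_nullVec := hMf.apply_nullVec hM.1 Y
  have ratio_ne : (Dilation.ratio f : ℝ)⁻¹ ≠ 0 := by
    exact_mod_cast (inv_pos.2 (Dilation.ratio_pos f)).ne'
  refine ⟨M, hM, (Dilation.ratio f : ℝ)⁻¹, ratio_ne, ?_, apply_nullVec⟩
  obtain ⟨d, hd⟩ := Submodule.mem_span_singleton.1
    ((hM.1.2.2.2 vecP).2 (Submodule.mem_span_singleton_self _))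
  have isometry := hM.1.2.1 (nullVec Y) vecP
  rw [apply_nullVec, ← hd, map_smul, map_smul, LinearMap.smul_apply, eta_vecP, eta_vecP] at isometry
  rw [← hd, eq_inv_of_mul_eq_one_left (a := d)]
  simpa [nullVec, mul_comm] using isometry

theorem ActsTransitively.eq_top_of_nullVec_mem (htr : ActsTransitively G)
    (h : IsConnectedLieSubgroupWith (homogeneous G) 𝔥) {F : Submodule ℝ (Mink E)}
    (hF : Preserves (lorentzAlgebra 𝔥) F) {Y : E} (hY : nullVec Y ∈ F) : F = ⊤ := by
  rw [eq_top_iff, ← span_range_nullVec, Submodule.span_le]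
  rintro _ ⟨Z, rfl⟩
  obtain ⟨M, hM, c, hc, -, apply_nullVec⟩ := htr.exists_mem_lorentzGroup h Y Z
  have apply_mem := (hF.apply_mem_iff (lorentzGroup_isConnected h) hM).2 hY
  rwa [apply_nullVec, F.smul_mem_iff hc] at apply_mem

theorem ActsTransitively.eq_top_of_vecP_mem (htr : ActsTransitively G)
    (h : IsConnectedLieSubgroupWith (homogeneous G) 𝔥) {F F' : Submodule ℝ (Mink E)}
    (hF : Preserves (lorentzAlgebra 𝔥) F) (hsup : F ⊔ F' = ⊤)
    (horth : ∀ v ∈ F', ∀ w ∈ F, eta v w = 0) (hp : vecP ∈ F) : F = ⊤ := by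
  obtain ⟨v, hv, w, hw, hvw⟩ :=
    Submodule.mem_sup.1 (hsup ▸ Submodule.mem_top : ((0, 0, 1) : Mink E) ∈ F ⊔ F')
  have w_snd : w.2.2 = 0 := by rw [← eta_vecP, horth w hw _ hp]
  have v_snd : v.2.2 = 1 := by simpa [w_snd] using congrArg (fun u => u.2.2) hvw
  have nullVec_eq : nullVec v.2.1 = v + (-(1 / 2) * ‖v.2.1‖ ^ 2 - v.1) • vecP := by
    refine Prod.ext ?_ (Prod.ext ?_ ?_) <;> simp [nullVec, vecP, v_snd]
  refine htr.eq_top_of_nullVec_mem h hF (Y := v.2.1) ?_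
  rw [nullVec_eq]
  exact add_mem hv (F.smul_mem _ hp)

-- The component `p₁ ∈ F` of `p` is an eigenvector of the group with the same eigenvalues as `p`, so
-- `η(p₁, ·)`, like `η(p, ·)`, is constant on the vectors `nullVec Y`; hence `p₁ ∈ ℝp`.
theorem ActsTransitively.vecP_mem_or_vecP_mem (htr : ActsTransitively G)
    (h : IsConnectedLieSubgroupWith (homogeneous G) 𝔥) {F F' : Submodule ℝ (Mink E)}
    (hF : Preserves (lorentzAlgebra 𝔥) F) (hF' : Preserves (lorentzAlgebra 𝔥) F')
    (hcompl : IsCompl F F') : vecP ∈ F ∨ vecP ∈ F' := by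
  obtain ⟨p₁, h₁, p₂, h₂, add_eq⟩ :=
    Submodule.mem_sup.1 (hcompl.sup_eq_top ▸ Submodule.mem_top : vecP ∈ F ⊔ F')
  have apply_p₁ {M : (Mink E →L[ℝ] Mink E)ˣ} (hM : M ∈ lorentzGroup G) {c : ℝ}
      (hc : M.val vecP = c • vecP) : M.val p₁ = c • p₁ := by
    rw [← add_eq, map_add, smul_add, add_comm (c • p₁), ← sub_eq_sub_iff_add_eq_add] at hc
    have diff_mem : M.val p₁ - c • p₁ ∈ F ⊓ F' := by
      refine ⟨F.sub_mem ((hF.apply_mem_iff (lorentzGroup_isConnected h) hM).2 h₁)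
        (F.smul_mem _ h₁), ?_⟩
      rw [hc]
      exact F'.sub_mem (F'.smul_mem _ h₂)
        ((hF'.apply_mem_iff (lorentzGroup_isConnected h) hM).2 h₂)
    rwa [hcompl.inf_eq_bot, Submodule.mem_bot, sub_eq_zero] at diff_mem
  have eta_const (Y : E) : eta p₁ (nullVec Y) = eta p₁ (nullVec 0) := by
    obtain ⟨M, hM, c, hc, apply_vecP, apply_nullVec⟩ := htr.exists_mem_lorentzGroup h Y 0
    rw [← hM.1.2.1, apply_p₁ hM apply_vecP, apply_nullVec, map_smul, map_smul,
      LinearMap.smul_apply, smul_smul, mul_inv_cancel₀ hc, one_smul]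
  obtain ⟨x, rfl⟩ := Submodule.mem_span_singleton.1 (mem_span_vecP_of_eta_nullVec_eq eta_const)
  rcases eq_or_ne x 0 with rfl | hx
  · rw [zero_smul, zero_add] at add_eq
    exact Or.inr (add_eq ▸ h₂)
  · exact Or.inl ((F.smul_mem_iff hx).1 h₁)

theorem ActsTransitively.isWeaklyIrreducibleAlg (htr : ActsTransitively G)
    (h : IsConnectedLieSubgroupWith (homogeneous G) 𝔥) :
    IsWeaklyIrreducibleAlg (lorentzAlgebra 𝔥) := by
  intro F hF hnd
  have hF' := hF.orthogonal lorentzAlgebra_isSubalgebraOfSOP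
  have hcompl := LinearMap.BilinForm.isCompl_orthogonal_of_restrict_nondegenerate eta_isRefl hnd
  rcases htr.vecP_mem_or_vecP_mem h hF hF' hcompl with hp | hp
  · exact Or.inr (htr.eq_top_of_vecP_mem h hF hcompl.sup_eq_top
      (fun v hv w hw => (eta_comm v w).trans (hv w hw)) hp)
  · refine Or.inl ((LinearMap.BilinForm.orthogonal_eq_top_iff eta_isRefl hnd).1 ?_)
    exact htr.eq_top_of_vecP_mem h hF' hcompl.symm.sup_eq_top (fun v hv w hw => hw v hv) hp

end Transitivity

/-! ### Lie algebras of skew-symmetric operators -/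

section Skew

-- The component of `v` orthogonal to `K` works: it is moved by `T i` both into `K` and into `Kᗮ`.
theorem exists_mem_forall_apply_sub_eq_zero {ι V H : Type*} [AddCommGroup V] [Module ℝ V]
    [FiniteDimensional ℝ V] [NormedAddCommGroup H] [InnerProductSpace ℝ H] {J : V →ₗ[ℝ] H}
    (hJ : Function.Injective J) {T : ι → V →ₗ[ℝ] V}
    (hT : ∀ i x y, inner ℝ (J (T i x)) (J y) = -inner ℝ (J x) (J (T i y)))
    {K : Submodule ℝ V} (hK : ∀ i, ∀ x ∈ K, T i x ∈ K) {v : V} (hv : ∀ i, T i v ∈ K) :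
    ∃ k ∈ K, ∀ i, T i (v - k) = 0 := by
  obtain ⟨_, ⟨k, hk, rfl⟩, z, hz, add_eq⟩ := (K.map J).exists_add_mem_mem_orthogonal (J v)
  have orthogonal (x : V) (hx : x ∈ K) : inner ℝ (J (v - k)) (J x) = 0 := by
    rw [map_sub, add_eq, add_sub_cancel_left, real_inner_comm]
    exact hz _ (Submodule.mem_map_of_mem hx)
  refine ⟨k, hk, fun i => (map_eq_zero_iff J hJ).1 (inner_self_eq_zero (𝕜 := ℝ) |>.1 ?_)⟩
  have apply_mem : T i (v - k) ∈ K := by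
    rw [map_sub]
    exact K.sub_mem (hv i) (hK i k hk)
  rw [hT, orthogonal _ (hK i _ apply_mem), neg_zero]

section HilbertSchmidt

variable {ι V E : Type*} [AddCommGroup V] [Module ℝ V] [NormedAddCommGroup E]
  [InnerProductSpace ℝ E]

/-- A linear map as the tuple of its values on a basis. The inner product of these tuples is the
Hilbert–Schmidt inner product of the maps, if `V` is given the inner product for which the basis is
orthonormal. -/
def basisValues (e : Module.Basis ι ℝ V) : (V →ₗ[ℝ] E) →ₗ[ℝ] PiLp 2 (fun _ : ι => E) where
  toFun c := WithLp.toLp 2 fun i => c (e i)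
  map_add' _ _ := rfl
  map_smul' _ _ := rfl

theorem basisValues_injective (e : Module.Basis ι ℝ V) :
    Function.Injective (basisValues (E := E) e) := fun _ _ h =>
  e.ext fun i => congrArg (fun v : PiLp 2 (fun _ : ι => E) => v i) h

variable [Fintype ι]

theorem inner_basisValues (e : Module.Basis ι ℝ V) (c d : V →ₗ[ℝ] E) :
    inner ℝ (basisValues e c) (basisValues e d) = ∑ i, inner ℝ (c (e i)) (d (e i)) := rfl

theorem sum_inner_apply_of_repr_skew {e : Module.Basis ι ℝ V} {m : V →ₗ[ℝ] V}
    (hm : ∀ i j, e.repr (m (e i)) j = -e.repr (m (e j)) i) (c d : V →ₗ[ℝ] E) :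
    ∑ i, inner ℝ (c (m (e i))) (d (e i)) = -∑ i, inner ℝ (c (e i)) (d (m (e i))) := by
  have expand (f : V →ₗ[ℝ] E) (i : ι) : f (m (e i)) = ∑ j, e.repr (m (e i)) j • f (e j) := by
    conv_lhs => rw [← e.sum_repr (m (e i)), map_sum]
    simp only [map_smul]
  simp only [expand, sum_inner, inner_sum, real_inner_smul_left, real_inner_smul_right]
  rw [Finset.sum_comm]
  simp only [← Finset.sum_neg_distrib]
  refine Finset.sum_congr rfl fun i _ => Finset.sum_congr rfl fun j _ => ?_
  rw [hm j i, neg_mul]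

theorem inner_basisValues_comp_sub_comp {e : Module.Basis ι ℝ V} {m : V →ₗ[ℝ] V}
    (hm : ∀ i j, e.repr (m (e i)) j = -e.repr (m (e j)) i) {n : E →L[ℝ] E}
    (hn : n ∈ skewOperators E) (c d : V →ₗ[ℝ] E) :
    inner ℝ (basisValues e (n.toLinearMap ∘ₗ c - c ∘ₗ m)) (basisValues e d) =
      -inner ℝ (basisValues e c) (basisValues e (n.toLinearMap ∘ₗ d - d ∘ₗ m)) := by
  have sum_n : ∑ i, inner ℝ (n (c (e i))) (d (e i)) = -∑ i, inner ℝ (c (e i)) (n (d (e i))) := by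
    rw [← Finset.sum_neg_distrib]
    exact Finset.sum_congr rfl fun i _ => hn _ _
  simp only [inner_basisValues, LinearMap.sub_apply, LinearMap.comp_apply, inner_sub_left,
    inner_sub_right, Finset.sum_sub_distrib, sum_inner_apply_of_repr_skew hm c d,
    ContinuousLinearMap.coe_coe, sum_n]
  ring

end HilbertSchmidt

variable {E : Type*} [NormedAddCommGroup E] [InnerProductSpace ℝ E]
  {ℬ : LieSubalgebra ℝ (E →L[ℝ] E)}

theorem commutant_toSubmodule : (commutant ℬ).toSubmodule =
    Submodule.span ℝ {x : ℬ | ∃ A B : ℬ, ⁅A, B⁆ = x} := by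
  rw [LieSubmodule.lieIdeal_oper_eq_linear_span']
  simp only [LieSubmodule.mem_top, true_and]

theorem lie_mem_commutant (A B : ℬ) : ⁅A, B⁆ ∈ commutant ℬ :=
  LieSubmodule.lie_mem_lie (LieSubmodule.mem_top _) (LieSubmodule.mem_top _)

theorem mem_center_iff {Z : ℬ} : Z ∈ LieAlgebra.center ℝ ℬ ↔
    ∀ B ∈ ℬ, ⁅B, (Z : E →L[ℝ] E)⁆ = 0 := by
  simp only [LieModule.mem_maxTrivSubmodule, Subtype.forall, Subtype.ext_iff]
  rfl

variable [FiniteDimensional ℝ E]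

/-- The Hilbert–Schmidt model of the space of operators. -/
def hilbertSchmidt :
    (E →L[ℝ] E) →ₗ[ℝ] PiLp 2 (fun _ : Fin (Module.finrank ℝ E) => E) :=
  basisValues (stdOrthonormalBasis ℝ E).toBasis ∘ₗ ContinuousLinearMap.coeLM ℝ

theorem hilbertSchmidt_injective : Function.Injective (hilbertSchmidt (E := E)) :=
  (basisValues_injective _).comp ContinuousLinearMap.coe_injective

theorem inner_hilbertSchmidt_lie {m : E →L[ℝ] E} (hm : m ∈ skewOperators E) (A B : E →L[ℝ] E) :
    inner ℝ (hilbertSchmidt ⁅m, A⁆) (hilbertSchmidt B) =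
      -inner ℝ (hilbertSchmidt A) (hilbertSchmidt ⁅m, B⁆) := by
  refine inner_basisValues_comp_sub_comp (m := m.toLinearMap) (fun i j => ?_) hm A.toLinearMap
    B.toLinearMap
  simp only [OrthonormalBasis.coe_toBasis, OrthonormalBasis.coe_toBasis_repr_apply,
    OrthonormalBasis.repr_apply_apply, ContinuousLinearMap.coe_coe]
  rw [real_inner_comm, hm]

theorem exists_commutant_add_center (hℬ : ℬ ≤ skewOperators E) {A : E →L[ℝ] E} (hA : A ∈ ℬ) :
    ∃ (C : commutant ℬ) (Z : LieAlgebra.center ℝ ℬ),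
      A = ((C : ℬ) : E →L[ℝ] E) + ((Z : ℬ) : E →L[ℝ] E) := by
  obtain ⟨C, hC, lie_sub⟩ := exists_mem_forall_apply_sub_eq_zero
    (J := hilbertSchmidt ∘ₗ ℬ.toSubmodule.subtype)
    (T := fun B : ℬ => (LieAlgebra.ad ℝ ℬ B : ℬ →ₗ[ℝ] ℬ))
    (hilbertSchmidt_injective.comp Subtype.val_injective)
    (fun B x y => inner_hilbertSchmidt_lie (hℬ B.2) x.1 y.1)
    (K := (commutant ℬ).toSubmodule) (fun B x _ => lie_mem_commutant B x)
    (v := ⟨A, hA⟩) (fun B => lie_mem_commutant B _)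
  exact ⟨⟨C, hC⟩, ⟨⟨A, hA⟩ - C, LieModule.mem_maxTrivSubmodule .. |>.2 lie_sub⟩, by simp⟩

theorem eq_zero_of_mem_commutant_of_mem_center (hℬ : ℬ ≤ skewOperators E) {C : ℬ}
    (hC : C ∈ commutant ℬ) (hZ : C ∈ LieAlgebra.center ℝ ℬ) : C = 0 := by
  have orthogonal (D : ℬ) (hD : D ∈ (commutant ℬ).toSubmodule) :
      inner ℝ (hilbertSchmidt D.1) (hilbertSchmidt C.1) = 0 := by
    rw [commutant_toSubmodule] at hD
    induction hD using Submodule.span_induction with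
    | mem x hx =>
      obtain ⟨A, B, rfl⟩ := hx
      refine (inner_hilbertSchmidt_lie (hℬ A.2) B.1 C.1).trans ?_
      rw [mem_center_iff.1 hZ A A.2, map_zero, inner_zero_right, neg_zero]
    | zero => simp
    | add x y _ _ hx hy => simp [inner_add_left, hx, hy]
    | smul t x _ hx => simp [real_inner_smul_left, hx]
  exact Subtype.ext (hilbertSchmidt_injective
    ((inner_self_eq_zero (𝕜 := ℝ) |>.1 (orthogonal C hC)).trans (map_zero _).symm))

theorem exists_basis_repr_lie_skew (hℬ : ℬ ≤ skewOperators E) :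
    ∃ (n : ℕ) (e : Module.Basis (Fin n) ℝ ℬ), ∀ (m : ℬ) (i j : Fin n),
      e.repr ⁅m, e i⁆ j = -e.repr ⁅m, e j⁆ i := by
  let J : ℬ →ₗ[ℝ] PiLp 2 (fun _ : Fin (Module.finrank ℝ E) => E) :=
    hilbertSchmidt ∘ₗ ℬ.toSubmodule.subtype
  let b := stdOrthonormalBasis ℝ (LinearMap.range J)
  let ρ := LinearEquiv.ofInjective J (hilbertSchmidt_injective.comp Subtype.val_injective)
  let e := b.toBasis.map ρ.symm
  have apply_e (i) : J (e i) = b i := by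
    change (ρ (ρ.symm (b.toBasis i))).1 = (b i).1
    rw [ρ.apply_symm_apply, b.coe_toBasis]
  have repr_eq (x : ℬ) (j) : e.repr x j = inner ℝ (J (e j)) (J x) := by
    rw [apply_e]
    exact b.repr_apply_apply (ρ x) j
  refine ⟨_, e, fun m i j => ?_⟩
  rw [repr_eq, repr_eq, real_inner_comm]
  exact inner_hilbertSchmidt_lie (hℬ m.2) (e i).1 (e j).1

-- The cochains `ℬ → E` carry an invariant inner product, and `ℬ` moves the cocycle `c` by the
-- coboundaries `A ↦ A (c B)`. So `c` can be made invariant by subtracting a coboundary.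
theorem exists_coboundary (hℬ : ℬ ≤ skewOperators E) (c : ℬ →ₗ[ℝ] E)
    (hc : ∀ A B : ℬ, c ⁅A, B⁆ = A.1 (c B) - B.1 (c A)) :
    ∃ u : E, ∀ A B : ℬ, B.1 (c A - A.1 u) = 0 := by
  obtain ⟨n, e, repr_skew⟩ := exists_basis_repr_lie_skew hℬ
  let T (B : ℬ) : (ℬ →ₗ[ℝ] E) →ₗ[ℝ] (ℬ →ₗ[ℝ] E) :=
    LinearMap.compRight ℝ B.1.toLinearMap - LinearMap.lcomp ℝ E (LieAlgebra.ad ℝ ℬ B)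
  let δ : E →ₗ[ℝ] (ℬ →ₗ[ℝ] E) :=
    (ContinuousLinearMap.coeLM ℝ ∘ₗ ℬ.toSubmodule.subtype).flip
  have T_apply (B A : ℬ) (d : ℬ →ₗ[ℝ] E) : T B d A = B.1 (d A) - d ⁅B, A⁆ := rfl
  have T_δ (B : ℬ) (x : E) : T B (δ x) = δ (B.1 x) := by
    ext A
    change B.1 (A.1 x) - (B.1 (A.1 x) - A.1 (B.1 x)) = A.1 (B.1 x)
    abel
  have T_c (B : ℬ) : T B c = δ (c B) := by
    ext A
    rw [T_apply, hc, sub_sub_cancel]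
    rfl
  obtain ⟨_, ⟨u, rfl⟩, apply_sub⟩ := exists_mem_forall_apply_sub_eq_zero
    (basisValues_injective e) (T := T)
    (fun B => inner_basisValues_comp_sub_comp (repr_skew B) (hℬ B.2))
    (K := LinearMap.range δ)
    (by rintro B _ ⟨x, rfl⟩; exact ⟨_, (T_δ B x).symm⟩) (v := c) (fun B => ⟨_, (T_c B).symm⟩)
  refine ⟨u, fun A B => ?_⟩
  have apply_eq := apply_sub A
  rw [map_sub, T_c, T_δ, ← map_sub] at apply_eq
  exact congrArg (fun d => d B) apply_eq

end Skew

/-! ### The Bérard Bergery–Ikemakhen classification -/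

section Classification

theorem exists_linearMap_of_graph {V Y : Type*} [AddCommGroup V] [Module ℝ V] [AddCommGroup Y]
    [Module ℝ Y] (R : Submodule ℝ (V × Y)) (exists_mem : ∀ x, ∃ y, (x, y) ∈ R)
    (eq_zero : ∀ y, ((0 : V), y) ∈ R → y = 0) : ∃ f : V →ₗ[ℝ] Y, ∀ x y, (x, y) ∈ R ↔ y = f x := by
  have bijective : Function.Bijective (Prod.fst ∘ R.subtype) := by
    refine ⟨?_, fun x => let ⟨y, hy⟩ := exists_mem x; ⟨⟨(x, y), hy⟩, rfl⟩⟩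
    rintro ⟨⟨x, y⟩, h⟩ ⟨⟨x', y'⟩, h'⟩ (rfl : x = x')
    have sub_mem := R.sub_mem h h'
    rw [Prod.mk_sub_mk, sub_self] at sub_mem
    simp only [sub_eq_zero.1 (eq_zero _ sub_mem)]
  obtain ⟨f, hf⟩ := R.exists_eq_graph bijective
  exact ⟨f, fun x y => by rw [hf, LinearMap.mem_graph_iff]⟩

theorem apply_mem_iff_of_injective {V : Type*} [AddCommGroup V] [Module ℝ V]
    [FiniteDimensional ℝ V] {L : V →ₗ[ℝ] V} (hL : Function.Injective L) {W : Submodule ℝ V}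
    (hW : ∀ x ∈ W, L x ∈ W) {x : V} : L x ∈ W ↔ x ∈ W := by
  refine ⟨fun hx => ?_, hW x⟩
  have map_eq : W.map L = W := Submodule.eq_of_le_of_finrank_eq (Submodule.map_le_iff_le_comap.2 hW)
    (Submodule.equivMapOfInjective L hL W).finrank_eq.symm
  obtain ⟨y, hy, L_eq⟩ := map_eq.ge hx
  exact hL L_eq ▸ hy

variable {E : Type*} [NormedAddCommGroup E] [InnerProductSpace ℝ E]

theorem injective_smul_one_add_of_skew {A : E →L[ℝ] E} (hA : A ∈ skewOperators E) {a : ℝ}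
    (ha : a ≠ 0) : Function.Injective (a • 1 + A : E →L[ℝ] E) := by
  refine (injective_iff_map_eq_zero _).2 fun x hx => ?_
  have inner_eq : inner ℝ ((a • 1 + A : E →L[ℝ] E) x) x = a * inner ℝ x x := by
    simp [inner_add_left, real_inner_smul_left, mem_skewOperators_iff_inner_self.1 hA x]
  rw [hx, inner_zero_left] at inner_eq
  exact inner_self_eq_zero (𝕜 := ℝ) |>.1 ((mul_eq_zero.1 inner_eq.symm).resolve_left ha)

theorem isSkewOn_top_iff {ℬ : LieSubalgebra ℝ (E →L[ℝ] E)} :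
    IsSkewOn ⊤ ℬ ↔ ℬ ≤ skewOperators E := by
  refine ⟨fun h A hA => (h A hA).1, fun h A hA => ⟨h hA, fun Y hY => ?_⟩⟩
  rw [Submodule.top_orthogonal_eq_bot, Submodule.mem_bot] at hY
  rw [hY, map_zero]

variable {𝔤 : LieSubalgebra ℝ (Mink E →L[ℝ] Mink E)} {a b : ℝ} {A B : E →L[ℝ] E} {X Y : E}

theorem triple_zero_mem : triple 0 (0 : E →L[ℝ] E) 0 ∈ 𝔤 :=
  triple_zero (E := E) ▸ 𝔤.zero_mem

theorem triple_add_mem (h : triple a A X ∈ 𝔤) (k : triple b B Y ∈ 𝔤) :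
    triple (a + b) (A + B) (X + Y) ∈ 𝔤 :=
  add_triple a b A B X Y ▸ 𝔤.add_mem h k

theorem triple_sub_mem (h : triple a A X ∈ 𝔤) (k : triple b B Y ∈ 𝔤) :
    triple (a - b) (A - B) (X - Y) ∈ 𝔤 :=
  sub_triple a b A B X Y ▸ 𝔤.sub_mem h k

theorem triple_smul_mem (t : ℝ) (h : triple a A X ∈ 𝔤) : triple (t * a) (t • A) (t • X) ∈ 𝔤 :=
  smul_triple t a A X ▸ 𝔤.smul_mem t h

theorem IsSubalgebraOfSOP.skew_of_triple_mem (hsub : IsSubalgebraOfSOP 𝔤)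
    (h : triple a A X ∈ 𝔤) : A ∈ skewOperators E := fun Y Z => by
  simpa [eta_apply, triple_apply] using (hsub _ h).1 (0, Y, 0) (0, Z, 0)

theorem IsSubalgebraOfSOP.triple_lie_mem (hsub : IsSubalgebraOfSOP 𝔤) (h : triple a A X ∈ 𝔤)
    (k : triple b B Y ∈ 𝔤) : triple 0 ⁅A, B⁆ ((a • 1 + A) Y - (b • 1 + B) X) ∈ 𝔤 :=
  lie_triple (hsub.skew_of_triple_mem h) (hsub.skew_of_triple_mem k) X Y ▸ 𝔤.lie_mem h k

/-- The space of the vectors `X` with `(0, 0, X) ∈ 𝔤`, the infinitesimal translations in `𝔤`. -/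
def translationSpace (𝔤 : LieSubalgebra ℝ (Mink E →L[ℝ] Mink E)) : Submodule ℝ E where
  carrier := {X | triple 0 0 X ∈ 𝔤}
  add_mem' hX hY := by simpa using triple_add_mem hX hY
  zero_mem' := triple_zero_mem
  smul_mem' t X hX := by simpa using triple_smul_mem t hX

theorem mem_translationSpace : X ∈ translationSpace 𝔤 ↔ triple 0 0 X ∈ 𝔤 := Iff.rfl

theorem sub_mem_translationSpace (h : triple a A X ∈ 𝔤) (k : triple a A Y ∈ 𝔤) :
    X - Y ∈ translationSpace 𝔤 :=
  mem_translationSpace.2 (by simpa using triple_sub_mem h k)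

theorem triple_sub_mem_of_mem_translationSpace (h : triple a A X ∈ 𝔤)
    (hY : Y ∈ translationSpace 𝔤) : triple a A (X - Y) ∈ 𝔤 := by
  simpa using triple_sub_mem h (mem_translationSpace.1 hY)

theorem triple_mem_of_translationSpace_eq_top (hN : translationSpace 𝔤 = ⊤)
    (h : triple a A X ∈ 𝔤) (Y : E) : triple a A Y ∈ 𝔤 := by
  simpa using triple_sub_mem_of_mem_translationSpace h (hN ▸ Submodule.mem_top : X - Y ∈ _)

theorem IsSubalgebraOfSOP.apply_mem_translationSpace (hsub : IsSubalgebraOfSOP 𝔤)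
    (h : triple a A X ∈ 𝔤) (hY : Y ∈ translationSpace 𝔤) : A Y ∈ translationSpace 𝔤 := by
  have lie_mem : a • Y + A Y ∈ translationSpace 𝔤 :=
    mem_translationSpace.2 (by simpa using hsub.triple_lie_mem h (mem_translationSpace.1 hY))
  simpa using (translationSpace 𝔤).sub_mem lie_mem ((translationSpace 𝔤).smul_mem a hY)

/-- The projection of `𝔤` to `𝔰𝔬(E)`: the operators `A` that occur in the elements `(a, A, X)`
of `𝔤`. -/
def IsSubalgebraOfSOP.skewPart (hsub : IsSubalgebraOfSOP 𝔤) : LieSubalgebra ℝ (E →L[ℝ] E) where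
  carrier := {A | ∃ a X, triple a A X ∈ 𝔤}
  add_mem' := by
    rintro A B ⟨a, X, h⟩ ⟨b, Y, k⟩
    exact ⟨_, _, triple_add_mem h k⟩
  zero_mem' := ⟨0, 0, triple_zero_mem⟩
  smul_mem' := by
    rintro t A ⟨a, X, h⟩
    exact ⟨_, _, triple_smul_mem t h⟩
  lie_mem' := by
    rintro A B ⟨a, X, h⟩ ⟨b, Y, k⟩
    exact ⟨_, _, hsub.triple_lie_mem h k⟩

variable {hsub : IsSubalgebraOfSOP 𝔤}

theorem skewPart_le_skewOperators : hsub.skewPart ≤ skewOperators E := fun _ ⟨_, _, h⟩ =>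
  hsub.skew_of_triple_mem h

theorem exists_triple_mem_of_mem_commutant {C : hsub.skewPart}
    (hC : C ∈ commutant hsub.skewPart) : ∃ X, triple 0 (C : E →L[ℝ] E) X ∈ 𝔤 := by
  change C ∈ (commutant hsub.skewPart).toSubmodule at hC
  rw [commutant_toSubmodule] at hC
  induction hC using Submodule.span_induction with
  | mem x hx =>
    obtain ⟨⟨A, a, X, h⟩, ⟨B, b, Y, k⟩, rfl⟩ := hx
    exact ⟨_, hsub.triple_lie_mem h k⟩
  | zero => exact ⟨0, triple_zero_mem⟩
  | add x y _ _ hx hy =>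
    obtain ⟨X, hX⟩ := hx
    obtain ⟨Y, hY⟩ := hy
    exact ⟨X + Y, by simpa using triple_add_mem hX hY⟩
  | smul t x _ hx =>
    obtain ⟨X, hX⟩ := hx
    exact ⟨t • X, by simpa using triple_smul_mem t hX⟩

theorem exists_dilationRate (hsub : IsSubalgebraOfSOP 𝔤) (hN : translationSpace 𝔤 = ⊤)
    (h1 : triple 1 0 0 ∉ 𝔤) : ∃ φ : LieAlgebra.center ℝ hsub.skewPart →ₗ[ℝ] ℝ,
      ∀ (Z : LieAlgebra.center ℝ hsub.skewPart) (a : ℝ),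
        triple a ((Z : hsub.skewPart) : E →L[ℝ] E) 0 ∈ 𝔤 ↔ a = φ Z := by
  let R : Submodule ℝ (LieAlgebra.center ℝ hsub.skewPart × ℝ) :=
    { carrier := {v | triple v.2 ((v.1 : hsub.skewPart) : E →L[ℝ] E) 0 ∈ 𝔤}
      add_mem' := fun h k => by simpa using triple_add_mem h k
      zero_mem' := triple_zero_mem
      smul_mem' := fun t v h => by simpa using triple_smul_mem t h }
  refine exists_linearMap_of_graph R (fun ⟨⟨A, a, X, h⟩, _⟩ =>
    ⟨a, triple_mem_of_translationSpace_eq_top hN h 0⟩) fun a (ha : triple a 0 0 ∈ 𝔤) => ?_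
  by_contra ne_zero
  exact h1 (by simpa [inv_mul_cancel₀ ne_zero] using triple_smul_mem a⁻¹ ha)

variable [FiniteDimensional ℝ E]

theorem exists_center_triple_mem (hsub : IsSubalgebraOfSOP 𝔤) (h : triple a A X ∈ 𝔤) :
    ∃ (C : commutant hsub.skewPart) (Z : LieAlgebra.center ℝ hsub.skewPart) (Y : E),
      A = ((C : hsub.skewPart) : E →L[ℝ] E) + ((Z : hsub.skewPart) : E →L[ℝ] E) ∧
      triple a ((Z : hsub.skewPart) : E →L[ℝ] E) Y ∈ 𝔤 := by
  obtain ⟨C, Z, rfl⟩ := exists_commutant_add_center skewPart_le_skewOperators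
    (show A ∈ hsub.skewPart from ⟨a, X, h⟩)
  obtain ⟨Y, hY⟩ := exists_triple_mem_of_mem_commutant C.2
  exact ⟨C, Z, X - Y, rfl, by simpa using triple_sub_mem h hY⟩

-- Subtracting an element over the commutant makes `A` central in the skew part. Then
-- `x ↦ a x + A x` is invertible, and conjugating its fixed point to the origin turns every
-- `(b, B, Y)` into an element with translation part in `translationSpace 𝔤`.
theorem translationSpace_eq_top (hwi : IsWeaklyIrreducibleAlg 𝔤) (hsub : IsSubalgebraOfSOP 𝔤)
    (ha : a ≠ 0) (h : triple a A X ∈ 𝔤) : translationSpace 𝔤 = ⊤ := by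
  obtain ⟨-, ⟨⟨Z, hZmem⟩, hZ⟩, X', -, hT⟩ := exists_center_triple_mem hsub h
  let L : E →L[ℝ] E := a • 1 + Z
  have L_injective : Function.Injective L.toLinearMap :=
    injective_smul_one_add_of_skew (hsub.skew_of_triple_mem hT) ha
  have L_mem {x : E} (hx : x ∈ translationSpace 𝔤) : L x ∈ translationSpace 𝔤 :=
    (translationSpace 𝔤).add_mem ((translationSpace 𝔤).smul_mem a hx)
      (hsub.apply_mem_translationSpace hT hx)
  obtain ⟨v, hv : L v = -X'⟩ := LinearMap.surjective_of_injective L_injective (-X')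
  refine hwi.eq_top_of_invariant_affine hsub v _ fun b B Y k =>
    ⟨fun s hs => hsub.apply_mem_translationSpace k hs,
      (apply_mem_iff_of_injective L_injective fun x hx => L_mem hx).1 ?_⟩
  have lie_eq_zero : ⁅Z, B⁆ = 0 := by
    rw [← lie_skew, mem_center_iff.1 hZ B ⟨b, Y, k⟩, neg_zero]
  have Z_apply_B : Z (B v) = B (Z v) :=
    sub_eq_zero.1 (congrArg (fun S : E →L[ℝ] E => S v) lie_eq_zero)
  have lie_mem : L Y - (b • 1 + B) X' ∈ translationSpace 𝔤 :=
    mem_translationSpace.2 (lie_eq_zero ▸ hsub.triple_lie_mem hT k)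
  convert lie_mem using 1
  rw [← neg_eq_iff_eq_neg.2 hv]
  simp only [L, ContinuousLinearMap.coe_coe, add_apply, smul_apply, one_apply_eq_self, map_add,
    map_smul, map_neg, Z_apply_B]
  module

theorem algType_type1_of_mem (hsub : IsSubalgebraOfSOP 𝔤) (hN : translationSpace 𝔤 = ⊤)
    (h1 : triple 1 0 0 ∈ 𝔤) : AlgType 𝔤 .type1 := by
  refine ⟨hsub.skewPart, isSkewOn_top_iff.2 skewPart_le_skewOperators, fun T => ⟨fun hT => ?_, ?_⟩⟩
  · obtain ⟨a, A, -, X, rfl⟩ := hsub.exists_eq_triple hT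
    exact ⟨a, ⟨A, a, X, hT⟩, X, rfl⟩
  · rintro ⟨a, ⟨A, b, Y, h⟩, X, rfl⟩
    exact triple_mem_of_translationSpace_eq_top hN
      (by simpa using triple_add_mem h (triple_smul_mem (a - b) h1)) X

theorem algType_type2_of_forall (hsub : IsSubalgebraOfSOP 𝔤) (hN : translationSpace 𝔤 = ⊤)
    (h0 : ∀ a A X, triple a A X ∈ 𝔤 → a = 0) : AlgType 𝔤 .type2 := by
  refine ⟨hsub.skewPart, isSkewOn_top_iff.2 skewPart_le_skewOperators, fun T => ⟨fun hT => ?_, ?_⟩⟩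
  · obtain ⟨a, A, -, X, rfl⟩ := hsub.exists_eq_triple hT
    obtain rfl := h0 _ _ _ hT
    exact ⟨⟨A, 0, X, hT⟩, X, rfl⟩
  · rintro ⟨⟨A, b, Y, h⟩, X, rfl⟩
    obtain rfl := h0 _ _ _ h
    exact triple_mem_of_translationSpace_eq_top hN h X

theorem algType_type3_of_notMem (hsub : IsSubalgebraOfSOP 𝔤) (hN : translationSpace 𝔤 = ⊤)
    (h1 : triple 1 0 0 ∉ 𝔤) (ha : a ≠ 0) (h : triple a A X ∈ 𝔤) : AlgType 𝔤 .type3 := by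
  obtain ⟨φ, hφ⟩ := exists_dilationRate hsub hN h1
  have decomposition {a : ℝ} {A : E →L[ℝ] E} {X : E} (h : triple a A X ∈ 𝔤) :
      ∃ (C : commutant hsub.skewPart) (Z : LieAlgebra.center ℝ hsub.skewPart),
        A = ((C : hsub.skewPart) : E →L[ℝ] E) + ((Z : hsub.skewPart) : E →L[ℝ] E) ∧ a = φ Z := by
    obtain ⟨C, Z, Y, A_eq, hZ⟩ := exists_center_triple_mem hsub h
    exact ⟨C, Z, A_eq, (hφ Z a).1 (triple_mem_of_translationSpace_eq_top hN hZ 0)⟩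
  refine ⟨hsub.skewPart, φ, isSkewOn_top_iff.2 skewPart_le_skewOperators, ?_,
    fun T => ⟨fun hT => ?_, ?_⟩⟩
  · rintro rfl
    obtain ⟨-, Z, -, a_eq⟩ := decomposition h
    exact ha a_eq
  · obtain ⟨a, A, -, X, rfl⟩ := hsub.exists_eq_triple hT
    obtain ⟨C, Z, rfl, rfl⟩ := decomposition hT
    exact ⟨C, Z, X, by simp [add_triple]⟩
  · rintro ⟨C, Z, X, rfl⟩
    obtain ⟨Y, hY⟩ := exists_triple_mem_of_mem_commutant C.2
    exact 𝔤.add_mem (𝔤.add_mem (triple_mem_of_translationSpace_eq_top hN hY 0) ((hφ Z _).2 rfl))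
      (mem_translationSpace.1 (hN ▸ Submodule.mem_top))

end Classification

section Type4

variable {E : Type*} [NormedAddCommGroup E] [InnerProductSpace ℝ E]
  {𝔤 : LieSubalgebra ℝ (Mink E →L[ℝ] Mink E)} {hsub : IsSubalgebraOfSOP 𝔤}

/-- The linear map `c : hsub.skewPart → E` picks, for every `A`, the element `(0, A, c A)` of `𝔤`
whose translation part is orthogonal to the translations in `𝔤`. -/
def IsNormalPart (hsub : IsSubalgebraOfSOP 𝔤) (c : hsub.skewPart →ₗ[ℝ] E) : Prop :=
  ∀ A, c A ∈ (translationSpace 𝔤)ᗮ ∧ triple 0 (A : E →L[ℝ] E) (c A) ∈ 𝔤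

theorem eq_zero_of_mem_of_mem_orthogonal {W : Submodule ℝ E} {x : E} (h : x ∈ W) (k : x ∈ Wᗮ) :
    x = 0 :=
  inner_self_eq_zero (𝕜 := ℝ) |>.1 (k x h)

theorem exists_isNormalPart [FiniteDimensional ℝ E] (hsub : IsSubalgebraOfSOP 𝔤)
    (h0 : ∀ a A X, triple a A X ∈ 𝔤 → a = 0) : ∃ c, IsNormalPart hsub c := by
  let R : Submodule ℝ (hsub.skewPart × E) :=
    { carrier := {v | v.2 ∈ (translationSpace 𝔤)ᗮ ∧ triple 0 (v.1 : E →L[ℝ] E) v.2 ∈ 𝔤}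
      add_mem' := fun h k =>
        ⟨Submodule.add_mem _ h.1 k.1, by simpa using triple_add_mem h.2 k.2⟩
      zero_mem' := ⟨Submodule.zero_mem _, triple_zero_mem⟩
      smul_mem' := fun t v h =>
        ⟨Submodule.smul_mem _ t h.1, by simpa using triple_smul_mem t h.2⟩ }
  obtain ⟨c, hc⟩ := exists_linearMap_of_graph R (by
      rintro ⟨A, a, X, h⟩
      obtain rfl := h0 _ _ _ h
      obtain ⟨w, hw, u, hu, rfl⟩ := (translationSpace 𝔤).exists_add_mem_mem_orthogonal X
      exact ⟨u, hu, by simpa using triple_sub_mem_of_mem_translationSpace h hw⟩)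
    (fun y hy => eq_zero_of_mem_of_mem_orthogonal hy.2 hy.1)
  exact ⟨c, fun A => (hc A (c A)).2 rfl⟩

namespace IsNormalPart

variable {c : hsub.skewPart →ₗ[ℝ] E} (hc : IsNormalPart hsub c)

include hc

theorem sub_mem {A : hsub.skewPart} {X : E} (h : triple 0 (A : E →L[ℝ] E) X ∈ 𝔤) :
    X - c A ∈ translationSpace 𝔤 :=
  sub_mem_translationSpace h (hc A).2

theorem eq_of_mem_orthogonal {A : hsub.skewPart} {u : E} (hu : u ∈ (translationSpace 𝔤)ᗮ)
    (h : triple 0 (A : E →L[ℝ] E) u ∈ 𝔤) : c A = u :=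
  (sub_eq_zero.1 (eq_zero_of_mem_of_mem_orthogonal (hc.sub_mem h)
    (Submodule.sub_mem _ hu (hc A).1))).symm

theorem apply_mem (A : hsub.skewPart) {x : E} (hx : x ∈ translationSpace 𝔤) :
    A.1 x ∈ translationSpace 𝔤 :=
  hsub.apply_mem_translationSpace (hc A).2 hx

theorem apply_mem_orthogonal (A : hsub.skewPart) {u : E} (hu : u ∈ (translationSpace 𝔤)ᗮ) :
    A.1 u ∈ (translationSpace 𝔤)ᗮ :=
  apply_mem_orthogonal_of_skew (skewPart_le_skewOperators A.2) (fun _ => hc.apply_mem A) hu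

theorem apply_lie (A B : hsub.skewPart) : c ⁅A, B⁆ = A.1 (c B) - B.1 (c A) :=
  hc.eq_of_mem_orthogonal
    (Submodule.sub_mem _ (hc.apply_mem_orthogonal A (hc B).1) (hc.apply_mem_orthogonal B (hc A).1))
    (by simpa using hsub.triple_lie_mem (hc A).2 (hc B).2)

variable [FiniteDimensional ℝ E]

-- `c` is a cocycle, so it differs from the coboundary of some `u₀` by a map into the common kernel
-- `I` of the skew part. Hence the affine subspace `-u₀ + (I ⊔ W)` is invariant, where `W` is the
-- translation space, and weak irreducibility gives `I ⊔ W = ⊤`.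
theorem apply_eq_zero (hwi : IsWeaklyIrreducibleAlg 𝔤) (h0 : ∀ a A X, triple a A X ∈ 𝔤 → a = 0)
    (A : hsub.skewPart) {u : E} (hu : u ∈ (translationSpace 𝔤)ᗮ) : A.1 u = 0 := by
  obtain ⟨u₀, hu₀⟩ := exists_coboundary skewPart_le_skewOperators c hc.apply_lie
  let I : Submodule ℝ E := ⨅ A : hsub.skewPart, LinearMap.ker A.1.toLinearMap
  have mem_I {x : E} : x ∈ I ↔ ∀ A : hsub.skewPart, A.1 x = 0 := by
    simp only [I, Submodule.mem_iInf, LinearMap.mem_ker, ContinuousLinearMap.coe_coe]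
  have sup_eq_top : I ⊔ translationSpace 𝔤 = ⊤ := by
    refine hwi.eq_top_of_invariant_affine hsub (-u₀) _ fun a A X h => ?_
    obtain rfl := h0 _ _ _ h
    let A' : hsub.skewPart := ⟨A, 0, X, h⟩
    refine ⟨fun s hs => ?_, Submodule.mem_sup.2
      ⟨c A' - A u₀, mem_I.2 (hu₀ A'), X - c A', hc.sub_mem h, ?_⟩⟩
    · obtain ⟨i, hi, w, hw, rfl⟩ := Submodule.mem_sup.1 hs
      rw [map_add, mem_I.1 hi A', zero_add]
      exact Submodule.mem_sup_right (hc.apply_mem A' hw)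
    · rw [map_neg, zero_smul]
      abel
  obtain ⟨i, hi, w, hw, rfl⟩ := Submodule.mem_sup.1 (sup_eq_top.ge (Submodule.mem_top (x := u)))
  refine eq_zero_of_mem_of_mem_orthogonal ?_ (hc.apply_mem_orthogonal A hu)
  rw [map_add, mem_I.1 hi A, zero_add]
  exact hc.apply_mem A hw

theorem range_eq (hwi : IsWeaklyIrreducibleAlg 𝔤) (h0 : ∀ a A X, triple a A X ∈ 𝔤 → a = 0) :
    LinearMap.range c = (translationSpace 𝔤)ᗮ := by
  have range_le : LinearMap.range c ≤ (translationSpace 𝔤)ᗮ := by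
    rintro _ ⟨A, rfl⟩
    exact (hc A).1
  have sup_eq_top : LinearMap.range c ⊔ translationSpace 𝔤 = ⊤ := by
    refine hwi.eq_top_of_invariant_affine hsub 0 _ fun a A X h => ?_
    obtain rfl := h0 _ _ _ h
    let A' : hsub.skewPart := ⟨A, 0, X, h⟩
    refine ⟨fun s hs => ?_, Submodule.mem_sup.2
      ⟨c A', LinearMap.mem_range_self c A', X - c A', hc.sub_mem h, by simp⟩⟩
    obtain ⟨u, hu, w, hw, rfl⟩ := Submodule.mem_sup.1 hs
    rw [map_add, hc.apply_eq_zero hwi h0 A' (range_le hu), zero_add]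
    exact Submodule.mem_sup_right (hc.apply_mem A' hw)
  refine le_antisymm range_le fun u hu => ?_
  obtain ⟨v, hv, w, hw, rfl⟩ := Submodule.mem_sup.1 (sup_eq_top.ge (Submodule.mem_top (x := u)))
  have w_orthogonal : w ∈ (translationSpace 𝔤)ᗮ := by
    simpa using Submodule.sub_mem _ hu (range_le hv)
  rwa [eq_zero_of_mem_of_mem_orthogonal hw w_orthogonal, add_zero]

theorem eq_zero_of_mem_commutant (hwi : IsWeaklyIrreducibleAlg 𝔤)
    (h0 : ∀ a A X, triple a A X ∈ 𝔤 → a = 0) {C : hsub.skewPart}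
    (hC : C ∈ commutant hsub.skewPart) : c C = 0 := by
  have le_ker : (commutant hsub.skewPart).toSubmodule ≤ LinearMap.ker c := by
    rw [commutant_toSubmodule, Submodule.span_le]
    rintro _ ⟨A, B, rfl⟩
    change c ⁅A, B⁆ = 0
    rw [hc.apply_lie, hc.apply_eq_zero hwi h0 A (hc B).1, hc.apply_eq_zero hwi h0 B (hc A).1,
      sub_zero]
  exact le_ker hC

theorem exists_commutant_add_center (hwi : IsWeaklyIrreducibleAlg 𝔤)
    (h0 : ∀ a A X, triple a A X ∈ 𝔤 → a = 0) (A : hsub.skewPart) :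
    ∃ (C : commutant hsub.skewPart) (Z : LieAlgebra.center ℝ hsub.skewPart),
      A = (C : hsub.skewPart) + (Z : hsub.skewPart) ∧ c A = c Z := by
  obtain ⟨C, Z, A_eq⟩ := _root_.exists_commutant_add_center skewPart_le_skewOperators A.2
  obtain rfl : A = C + Z := Subtype.ext A_eq
  exact ⟨C, Z, rfl, by rw [map_add, hc.eq_zero_of_mem_commutant hwi h0 C.2, zero_add]⟩

theorem translationSpace_ne_bot [Nontrivial E] (hwi : IsWeaklyIrreducibleAlg 𝔤)
    (h0 : ∀ a A X, triple a A X ∈ 𝔤 → a = 0) : translationSpace 𝔤 ≠ ⊥ := by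
  intro eq_bot
  have mem_orthogonal (x : E) : x ∈ (translationSpace 𝔤)ᗮ := by
    rw [eq_bot, Submodule.bot_orthogonal_eq_top]
    exact Submodule.mem_top
  obtain ⟨y, hy⟩ := exists_ne (0 : E)
  obtain ⟨A, rfl⟩ := (hc.range_eq hwi h0).ge (mem_orthogonal y)
  have A_eq_zero : A = 0 := Subtype.ext (ContinuousLinearMap.ext fun x =>
    hc.apply_eq_zero hwi h0 A (mem_orthogonal x))
  exact hy (by rw [A_eq_zero, map_zero])

end IsNormalPart

theorem algType_type4_of_forall [FiniteDimensional ℝ E] [Nontrivial E]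
    (hwi : IsWeaklyIrreducibleAlg 𝔤) (hsub : IsSubalgebraOfSOP 𝔤)
    (h0 : ∀ a A X, triple a A X ∈ 𝔤 → a = 0) (hW : translationSpace 𝔤 ≠ ⊤) :
    AlgType 𝔤 .type4 := by
  obtain ⟨c, hc⟩ := exists_isNormalPart hsub h0
  let ψ : LieAlgebra.center ℝ hsub.skewPart →ₗ[ℝ] (translationSpace 𝔤)ᗮ :=
    (c ∘ₗ (LieAlgebra.center ℝ hsub.skewPart).toSubmodule.subtype).codRestrict _ fun A => (hc A.1).1
  refine ⟨(translationSpace 𝔤)ᗮ, hsub.skewPart, ψ,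
    fun eq_bot => hW (Submodule.orthogonal_eq_bot_iff.1 eq_bot), ?_, ?_, ?_, ?_⟩
  all_goals try rw [(translationSpace 𝔤).orthogonal_orthogonal]
  · exact hc.translationSpace_ne_bot hwi h0
  · exact fun A hA => ⟨skewPart_le_skewOperators hA, fun u hu => hc.apply_eq_zero hwi h0 ⟨A, hA⟩ hu⟩
  · rintro ⟨u, hu⟩
    obtain ⟨A, rfl⟩ := (hc.range_eq hwi h0).ge hu
    obtain ⟨-, Z, -, c_eq⟩ := hc.exists_commutant_add_center hwi h0 A
    exact ⟨Z, Subtype.ext c_eq.symm⟩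
  · refine fun T => ⟨fun hT => ?_, ?_⟩
    · obtain ⟨a, A, -, X, rfl⟩ := hsub.exists_eq_triple hT
      obtain rfl := h0 _ _ _ hT
      let A' : hsub.skewPart := ⟨A, 0, X, hT⟩
      obtain ⟨C, Z, A_eq, c_eq⟩ := hc.exists_commutant_add_center hwi h0 A'
      refine ⟨C, Z, ⟨X - c A', hc.sub_mem hT⟩, ?_⟩
      have hA : A = ((C : hsub.skewPart) : E →L[ℝ] E) + ((Z : hsub.skewPart) : E →L[ℝ] E) :=
        congrArg Subtype.val A_eq
      change triple 0 A X = triple 0 _ 0 + triple 0 _ (c Z) + triple 0 0 (X - c A')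
      rw [add_triple, add_triple, ← hA, ← c_eq, zero_add, zero_add, add_zero, zero_add,
        add_sub_cancel]
    · rintro ⟨C, Z, ⟨X, hX⟩, rfl⟩
      refine 𝔤.add_mem (𝔤.add_mem ?_ (hc Z).2) hX
      simpa [hc.eq_zero_of_mem_commutant hwi h0 C.2] using (hc C).2

theorem exists_algType [FiniteDimensional ℝ E] [Nontrivial E] (hwi : IsWeaklyIrreducibleAlg 𝔤)
    (hsub : IsSubalgebraOfSOP 𝔤) : ∃ i, AlgType 𝔤 i := by
  by_cases hex : ∃ a A X, triple a A X ∈ 𝔤 ∧ a ≠ 0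
  · obtain ⟨a, A, X, h, ha⟩ := hex
    have hN := translationSpace_eq_top hwi hsub ha h
    by_cases h1 : triple 1 0 0 ∈ 𝔤
    · exact ⟨_, algType_type1_of_mem hsub hN h1⟩
    · exact ⟨_, algType_type3_of_notMem hsub hN h1 ha h⟩
  · push Not at hex
    by_cases hN : translationSpace 𝔤 = ⊤
    · exact ⟨_, algType_type2_of_forall hsub hN hex⟩
    · exact ⟨_, algType_type4_of_forall hwi hsub hex hN⟩

end Type4

/-! ### Invariants distinguishing the four types -/

section Invariants

variable {E : Type*} [NormedAddCommGroup E] [InnerProductSpace ℝ E]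

/-- Pairwise incompatible conditions on `𝔤`, the `i`-th of which holds for the algebras of the
`i`-th type and for the algebras of the groups of the `i`-th type. -/
def TypeCondition (𝔤 : LieSubalgebra ℝ (Mink E →L[ℝ] Mink E)) : FourTypes → Prop
  | .type1 => triple 1 0 0 ∈ 𝔤
  | .type2 => (∀ a A X, triple a A X ∈ 𝔤 → a = 0) ∧ ∀ X, triple 0 0 X ∈ 𝔤
  | .type3 => (∃ a A X, triple a A X ∈ 𝔤 ∧ a ≠ 0) ∧ triple 1 0 0 ∉ 𝔤
  | .type4 => (∀ a A X, triple a A X ∈ 𝔤 → a = 0) ∧ ¬ ∀ X, triple 0 0 X ∈ 𝔤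

variable {𝔤 : LieSubalgebra ℝ (Mink E →L[ℝ] Mink E)}

theorem TypeCondition.unique {i j : FourTypes} (hi : TypeCondition 𝔤 i)
    (hj : TypeCondition 𝔤 j) : i = j := by
  have of_dilation_mem (h : triple 1 0 0 ∈ 𝔤) : ¬∀ a A X, triple a A X ∈ 𝔤 → a = 0 :=
    fun k => one_ne_zero (k _ _ _ h)
  have of_ne_zero : (∃ a A X, triple a A X ∈ 𝔤 ∧ a ≠ 0) →
      ¬∀ a A X, triple a A X ∈ 𝔤 → a = 0 := fun ⟨_, _, _, h, ha⟩ k => ha (k _ _ _ h)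
  cases i <;> cases j <;> simp only [TypeCondition] at hi hj <;> first | rfl | (exfalso; tauto)

variable [FiniteDimensional ℝ E] {ℬ : LieSubalgebra ℝ (E →L[ℝ] E)}

theorem eq_zero_of_commutant_add_center_eq_zero (hℬ : ℬ ≤ skewOperators E) {C : commutant ℬ}
    {Z : LieAlgebra.center ℝ ℬ}
    (h : ((C : ℬ) : E →L[ℝ] E) + ((Z : ℬ) : E →L[ℝ] E) = 0) : Z = 0 := by
  have Z_eq_neg : (Z : ℬ) = -(C : ℬ) := Subtype.ext (eq_neg_of_add_eq_zero_right h)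
  exact Subtype.ext (eq_zero_of_mem_commutant_of_mem_center hℬ (Z_eq_neg ▸ neg_mem C.2) Z.2)

theorem typeCondition_type3_of_mem_iff (hℬ : ℬ ≤ skewOperators E)
    {φ : LieAlgebra.center ℝ ℬ →ₗ[ℝ] ℝ} (hφ : φ ≠ 0)
    (h : ∀ T, T ∈ 𝔤 ↔ ∃ (C : commutant ℬ) (A : LieAlgebra.center ℝ ℬ) (X : E),
      T = triple 0 ((C : ℬ) : E →L[ℝ] E) 0 + triple (φ A) ((A : ℬ) : E →L[ℝ] E) 0
        + triple 0 0 X) : TypeCondition 𝔤 .type3 := by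
  refine ⟨?_, fun hT => ?_⟩
  · obtain ⟨Z, hZ⟩ := DFunLike.ne_iff.1 hφ
    refine ⟨φ Z, ((Z : ℬ) : E →L[ℝ] E), 0, (h _).2 ⟨0, Z, 0, ?_⟩, hZ⟩
    simp [add_triple]
  · obtain ⟨C, Z, X, hT⟩ := (h _).1 hT
    simp only [add_triple, triple_inj, zero_add, add_zero] at hT
    rw [eq_zero_of_commutant_add_center_eq_zero hℬ hT.2.1.symm, map_zero] at hT
    exact one_ne_zero hT.1

theorem typeCondition_type4_of_mem_iff {U : Submodule ℝ E} (hU : U ≠ ⊥)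
    (hℬ : ℬ ≤ skewOperators E) {ψ : LieAlgebra.center ℝ ℬ →ₗ[ℝ] U}
    (h : ∀ T, T ∈ 𝔤 ↔ ∃ (C : commutant ℬ) (A : LieAlgebra.center ℝ ℬ) (X : Uᗮ),
      T = triple 0 ((C : ℬ) : E →L[ℝ] E) 0 + triple 0 ((A : ℬ) : E →L[ℝ] E) (ψ A : E)
        + triple 0 0 (X : E)) : TypeCondition 𝔤 .type4 := by
  refine ⟨fun a A X hT => ?_, fun hN => ?_⟩
  · obtain ⟨C, Z, Y, hT⟩ := (h _).1 hT
    simp only [add_triple, triple_inj, zero_add] at hT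
    exact hT.1
  · obtain ⟨u, hu, u_ne_zero⟩ := U.ne_bot_iff.1 hU
    obtain ⟨C, Z, X, hT⟩ := (h _).1 (hN u)
    simp only [add_triple, triple_inj, zero_add, add_zero] at hT
    obtain rfl := eq_zero_of_commutant_add_center_eq_zero hℬ hT.2.1.symm
    have u_eq_X : u = X := by simpa only [map_zero, ZeroMemClass.coe_zero, zero_add] using hT.2.2
    exact u_ne_zero (eq_zero_of_mem_of_mem_orthogonal hu (u_eq_X ▸ X.2))

theorem AlgType.typeCondition {i : FourTypes} (h : AlgType 𝔤 i) : TypeCondition 𝔤 i := by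
  cases i with
  | type1 =>
    obtain ⟨ℬ, -, h⟩ := h
    exact (h _).2 ⟨1, 0, 0, rfl⟩
  | type2 =>
    obtain ⟨ℬ, -, h⟩ := h
    refine ⟨fun a A X hT => ?_, fun X => (h _).2 ⟨0, X, rfl⟩⟩
    obtain ⟨B, Y, hT⟩ := (h _).1 hT
    exact (triple_inj.1 hT).1
  | type3 =>
    obtain ⟨ℬ, φ, hℬ, hφ, h⟩ := h
    exact typeCondition_type3_of_mem_iff (isSkewOn_top_iff.1 hℬ) hφ h
  | type4 =>
    obtain ⟨U, ℬ, ψ, hU, -, hℬ, -, h⟩ := h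
    exact typeCondition_type4_of_mem_iff hU (fun A hA => (hℬ A hA).1) h

end Invariants

/-! ### Exponentials as similarities -/

section ExpSim

theorem Sim.ratio_eq {E : Type*} [NormedAddCommGroup E] [Nontrivial E] {f : E ≃ᵈ E} {r : ℝ}
    (h : ∀ x, ‖f x - f 0‖ = r * ‖x‖) : (Dilation.ratio f : ℝ) = r := by
  obtain ⟨y, hy⟩ := exists_ne (0 : E)
  have norm_sub := Sim.norm_sub f y 0
  rw [h, sub_zero] at norm_sub
  exact (mul_right_cancel₀ (norm_ne_zero_iff.2 hy) norm_sub).symm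

variable {E : Type*} [NormedAddCommGroup E] [InnerProductSpace ℝ E]

/-- The similarity `x ↦ r R x + v`. -/
def Sim.ofLinear (r : ℝ) (hr : 0 < r) (R : E ≃ₗᵢ[ℝ] E) (v : E) : Sim E where
  toFun x := r • R x + v
  invFun x := R.symm (r⁻¹ • (x - v))
  left_inv x := by simp [smul_smul, hr.ne']
  right_inv x := by simp [smul_smul, hr.ne']
  edist_eq' := by
    refine ⟨⟨r, hr.le⟩, fun h => hr.ne' (congrArg NNReal.toReal h), fun x y => ?_⟩
    rw [edist_add_right, edist_smul₀, R.edist_map, show ‖r‖₊ = ⟨r, hr.le⟩ from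
      NNReal.eq (Real.norm_of_nonneg hr.le)]
    rfl

theorem Sim.ofLinear_apply (r : ℝ) (hr : 0 < r) (R : E ≃ₗᵢ[ℝ] E) (v x : E) :
    Sim.ofLinear r hr R v x = r • R x + v := rfl

variable [FiniteDimensional ℝ E]

/-- The orthogonal transformation `exp A` for skew-symmetric `A`. -/
def expIsometry (A : skewOperators E) : E ≃ₗᵢ[ℝ] E where
  toLinearEquiv := LinearEquiv.ofLinearMap (exp A.1).toLinearMap (exp (-A.1)).toLinearMap
    (LinearMap.ext fun x => by simpa using exp_neg_apply_exp_apply (-A.1) x)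
    (LinearMap.ext fun x => exp_neg_apply_exp_apply A.1 x)
  norm_map' := norm_exp_apply_of_skew A.2

theorem expIsometry_apply (A : skewOperators E) (x : E) : expIsometry A x = exp A.1 x := rfl

theorem expIsometry_mem_rotations {A : skewOperators E} {W : Submodule ℝ E}
    (h : ∀ x ∈ Wᗮ, A.1 x = 0) : expIsometry A ∈ rotations W := by
  have inner_nondegenerate : (innerₗ E : LinearMap.BilinForm ℝ E).Nondegenerate :=
    ⟨fun x h => inner_self_eq_zero (𝕜 := ℝ) |>.1 (h x),
      fun x h => inner_self_eq_zero (𝕜 := ℝ) |>.1 (h x)⟩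
  exact ⟨det_exp_of_skew inner_nondegenerate A.2, fun x hx => exp_apply_of_apply_eq_zero (h x hx)⟩

theorem expIsometry_mem_rotations_top (A : skewOperators E) : expIsometry A ∈ rotations ⊤ :=
  expIsometry_mem_rotations fun x hx => by
    rw [Submodule.top_orthogonal_eq_bot, Submodule.mem_bot] at hx
    rw [hx, map_zero]

/-- The similarity with velocity field `x ↦ (a + A) x + X`. -/
def expSim (a : ℝ) (A : skewOperators E) (X : E) : Sim E :=
  Sim.ofLinear (Real.exp a) (Real.exp_pos a) (expIsometry A)
    (exp (affineField (a • 1 + A.1) X) (0, 1)).1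

theorem exp_affineField_eq_expSim (a : ℝ) (A : skewOperators E) (X x : E) :
    exp (affineField (a • 1 + A.1) X) (x, 1) = (expSim a A X x, 1) := by
  rw [exp_affineField_apply, exp_smul_one_add]
  rfl

theorem expSim_zero_zero_apply (X x : E) : expSim 0 0 X x = x + X := by
  have exp_eq := exp_affineField_eq_expSim 0 0 X x
  rw [zero_smul, zero_add, ZeroMemClass.coe_zero, exp_affineField_zero] at exp_eq
  exact (congrArg Prod.fst exp_eq).symm

theorem expSim_apply_zero_right (a : ℝ) (A : skewOperators E) (x : E) :
    expSim a A 0 x = Real.exp a • exp A.1 x := by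
  have fixed : exp (affineField (a • 1 + A.1) 0) ((0, 1) : E × ℝ) = (0, 1) :=
    exp_apply_of_apply_eq_zero (by simp)
  rw [expSim, fixed, Sim.ofLinear_apply, add_zero, expIsometry_apply]

theorem ratio_expSim [Nontrivial E] (a : ℝ) (A : skewOperators E) (X : E) :
    (Dilation.ratio (expSim a A X) : ℝ) = Real.exp a :=
  Sim.ratio_eq fun x => by
    rw [expSim, Sim.ofLinear_apply, Sim.ofLinear_apply, map_zero, smul_zero, zero_add,
      add_sub_cancel_right, norm_smul, LinearIsometryEquiv.norm_map, Real.norm_of_nonneg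
      (Real.exp_pos a).le]

theorem expSim_add {a b : ℝ} {A B : skewOperators E} {X Y : E} (hAB : Commute A.1 B.1)
    (hXY : (a • 1 + A.1) Y = (b • 1 + B.1) X) :
    expSim (a + b) (A + B) (X + Y) = expSim a A X * expSim b B Y := by
  refine DilationEquiv.ext fun x => congrArg Prod.fst (?_ : (_, (1 : ℝ)) = (_, 1))
  have commute : Commute (affineField (a • 1 + A.1) X) (affineField (b • 1 + B.1) Y) := by
    have hlin : Commute (a • 1 + A.1) (b • 1 + B.1) :=
      ((Commute.one_left _).smul_left a).add_left
        (((Commute.one_right _).smul_right b).add_right hAB)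
    rw [commute_iff_lie_eq, lie_affineField, commute_iff_lie_eq.1 hlin, hXY, sub_self]
    simpa using (smul_affineField 0 (0 : E →L[ℝ] E) (0 : E)).symm
  rw [← exp_affineField_eq_expSim, DilationEquiv.coe_mul, Function.comp_apply,
    ← exp_affineField_eq_expSim, ← exp_affineField_eq_expSim, ← mul_apply_eq_comp,
    ← exp_add_of_commute commute, add_affineField]
  congr 3
  rw [AddMemClass.coe_add, add_smul, add_add_add_comm]

theorem expSim_eq_translation_mul (a : ℝ) (A : skewOperators E) (X : E) :
    expSim a A X = expSim 0 0 (expSim a A X 0) * expSim a A 0 :=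
  DilationEquiv.ext fun x => by
    rw [DilationEquiv.coe_mul, Function.comp_apply, expSim_zero_zero_apply,
      expSim_apply_zero_right, expSim, Sim.ofLinear_apply, Sim.ofLinear_apply, map_zero, smul_zero,
      zero_add, expIsometry_apply]

end ExpSim

section ConnectedSubgroups

variable {E : Type*} [NormedAddCommGroup E]

variable (E) in
/-- The group of the isometries of `E`. -/
def simIsometries : Subgroup (Sim E) :=
  (DilationEquiv.ratioHom : Sim E →* NNReal).ker

theorem mem_simIsometries {f : Sim E} : f ∈ simIsometries E ↔ (Dilation.ratio f : ℝ) = 1 := by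
  rw [NNReal.coe_eq_one]
  rfl

theorem mem_simIsometries_of_norm_sub [Nontrivial E] {f : Sim E} (h : ∀ x, ‖f x - f 0‖ = ‖x‖) :
    f ∈ simIsometries E :=
  mem_simIsometries.2 (Sim.ratio_eq fun x => (h x).trans (one_mul _).symm)

variable [InnerProductSpace ℝ E]

theorem linearRotations_le_simIsometries [Nontrivial E] : linearRotations E ≤ simIsometries E :=
  fun _ ⟨R, _, hR⟩ => mem_simIsometries_of_norm_sub fun x => by
    rw [hR, hR, map_zero, sub_zero, R.norm_map]

theorem translations_le_simIsometries [Nontrivial E] (W : Submodule ℝ E) :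
    translations W ≤ simIsometries E :=
  fun _ ⟨w, _, hw⟩ => mem_simIsometries_of_norm_sub fun x => by
    rw [hw, hw, zero_add, add_sub_cancel_right]

theorem screwIsometries_le_simIsometries [Nontrivial E] (U : Submodule ℝ E)
    (Ψ : Multiplicative U →* rotations Uᗮ) : screwIsometries U Ψ ≤ simIsometries E :=
  fun _ ⟨u, hu⟩ => mem_simIsometries_of_norm_sub fun x => by
    rw [hu, hu, ← map_sub, zero_add, add_sub_cancel_right, LinearIsometryEquiv.norm_map]

variable [FiniteDimensional ℝ E]

theorem expSim_mem_simIsometries_iff [Nontrivial E] {a : ℝ} {A : skewOperators E} {X : E} :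
    expSim a A X ∈ simIsometries E ↔ a = 0 := by
  rw [mem_simIsometries, ratio_expSim, Real.exp_eq_one_iff]

theorem mem_translations_iff {W : Submodule ℝ E} {f : Sim E} :
    f ∈ translations W ↔ ∃ w ∈ W, f = expSim 0 0 w :=
  exists_congr fun w => and_congr_right fun _ =>
    ⟨fun h => DilationEquiv.ext fun x => (h x).trans (expSim_zero_zero_apply w x).symm,
      fun h x => h ▸ expSim_zero_zero_apply w x⟩

theorem affineField_mem_lieSet_iff_expSim {G : Subgroup (Sim E)} {a : ℝ} {A : skewOperators E}
    {X : E} : affineField (a • 1 + A.1) X ∈ lieSet (homogeneous G) ↔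
      ∀ t : ℝ, expSim (t * a) (t • A) (t • X) ∈ G := by
  rw [affineField_mem_lieSet_iff]
  refine forall_congr' fun t => ?_
  have linear_eq : t • (a • 1 + A.1) = (t * a) • 1 + (t • A).1 := by
    rw [smul_add, smul_smul, SetLike.val_smul]
  simp only [linear_eq, exp_affineField_eq_expSim, Prod.mk.injEq, and_true]
  refine ⟨fun ⟨f, hf, h⟩ => ?_, fun h => ⟨_, h, fun x => rfl⟩⟩
  rwa [DilationEquiv.ext h]

variable {G : Subgroup (Sim E)} {𝔥 : LieSubalgebra ℝ ((E × ℝ) →L[ℝ] (E × ℝ))} {a : ℝ}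
  {A : skewOperators E} {X : E}

namespace IsConnectedLieSubgroupWith

theorem triple_mem_iff (h : IsConnectedLieSubgroupWith (homogeneous G) 𝔥) :
    triple a A.1 X ∈ lorentzAlgebra 𝔥 ↔ ∀ t : ℝ, expSim (t * a) (t • A) (t • X) ∈ G := by
  rw [triple_mem_lorentzAlgebra, and_iff_right A.2, ← affineField_mem_lieSet_iff_expSim,
    ← h.lie_eq, SetLike.mem_coe]

theorem expSim_mem (h : IsConnectedLieSubgroupWith (homogeneous G) 𝔥)
    (hT : triple a A.1 X ∈ lorentzAlgebra 𝔥) : expSim a A X ∈ G := by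
  simpa only [one_mul, one_smul] using h.triple_mem_iff.1 hT 1

theorem translations_le_iff (h : IsConnectedLieSubgroupWith (homogeneous G) 𝔥)
    {W : Submodule ℝ E} :
    translations W ≤ G ↔ ∀ X ∈ W, triple 0 0 X ∈ lorentzAlgebra 𝔥 := by
  refine ⟨fun hG X hX => ?_, fun hN f hf => ?_⟩
  · refine (h.triple_mem_iff (A := 0)).2 fun t => hG (mem_translations_iff.2 ⟨t • X, ?_, ?_⟩)
    · exact W.smul_mem t hX
    · rw [mul_zero, smul_zero]
  · obtain ⟨w, hw, rfl⟩ := mem_translations_iff.1 hf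
    exact h.expSim_mem (hN w hw)

variable [Nontrivial E]

theorem le_of_expSim_mem (h : IsConnectedLieSubgroupWith (homogeneous G) 𝔥) {K : Subgroup (Sim E)}
    (hK : ∀ a (A : skewOperators E) X, triple a A.1 X ∈ lorentzAlgebra 𝔥 → expSim a A X ∈ K) :
    G ≤ K := by
  refine homogeneous_le_homogeneous_iff.1 ?_
  rw [h.generates, Subgroup.closure_le]
  rintro M ⟨T, hT, hM⟩
  have hTG : T ∈ lieSet (homogeneous G) := h.lie_eq ▸ hT
  obtain ⟨a, A, hA, X, rfl⟩ := exists_of_mem_lieSet_homogeneous hTG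
  refine ⟨expSim a ⟨A, hA⟩ X, hK _ _ _ (triple_mem_lorentzAlgebra.2 ⟨hA, hT⟩), fun x => ?_⟩
  rw [hM]
  exact exp_affineField_eq_expSim a ⟨A, hA⟩ X x

theorem forall_eq_zero_iff (h : IsConnectedLieSubgroupWith (homogeneous G) 𝔥) :
    (∀ a A X, triple a A X ∈ lorentzAlgebra 𝔥 → a = 0) ↔ G ≤ simIsometries E := by
  refine ⟨fun h0 => h.le_of_expSim_mem fun a A X hT =>
    expSim_mem_simIsometries_iff.2 (h0 a A X hT), fun hG a A X hT => ?_⟩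
  have hA := (triple_mem_lorentzAlgebra.1 hT).1
  exact expSim_mem_simIsometries_iff.1 (hG (h.expSim_mem (A := ⟨A, hA⟩) hT))

end IsConnectedLieSubgroupWith

end ConnectedSubgroups

/-! ### Groups of the four types -/

section SimTypes

section Products

variable {S : Type*} [Group S] {K L N G : Subgroup S} {x : S}

theorem IsInternalDirect.left_le (h : IsInternalDirect K L G) : K ≤ G :=
  h.2.2 ▸ le_sup_left

theorem IsInternalDirect.right_le (h : IsInternalDirect K L G) : L ≤ G :=
  h.2.2 ▸ le_sup_right

theorem IsInternalSemidirect.left_le (h : IsInternalSemidirect K N G) : K ≤ G :=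
  h.2.2 ▸ le_sup_left

theorem IsInternalSemidirect.right_le (h : IsInternalSemidirect K N G) : N ≤ G :=
  h.2.2 ▸ le_sup_right

theorem exists_mul_eq_of_mem_sup (h : K ≤ Subgroup.normalizer N) (hx : x ∈ K ⊔ N) :
    ∃ k ∈ K, ∃ n ∈ N, k * n = x := by
  rw [← SetLike.mem_coe, Subgroup.coe_mul_of_left_le_normalizer_right K N h] at hx
  exact Set.mem_mul.1 hx

theorem IsInternalDirect.exists_mul_eq (h : IsInternalDirect K L G) (hx : x ∈ G) :
    ∃ k ∈ K, ∃ l ∈ L, k * l = x := by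
  refine exists_mul_eq_of_mem_sup (Subgroup.le_normalizer_iff.2 fun k hk l hl => ?_) (h.2.2.ge hx)
  rwa [h.1 k hk l hl, mul_inv_cancel_right]

theorem IsInternalSemidirect.exists_mul_eq (h : IsInternalSemidirect K N G) (hx : x ∈ G) :
    ∃ k ∈ K, ∃ n ∈ N, k * n = x :=
  exists_mul_eq_of_mem_sup (Subgroup.le_normalizer_iff.2 fun k hk n hn => h.1 k (h.left_le hk) n hn)
    (h.2.2.ge hx)

end Products

variable {E : Type*} [NormedAddCommGroup E]

variable (E) in
/-- The group of the similarities that fix the origin. -/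
def originStabilizer : Subgroup (Sim E) where
  carrier := {f | f 0 = 0}
  one_mem' := rfl
  mul_mem' {f g} (hf : f 0 = 0) (hg : g 0 = 0) := show f (g 0) = 0 by rw [hg, hf]
  inv_mem' {f} (hf : f 0 = 0) := f.injective ((f.apply_symm_apply 0).trans hf.symm)

variable [InnerProductSpace ℝ E] {G H K : Subgroup (Sim E)}
  {U W : Submodule ℝ E} {Φ : {a : ℝ // 0 < a} →* rotations (⊤ : Submodule ℝ E)}
  {Ψ : Multiplicative U →* rotations Uᗮ} {f : Sim E}

theorem linearRotations_le_originStabilizer : linearRotations E ≤ originStabilizer E :=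
  fun f ⟨R, _, hR⟩ => show f 0 = 0 by rw [hR, map_zero]

theorem screwDilations_le_originStabilizer : screwDilations Φ ≤ originStabilizer E :=
  fun f ⟨a, ha⟩ => show f 0 = 0 by rw [ha, smul_zero, map_zero]

theorem originStabilizer_inf_translations : originStabilizer E ⊓ translations W = ⊥ := by
  refine (Subgroup.eq_bot_iff_forall _).2 fun f ⟨h0, w, _, hw⟩ => DilationEquiv.ext fun x => ?_
  have w_eq_zero : w = 0 := by rw [← zero_add w, ← hw, h0]
  rw [hw, w_eq_zero, add_zero, DilationEquiv.coe_one, id_eq]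

theorem mem_left_of_mem_originStabilizer (hK : K ≤ originStabilizer E)
    (hG : IsInternalSemidirect K (translations W) G) (hf : f ∈ G) (h0 : f ∈ originStabilizer E) :
    f ∈ K := by
  obtain ⟨k, hk, n, hn, rfl⟩ := hG.exists_mul_eq hf
  have n_eq_one : n = 1 := (Subgroup.eq_bot_iff_forall _).1 originStabilizer_inf_translations n
    ⟨(Subgroup.mul_mem_cancel_left _ (hK hk)).1 h0, hn⟩
  rwa [n_eq_one, mul_one]

theorem screwDilations_inf_linearRotations [Nontrivial E] :
    screwDilations Φ ⊓ linearRotations E = ⊥ := by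
  refine (Subgroup.eq_bot_iff_forall _).2 fun f ⟨⟨a, ha⟩, hf⟩ => ?_
  have ratio_eq : (Dilation.ratio f : ℝ) = a := Sim.ratio_eq fun x => by
    rw [ha, ha, smul_zero, map_zero, sub_zero, LinearIsometryEquiv.norm_map, norm_smul,
      Real.norm_of_nonneg a.2.le]
  have a_eq_one : a = 1 := Subtype.ext
    (ratio_eq.symm.trans (mem_simIsometries.1 (linearRotations_le_simIsometries hf)))
  exact DilationEquiv.ext fun x => by
    rw [ha, a_eq_one, map_one]
    exact one_smul ℝ x

theorem mem_of_type3 [Nontrivial E] (hH : H ≤ linearRotations E)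
    (hK : IsInternalDirect (screwDilations Φ) H K)
    (hG : IsInternalSemidirect K (translations ⊤) G) (hf : f ∈ G) (hrot : f ∈ linearRotations E) :
    f ∈ H := by
  have hK0 : K ≤ originStabilizer E := hK.2.2 ▸ sup_le screwDilations_le_originStabilizer
    (hH.trans linearRotations_le_originStabilizer)
  obtain ⟨s, hs, η, hη, rfl⟩ := hK.exists_mul_eq
    (mem_left_of_mem_originStabilizer hK0 hG hf (linearRotations_le_originStabilizer hrot))
  have s_eq_one : s = 1 := (Subgroup.eq_bot_iff_forall _).1 screwDilations_inf_linearRotations s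
    ⟨hs, (Subgroup.mul_mem_cancel_right _ (hH hη)).1 hrot⟩
  rwa [s_eq_one, one_mul]

-- At the origin `η * s * n` takes the value `η (Ψ u (w + u))`, and `u ∈ U`, `w ∈ Uᗮ`.
theorem mem_of_type4 (hH : H ≤ linearRotations E)
    (hK : IsInternalDirect H (screwIsometries U Ψ) K)
    (hG : IsInternalSemidirect K (translations Uᗮ) G) (hf : f ∈ G) (hrot : f ∈ linearRotations E) :
    f ∈ H := by
  obtain ⟨k, hk, n, hn, rfl⟩ := hG.exists_mul_eq hf
  obtain ⟨η, hη, s, ⟨u, hs⟩, rfl⟩ := hK.exists_mul_eq hk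
  obtain ⟨w, hw, hnw⟩ := hn
  have s_apply : s w = 0 := by
    have η_zero : η 0 = 0 := linearRotations_le_originStabilizer (hH hη)
    have zero_eq : η (s (n 0)) = 0 := linearRotations_le_originStabilizer hrot
    rw [hnw, zero_add] at zero_eq
    exact η.injective (zero_eq.trans η_zero.symm)
  rw [hs, LinearIsometryEquiv.map_eq_zero_iff] at s_apply
  have u_eq_zero : u = 0 := Subtype.ext (eq_zero_of_mem_of_mem_orthogonal u.2
    (eq_neg_of_add_eq_zero_right s_apply ▸ Uᗮ.neg_mem hw))
  have s_eq_one : s = 1 := DilationEquiv.ext fun x => by simp [hs, u_eq_zero]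
  have n_eq_one : n = 1 := by
    rw [u_eq_zero, ZeroMemClass.coe_zero, add_zero] at s_apply
    exact DilationEquiv.ext fun x => by simp [hnw, s_apply]
  rwa [s_eq_one, n_eq_one, mul_one, mul_one]

end SimTypes

section NecessaryConditions

variable {E : Type*} [NormedAddCommGroup E] [InnerProductSpace ℝ E] {G : Subgroup (Sim E)}
  {U W : Submodule ℝ E} {R : E ≃ₗᵢ[ℝ] E}

theorem rotations_le_rotations_top : rotations W ≤ rotations ⊤ :=
  fun _ hR => ⟨hR.1, fun x hx => hR.2 x (Submodule.orthogonal_le le_top hx)⟩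

theorem ofLinear_mem_linearRotations (hR : R ∈ rotations ⊤) :
    Sim.ofLinear 1 one_pos R 0 ∈ linearRotations E :=
  ⟨R, hR, fun x => by rw [Sim.ofLinear_apply, one_smul, add_zero]⟩

theorem apply_eq_self_of_mem_rotations_orthogonal (hR : R ∈ rotations Uᗮ) {u : E} (hu : u ∈ U) :
    R u = u :=
  hR.2 u (U.le_orthogonal_orthogonal hu)

theorem apply_sub_self_mem_orthogonal (hR : R ∈ rotations Uᗮ) (x : E) : R x - x ∈ Uᗮ := by
  intro u hu
  have hRu := apply_eq_self_of_mem_rotations_orthogonal hR hu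
  rw [inner_sub_right, sub_eq_zero, ← R.inner_map_map u x, hRu]

theorem ofLinear_mem_screwDilations (Φ : {a : ℝ // 0 < a} →* rotations (⊤ : Submodule ℝ E))
    (a : {a : ℝ // 0 < a}) : Sim.ofLinear a a.2 (Φ a).1 0 ∈ screwDilations Φ :=
  ⟨a, fun x => by rw [Sim.ofLinear_apply, map_smul, add_zero]⟩

theorem ofLinear_mem_screwIsometries (Ψ : Multiplicative U →* rotations Uᗮ) (u : U) :
    Sim.ofLinear 1 one_pos (Ψ (Multiplicative.ofAdd u)).1 u.1 ∈ screwIsometries U Ψ := by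
  refine ⟨u, fun x => ?_⟩
  rw [Sim.ofLinear_apply, one_smul, map_add,
    apply_eq_self_of_mem_rotations_orthogonal (Ψ (Multiplicative.ofAdd u)).2 u.2]

variable [FiniteDimensional ℝ E]

theorem expSim_mem_translations {w : E} (hw : w ∈ W) : expSim 0 0 w ∈ translations W :=
  mem_translations_iff.2 ⟨w, hw, rfl⟩

theorem actsTransitively_of_translations_le (h : translations ⊤ ≤ G) : ActsTransitively G :=
  fun x y => ⟨expSim 0 0 (y - x), h (expSim_mem_translations Submodule.mem_top), by
    rw [expSim_zero_zero_apply, add_sub_cancel]⟩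

theorem actsTransitively_of_screwIsometries_le {Ψ : Multiplicative U →* rotations Uᗮ}
    (hs : screwIsometries U Ψ ≤ G) (ht : translations Uᗮ ≤ G) : ActsTransitively G := by
  intro x y
  obtain ⟨u, hu, w, hw, sub_eq⟩ := U.exists_add_mem_mem_orthogonal (y - x)
  let R := Ψ (Multiplicative.ofAdd ⟨u, hu⟩)
  let s := Sim.ofLinear 1 one_pos R.1 u
  have sub_mem : y - s x ∈ Uᗮ := by
    have y_sub_eq : y - s x = w - (R.1 x - x) := by
      rw [Sim.ofLinear_apply, one_smul, eq_add_of_sub_eq sub_eq]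
      abel
    exact y_sub_eq ▸ Uᗮ.sub_mem hw (apply_sub_self_mem_orthogonal R.2 x)
  refine ⟨expSim 0 0 (y - s x) * s, G.mul_mem (ht (expSim_mem_translations sub_mem))
    (hs (ofLinear_mem_screwIsometries Ψ ⟨u, hu⟩)), ?_⟩
  rw [DilationEquiv.coe_mul, Function.comp_apply, expSim_zero_zero_apply, add_sub_cancel]

theorem SimType.actsTransitively {i : FourTypes} (h : SimType G i) : ActsTransitively G := by
  cases i with
  | type1 =>
    obtain ⟨H, K, -, -, -, hG⟩ := h
    exact actsTransitively_of_translations_le hG.right_le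
  | type2 =>
    obtain ⟨H, -, -, hG⟩ := h
    exact actsTransitively_of_translations_le hG.right_le
  | type3 =>
    obtain ⟨H, K, Φ, -, -, -, -, hG, -⟩ := h
    exact actsTransitively_of_translations_le hG.right_le
  | type4 =>
    obtain ⟨H, K, U, Ψ, -, -, -, hK, hG, -⟩ := h
    exact actsTransitively_of_screwIsometries_le (hK.right_le.trans hG.left_le) hG.right_le

variable {H K : Subgroup (Sim E)} {𝔥 : LieSubalgebra ℝ ((E × ℝ) →L[ℝ] (E × ℝ))}

namespace IsConnectedLieSubgroupWith

theorem typeCondition_type1 (h : IsConnectedLieSubgroupWith (homogeneous G) 𝔥)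
    (hG : dilations E ≤ G) : TypeCondition (lorentzAlgebra 𝔥) .type1 := by
  refine (h.triple_mem_iff (A := 0)).2 fun t => hG ⟨⟨Real.exp t, Real.exp_pos t⟩, fun x => ?_⟩
  rw [mul_one, smul_zero, smul_zero, expSim_apply_zero_right, ZeroMemClass.coe_zero,
    NormedSpace.exp_zero]
  rfl

variable [Nontrivial E]

theorem typeCondition_type2 (h : IsConnectedLieSubgroupWith (homogeneous G) 𝔥)
    (hH : H ≤ linearRotations E) (hG : IsInternalSemidirect H (translations ⊤) G) :
    TypeCondition (lorentzAlgebra 𝔥) .type2 := by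
  refine ⟨h.forall_eq_zero_iff.2 ?_,
    fun X => h.translations_le_iff.1 hG.right_le X Submodule.mem_top⟩
  rw [← hG.2.2]
  exact sup_le (hH.trans linearRotations_le_simIsometries) (translations_le_simIsometries _)

theorem typeCondition_type3 (h : IsConnectedLieSubgroupWith (homogeneous G) 𝔥)
    {Φ : {a : ℝ // 0 < a} →* rotations (⊤ : Submodule ℝ E)} (hH : H ≤ linearRotations E)
    (hK : IsInternalDirect (screwDilations Φ) H K)
    (hG : IsInternalSemidirect K (translations ⊤) G)
    (hΦ : ∃ a, ¬∃ η ∈ H, ∀ x, η x = (Φ a : E ≃ₗᵢ[ℝ] E) x) :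
    TypeCondition (lorentzAlgebra 𝔥) .type3 := by
  have screw_mem (a : {a : ℝ // 0 < a}) : Sim.ofLinear a a.2 (Φ a).1 0 ∈ G :=
    hG.left_le (hK.left_le (ofLinear_mem_screwDilations Φ a))
  refine ⟨?_, fun h1 => ?_⟩
  · by_contra! eq_zero
    have isometry := mem_simIsometries.1 (h.forall_eq_zero_iff.1 eq_zero (screw_mem ⟨2, two_pos⟩))
    rw [Sim.ratio_eq (r := 2) fun x => by simp [Sim.ofLinear_apply, norm_smul]] at isometry
    norm_num at isometry
  · obtain ⟨a, ha⟩ := hΦ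
    have dilation_mem : expSim (Real.log a) 0 0 ∈ G := by
      simpa only [mul_one, smul_zero] using (h.triple_mem_iff (A := 0)).1 h1 (Real.log a)
    have mul_eq : Sim.ofLinear 1 one_pos (Φ a).1 0 * expSim (Real.log a) 0 0 =
        Sim.ofLinear a a.2 (Φ a).1 0 := DilationEquiv.ext fun x => by
      simp [Sim.ofLinear_apply, expSim_apply_zero_right, Real.exp_log a.2]
    have rotation_mem : Sim.ofLinear 1 one_pos (Φ a).1 0 ∈ G :=
      (G.mul_mem_cancel_right dilation_mem).1 (mul_eq ▸ screw_mem a)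
    refine ha ⟨_, mem_of_type3 hH hK hG rotation_mem (ofLinear_mem_linearRotations (Φ a).2), ?_⟩
    exact fun x => by rw [Sim.ofLinear_apply, one_smul, add_zero]

theorem typeCondition_type4 (h : IsConnectedLieSubgroupWith (homogeneous G) 𝔥)
    {Ψ : Multiplicative U →* rotations Uᗮ} (hH : H ≤ linearRotations E)
    (hK : IsInternalDirect H (screwIsometries U Ψ) K)
    (hG : IsInternalSemidirect K (translations Uᗮ) G)
    (hΨ : ∃ u, ¬∃ η ∈ H, ∀ x, η x = (Ψ u : E ≃ₗᵢ[ℝ] E) x) :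
    TypeCondition (lorentzAlgebra 𝔥) .type4 := by
  refine ⟨h.forall_eq_zero_iff.2 ?_, fun hN => ?_⟩
  · rw [← hG.2.2, ← hK.2.2]
    exact sup_le (sup_le (hH.trans linearRotations_le_simIsometries)
      (screwIsometries_le_simIsometries U Ψ)) (translations_le_simIsometries _)
  · obtain ⟨u, hu⟩ := hΨ
    have translation_mem : expSim 0 0 u.toAdd.1 ∈ G :=
      h.translations_le_iff.2 (fun X _ => hN X) (expSim_mem_translations (W := ⊤) Submodule.mem_top)
    have mul_eq : expSim 0 0 u.toAdd.1 * Sim.ofLinear 1 one_pos (Ψ u).1 0 =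
        Sim.ofLinear 1 one_pos (Ψ u).1 u.toAdd.1 := DilationEquiv.ext fun x => by
      simp [Sim.ofLinear_apply, expSim_zero_zero_apply]
    have screw_mem : Sim.ofLinear 1 one_pos (Ψ u).1 u.toAdd.1 ∈ G :=
      hG.left_le (hK.right_le (ofLinear_mem_screwIsometries Ψ _))
    have rotation_mem : Sim.ofLinear 1 one_pos (Ψ u).1 0 ∈ G :=
      (G.mul_mem_cancel_left translation_mem).1 (mul_eq ▸ screw_mem)
    refine hu ⟨_, mem_of_type4 hH hK hG rotation_mem
      (ofLinear_mem_linearRotations (rotations_le_rotations_top (Ψ u).2)), fun x => ?_⟩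
    rw [Sim.ofLinear_apply, one_smul, add_zero]

theorem typeCondition_of_simType (h : IsConnectedLieSubgroupWith (homogeneous G) 𝔥)
    {i : FourTypes} (hi : SimType G i) : TypeCondition (lorentzAlgebra 𝔥) i := by
  cases i with
  | type1 =>
    obtain ⟨H, K, -, -, hK, hG⟩ := hi
    exact h.typeCondition_type1 (hK.left_le.trans hG.left_le)
  | type2 =>
    obtain ⟨H, hH, -, hG⟩ := hi
    exact h.typeCondition_type2 hH hG
  | type3 =>
    obtain ⟨H, K, Φ, hH, -, -, hK, hG, hΦ⟩ := hi
    exact h.typeCondition_type3 hH hK hG hΦ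
  | type4 =>
    obtain ⟨H, K, U, Ψ, hH, -, -, hK, hG, hΨ⟩ := hi
    exact h.typeCondition_type4 hH hK hG hΨ

end IsConnectedLieSubgroupWith

end NecessaryConditions

/-! ### From the algebras to the groups -/

section RotationGroup

variable {E : Type*} [NormedAddCommGroup E] [InnerProductSpace ℝ E]

theorem homogeneous_closure_le {S : Set (Sim E)} {H : Subgroup ((E × ℝ) →L[ℝ] (E × ℝ))ˣ}
    (h : ∀ f ∈ S, ∃ M ∈ H, ∀ x : E, M.val (x, 1) = (f x, 1)) :
    homogeneous (Subgroup.closure S) ≤ H := by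
  rintro M ⟨f, hf, hM⟩
  suffices mem : ∃ N ∈ H, ∀ x : E, N.val (x, 1) = (f x, 1) by
    obtain ⟨N, hN, hNf⟩ := mem
    rwa [show M = N from Units.ext (clm_ext_affine fun x => (hM x).trans (hNf x).symm)]
  clear hM
  induction hf using Subgroup.closure_induction with
  | mem f hf => exact h f hf
  | one => exact ⟨1, H.one_mem, fun x => rfl⟩
  | mul f g _ _ hf hg =>
    obtain ⟨M, hM, hMf⟩ := hf
    obtain ⟨N, hN, hNg⟩ := hg
    exact ⟨M * N, H.mul_mem hM hN, fun x => by
      rw [Units.val_mul, mul_apply_eq_comp, hNg, hMf, DilationEquiv.coe_mul, Function.comp_apply]⟩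
  | inv f _ hf =>
    obtain ⟨M, hM, hMf⟩ := hf
    refine ⟨M⁻¹, H.inv_mem hM, fun x => ?_⟩
    have M_apply : M.val (f⁻¹ x, 1) = (x, 1) :=
      (hMf _).trans (congrArg (·, (1 : ℝ)) (f.apply_symm_apply x))
    rw [← M_apply, ← mul_apply_eq_comp, M.inv_mul, one_apply_eq_self]

theorem lieSet_homogeneous_mono {G H : Subgroup (Sim E)} (hGH : G ≤ H) :
    lieSet (homogeneous G) ⊆ lieSet (homogeneous H) := fun _ hT t =>
  let ⟨M, hM, hMT⟩ := hT t
  ⟨M, homogeneous_le_homogeneous_iff.2 hGH hM, hMT⟩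

variable (E) in
/-- The Lie algebra of the velocity fields `x ↦ A x` of rotations about the origin. -/
def rotationFields : LieSubalgebra ℝ ((E × ℝ) →L[ℝ] (E × ℝ)) where
  carrier := {T | ∃ A ∈ skewOperators E, T = affineField A 0}
  zero_mem' := ⟨0, zero_mem _, by simpa using smul_affineField 0 (0 : E →L[ℝ] E) (0 : E)⟩
  add_mem' := by
    rintro _ _ ⟨A, hA, rfl⟩ ⟨B, hB, rfl⟩
    exact ⟨A + B, add_mem hA hB, by rw [add_affineField, add_zero]⟩
  smul_mem' := by
    rintro t _ ⟨A, hA, rfl⟩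
    exact ⟨t • A, (skewOperators E).smul_mem t hA, by rw [smul_affineField, smul_zero]⟩
  lie_mem' := by
    rintro _ _ ⟨A, hA, rfl⟩ ⟨B, hB, rfl⟩
    exact ⟨⁅A, B⁆, (skewOperators E).lie_mem hA hB, by
      rw [lie_affineField, map_zero, map_zero, sub_zero]⟩

variable [FiniteDimensional ℝ E]

theorem mem_rotationFields_of_mem_lieSet [Nontrivial E] {T : (E × ℝ) →L[ℝ] (E × ℝ)}
    (hT : T ∈ lieSet (homogeneous (linearRotations E))) : T ∈ rotationFields E := by
  obtain ⟨a, A, hA, X, rfl⟩ := exists_of_mem_lieSet_homogeneous hT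
  obtain rfl : a = 0 := by
    have exp_mem := (affineField_mem_lieSet_iff_expSim (A := ⟨A, hA⟩)).1 hT 1
    rw [one_mul] at exp_mem
    exact expSim_mem_simIsometries_iff.1 (linearRotations_le_simIsometries exp_mem)
  obtain rfl : X = 0 := by
    have fst_eq_zero : affineField ((0 : ℝ) • 1 + A) X (0, 1) ∈ (LinearMap.fst ℝ E ℝ).ker := by
      refine apply_mem_of_forall_exp_mem (Submodule.closed_of_finiteDimensional _) fun t => ?_
      obtain ⟨f, hf, exp_eq⟩ := mem_lieSet_homogeneous_iff.1 hT t
      rw [exp_eq]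
      exact linearRotations_le_originStabilizer hf
    simpa using fst_eq_zero
  exact ⟨A, hA, by rw [zero_smul, zero_add]⟩

/-- The group generated by the rotations `exp A` with `(0, A, 0) ∈ 𝔤`. -/
def rotationGroup (𝔤 : LieSubalgebra ℝ (Mink E →L[ℝ] Mink E)) : Subgroup (Sim E) :=
  Subgroup.closure {f | ∃ A : skewOperators E, triple 0 A.1 0 ∈ 𝔤 ∧ f = expSim 0 A 0}

variable {𝔤 : LieSubalgebra ℝ (Mink E →L[ℝ] Mink E)}

theorem rotationGroup_le_iff {K : Subgroup (Sim E)} : rotationGroup 𝔤 ≤ K ↔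
    ∀ A : skewOperators E, triple 0 A.1 0 ∈ 𝔤 → expSim 0 A 0 ∈ K := by
  rw [rotationGroup, Subgroup.closure_le]
  exact ⟨fun h A hA => h ⟨A, hA, rfl⟩, fun h f ⟨A, hA, hf⟩ => hf ▸ h A hA⟩

theorem expSim_mem_rotationGroup {A : skewOperators E} (hA : triple 0 A.1 0 ∈ 𝔤) :
    expSim 0 A 0 ∈ rotationGroup 𝔤 :=
  rotationGroup_le_iff.1 le_rfl A hA

theorem rotationGroup_le_linearRotations : rotationGroup 𝔤 ≤ linearRotations E :=
  rotationGroup_le_iff.2 fun A _ => ⟨expIsometry A, expIsometry_mem_rotations_top A, fun x => by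
    rw [expSim_apply_zero_right, Real.exp_zero, one_smul, expIsometry_apply]⟩

theorem rotationGroup_le_originStabilizer : rotationGroup 𝔤 ≤ originStabilizer E :=
  rotationGroup_le_linearRotations.trans linearRotations_le_originStabilizer

variable {G : Subgroup (Sim E)} {𝔥 : LieSubalgebra ℝ ((E × ℝ) →L[ℝ] (E × ℝ))}

namespace IsConnectedLieSubgroupWith

theorem rotationGroup_le (h : IsConnectedLieSubgroupWith (homogeneous G) 𝔥) :
    rotationGroup (lorentzAlgebra 𝔥) ≤ G :=
  rotationGroup_le_iff.2 fun _ => h.expSim_mem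

theorem triple_mem_of_forall_mem_rotationGroup (h : IsConnectedLieSubgroupWith (homogeneous G) 𝔥)
    {A : skewOperators E} (hA : ∀ t : ℝ, expSim 0 (t • A) 0 ∈ rotationGroup (lorentzAlgebra 𝔥)) :
    triple 0 A.1 0 ∈ lorentzAlgebra 𝔥 :=
  h.triple_mem_iff.2 fun t => by
    rw [mul_zero, smul_zero]
    exact h.rotationGroup_le (hA t)

theorem rotationGroup_isConnected [Nontrivial E]
    (h : IsConnectedLieSubgroupWith (homogeneous G) 𝔥) :
    IsConnectedSimSubgroup (rotationGroup (lorentzAlgebra 𝔥)) := by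
  have mem_iff {A : E →L[ℝ] E} (hA : A ∈ skewOperators E) :
      affineField A 0 ∈ 𝔥 ↔ triple 0 A 0 ∈ lorentzAlgebra 𝔥 := by
    rw [triple_mem_lorentzAlgebra, and_iff_right hA, zero_smul, zero_add]
  have exp_eq (A : skewOperators E) (x : E) :
      exp (affineField A.1 0) (x, 1) = (expSim 0 A 0 x, 1) := by
    simpa only [zero_smul, zero_add] using exp_affineField_eq_expSim 0 A 0 x
  refine ⟨𝔥 ⊓ rotationFields E, ⟨Set.ext fun T => ⟨?_, fun hT => ⟨?_, ?_⟩⟩, le_antisymm ?_ ?_⟩⟩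
  · rintro ⟨hT, A, hA, rfl⟩ t
    refine ⟨expUnit (t • affineField A 0), ⟨expSim 0 (t • ⟨A, hA⟩) 0, ?_, fun x => ?_⟩, rfl⟩
    · refine expSim_mem_rotationGroup ?_
      have smul_mem := triple_smul_mem t ((mem_iff hA).1 hT)
      rwa [mul_zero, smul_zero] at smul_mem
    · rw [coe_expUnit, smul_affineField, smul_zero, ← exp_eq]
      rfl
  · exact h.lie_eq.ge (lieSet_homogeneous_mono h.rotationGroup_le hT)
  · exact mem_rotationFields_of_mem_lieSet
      (lieSet_homogeneous_mono rotationGroup_le_linearRotations hT)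
  · refine homogeneous_closure_le ?_
    rintro _ ⟨A, hA, rfl⟩
    exact ⟨expUnit (affineField A.1 0), Subgroup.subset_closure
      ⟨_, ⟨(mem_iff A.2).2 hA, A.1, A.2, rfl⟩, rfl⟩, exp_eq A⟩
  · rw [Subgroup.closure_le]
    rintro M ⟨T, ⟨hT, A, hA, rfl⟩, hM⟩
    refine ⟨expSim 0 ⟨A, hA⟩ 0, expSim_mem_rotationGroup ((mem_iff hA).1 hT), fun x => ?_⟩
    rw [hM]
    exact exp_eq ⟨A, hA⟩ x

end IsConnectedLieSubgroupWith

end RotationGroup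

section TranslationIdeal

variable {E : Type*} [NormedAddCommGroup E] [InnerProductSpace ℝ E] [FiniteDimensional ℝ E]
  {G K : Subgroup (Sim E)} {W : Submodule ℝ E}
  {𝔥 : LieSubalgebra ℝ ((E × ℝ) →L[ℝ] (E × ℝ))}

theorem conj_translation (g : Sim E) (w : E) :
    g * expSim 0 0 w * g⁻¹ = expSim 0 0 (g w - g 0) := by
  obtain ⟨r, -, R, hg⟩ := g.exists_linear
  refine mul_inv_eq_of_eq_mul (DilationEquiv.ext fun x => ?_)
  simp only [DilationEquiv.coe_mul, Function.comp_apply, expSim_zero_zero_apply]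
  rw [hg (x + w), hg x, hg w, map_add, smul_add]
  abel

theorem mem_normalizer_translations {g : Sim E} (hg : ∀ w ∈ W, g w - g 0 ∈ W)
    (hg' : ∀ w ∈ W, g⁻¹ w - g⁻¹ 0 ∈ W) : g ∈ Subgroup.normalizer (translations W) := by
  have conj_mem {f : Sim E} (hf : ∀ w ∈ W, f w - f 0 ∈ W) {t : Sim E} (ht : t ∈ translations W) :
      f * t * f⁻¹ ∈ translations W := by
    obtain ⟨w, hw, rfl⟩ := mem_translations_iff.1 ht
    exact conj_translation f w ▸ expSim_mem_translations (hf w hw)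
  refine Subgroup.mem_normalizer_iff.2 fun t => ⟨conj_mem hg, fun ht => ?_⟩
  simpa [mul_assoc] using conj_mem hg' ht

theorem le_normalizer_translations_top :
    G ≤ Subgroup.normalizer (translations (⊤ : Submodule ℝ E)) :=
  fun _ _ => mem_normalizer_translations (fun _ _ => Submodule.mem_top) fun _ _ => Submodule.mem_top

variable [Nontrivial E]

theorem IsConnectedLieSubgroupWith.isInternalSemidirect_translations_top
    (h : IsConnectedLieSubgroupWith (homogeneous G) 𝔥)
    (hN : ∀ X, triple 0 0 X ∈ lorentzAlgebra 𝔥) (hK : K ≤ originStabilizer E) (hKG : K ≤ G)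
    (hmem : ∀ a (A : skewOperators E), triple a A.1 0 ∈ lorentzAlgebra 𝔥 → expSim a A 0 ∈ K) :
    IsInternalSemidirect K (translations ⊤) G := by
  refine ⟨Subgroup.le_normalizer_iff.1 le_normalizer_translations_top, ?_, le_antisymm ?_ ?_⟩
  · exact eq_bot_mono (inf_le_inf_right _ hK) originStabilizer_inf_translations
  · exact sup_le hKG (h.translations_le_iff.2 fun X _ => hN X)
  · refine h.le_of_expSim_mem fun a A X hT => ?_
    have linear_mem : triple a A.1 0 ∈ lorentzAlgebra 𝔥 := by
      simpa only [sub_zero, sub_self] using triple_sub_mem hT (hN X)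
    rw [expSim_eq_translation_mul]
    exact Subgroup.mul_mem _
      (Subgroup.mem_sup_right (expSim_mem_translations Submodule.mem_top))
      (Subgroup.mem_sup_left (hmem a A linear_mem))

theorem IsConnectedLieSubgroupWith.simType_type2
    (h : IsConnectedLieSubgroupWith (homogeneous G) 𝔥)
    (hc : TypeCondition (lorentzAlgebra 𝔥) .type2) : SimType G .type2 := by
  refine ⟨rotationGroup (lorentzAlgebra 𝔥), rotationGroup_le_linearRotations,
    h.rotationGroup_isConnected, h.isInternalSemidirect_translations_top hc.2
      rotationGroup_le_originStabilizer h.rotationGroup_le fun a A hA => ?_⟩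
  obtain rfl := hc.1 _ _ _ hA
  exact expSim_mem_rotationGroup hA

end TranslationIdeal

section ScrewDilations

variable {E : Type*} [NormedAddCommGroup E] [InnerProductSpace ℝ E] [FiniteDimensional ℝ E]
  {G : Subgroup (Sim E)} {𝔥 : LieSubalgebra ℝ ((E × ℝ) →L[ℝ] (E × ℝ))} {D : skewOperators E}

theorem expIsometry_add {A B : skewOperators E} (h : Commute A.1 B.1) :
    expIsometry (A + B) = expIsometry A * expIsometry B :=
  LinearIsometryEquiv.ext fun x => by
    rw [expIsometry_apply, AddMemClass.coe_add, exp_add_of_commute h]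
    rfl

theorem commute_expSim {a b : ℝ} {A B : skewOperators E} {X Y : E} (hAB : Commute A.1 B.1)
    (hXY : (a • 1 + A.1) Y = (b • 1 + B.1) X) : Commute (expSim a A X) (expSim b B Y) := by
  rw [commute_iff_eq, ← expSim_add hAB hXY, ← expSim_add hAB.symm hXY.symm, add_comm a, add_comm A,
    add_comm X]

/-- The homomorphism `a ↦ exp (log a • D)` into the rotations; it sends `a` to the rotational part
of a screw dilation with ratio `a`. -/
def screwDilationHom (D : skewOperators E) :
    {a : ℝ // 0 < a} →* rotations (⊤ : Submodule ℝ E) :=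
  MonoidHom.mk' (fun a => ⟨expIsometry (Real.log a • D), expIsometry_mem_rotations_top _⟩)
    fun a b => Subtype.ext <| by
      rw [Positive.val_mul, Real.log_mul a.2.ne' b.2.ne', add_smul]
      exact expIsometry_add (((Commute.refl D.1).smul_left _).smul_right _)

theorem screwDilationHom_apply (D : skewOperators E) (a : {a : ℝ // 0 < a}) (x : E) :
    (screwDilationHom D a : E ≃ₗᵢ[ℝ] E) x = exp (Real.log a • D.1) x := rfl

theorem continuous_screwDilationHom (D : skewOperators E) (x : E) :
    Continuous fun a => (screwDilationHom D a : E ≃ₗᵢ[ℝ] E) x := by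
  have continuous_log : Continuous fun a : {a : ℝ // 0 < a} => Real.log a :=
    continuous_subtype_val.log fun a => a.2.ne'
  exact (continuous_exp.comp (continuous_log.smul continuous_const)).clm_apply continuous_const

theorem mem_screwDilations_iff {f : Sim E} :
    f ∈ screwDilations (screwDilationHom D) ↔ ∃ t : ℝ, f = expSim t (t • D) 0 := by
  have screw_eq (t : ℝ) (x : E) : expSim t (t • D) 0 x =
      (screwDilationHom D ⟨Real.exp t, Real.exp_pos t⟩ : E ≃ₗᵢ[ℝ] E) (Real.exp t • x) := by
    rw [expSim_apply_zero_right, screwDilationHom_apply, Real.log_exp, map_smul]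
    rfl
  refine ⟨fun ⟨a, ha⟩ => ⟨Real.log a, DilationEquiv.ext fun x => ?_⟩,
    fun ⟨t, ht⟩ => ⟨⟨Real.exp t, Real.exp_pos t⟩, fun x => ht ▸ screw_eq t x⟩⟩
  simp only [screw_eq, Real.exp_log a.2, ha]

theorem screwDilations_screwDilationHom_zero :
    screwDilations (screwDilationHom (0 : skewOperators E)) = dilations E := by
  have hom_eq : screwDilationHom (0 : skewOperators E) = 1 :=
    MonoidHom.ext fun a => Subtype.ext (LinearIsometryEquiv.ext fun x => by
      rw [screwDilationHom_apply, ZeroMemClass.coe_zero, smul_zero, NormedSpace.exp_zero]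
      rfl)
  rw [hom_eq, dilations]

variable [Nontrivial E]

namespace IsConnectedLieSubgroupWith

theorem isInternalDirect_screwDilations
    (hcomm : ∀ A, triple 0 A 0 ∈ lorentzAlgebra 𝔥 → Commute D.1 A) :
    IsInternalDirect (screwDilations (screwDilationHom D)) (rotationGroup (lorentzAlgebra 𝔥))
      (screwDilations (screwDilationHom D) ⊔ rotationGroup (lorentzAlgebra 𝔥)) := by
  refine ⟨fun k hk l hl => ?_, ?_, rfl⟩
  · obtain ⟨t, rfl⟩ := mem_screwDilations_iff.1 hk
    have le_centralizer : rotationGroup (lorentzAlgebra 𝔥) ≤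
        Subgroup.centralizer {expSim t (t • D) 0} := rotationGroup_le_iff.2 fun A hA =>
      Subgroup.mem_centralizer_singleton_iff.2
        (commute_expSim ((hcomm A hA).smul_left t) (by simp)).eq.symm
    exact (Subgroup.mem_centralizer_singleton_iff.1 (le_centralizer hl)).symm
  · exact eq_bot_mono (inf_le_inf_left _ rotationGroup_le_linearRotations)
      screwDilations_inf_linearRotations

theorem isInternalSemidirect_screwDilations (h : IsConnectedLieSubgroupWith (homogeneous G) 𝔥)
    (hN : ∀ X, triple 0 0 X ∈ lorentzAlgebra 𝔥) (hD : triple 1 D.1 0 ∈ lorentzAlgebra 𝔥)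
    (hcomm : ∀ A, triple 0 A 0 ∈ lorentzAlgebra 𝔥 → Commute D.1 A) :
    IsInternalSemidirect (screwDilations (screwDilationHom D) ⊔ rotationGroup (lorentzAlgebra 𝔥))
      (translations ⊤) G := by
  refine h.isInternalSemidirect_translations_top hN
    (sup_le screwDilations_le_originStabilizer rotationGroup_le_originStabilizer)
    (sup_le (fun f hf => ?_) h.rotationGroup_le) fun a A hA => ?_
  · obtain ⟨t, rfl⟩ := mem_screwDilations_iff.1 hf
    simpa only [mul_one, smul_zero] using h.triple_mem_iff.1 hD t
  · have rotation_mem : triple 0 (A - a • D).1 0 ∈ lorentzAlgebra 𝔥 := by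
      simpa using triple_sub_mem hA (triple_smul_mem a hD)
    have screw_mul : expSim a A 0 = expSim a (a • D) 0 * expSim 0 (A - a • D) 0 := by
      rw [← expSim_add ((hcomm _ rotation_mem).smul_left a) (by simp), add_zero, add_zero,
        add_sub_cancel]
    rw [screw_mul]
    exact Subgroup.mul_mem _ (Subgroup.mem_sup_left (mem_screwDilations_iff.2 ⟨a, rfl⟩))
      (Subgroup.mem_sup_right (expSim_mem_rotationGroup rotation_mem))

theorem simType_type1 (h : IsConnectedLieSubgroupWith (homogeneous G) 𝔥)
    (hN : ∀ X, triple 0 0 X ∈ lorentzAlgebra 𝔥) (hc : TypeCondition (lorentzAlgebra 𝔥) .type1) :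
    SimType G .type1 := by
  have zero_mem : triple 1 (0 : skewOperators E).1 0 ∈ lorentzAlgebra 𝔥 := hc
  have commute_zero (A : E →L[ℝ] E) (_ : triple 0 A 0 ∈ lorentzAlgebra 𝔥) :
      Commute (0 : skewOperators E).1 A := by
    rw [ZeroMemClass.coe_zero]
    exact Commute.zero_left A
  have direct := isInternalDirect_screwDilations commute_zero
  have semidirect := h.isInternalSemidirect_screwDilations hN zero_mem commute_zero
  rw [screwDilations_screwDilationHom_zero] at direct semidirect
  exact ⟨rotationGroup (lorentzAlgebra 𝔥), dilations E ⊔ rotationGroup (lorentzAlgebra 𝔥),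
    rotationGroup_le_linearRotations, h.rotationGroup_isConnected, direct, semidirect⟩

theorem simType_type3 (h : IsConnectedLieSubgroupWith (homogeneous G) 𝔥)
    (hN : ∀ X, triple 0 0 X ∈ lorentzAlgebra 𝔥) (hc : TypeCondition (lorentzAlgebra 𝔥) .type3)
    (hD : triple 1 D.1 0 ∈ lorentzAlgebra 𝔥)
    (hcomm : ∀ A, triple 0 A 0 ∈ lorentzAlgebra 𝔥 → Commute D.1 A) : SimType G .type3 := by
  refine ⟨_, _, screwDilationHom D, rotationGroup_le_linearRotations, h.rotationGroup_isConnected,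
    continuous_screwDilationHom D, isInternalDirect_screwDilations hcomm,
    h.isInternalSemidirect_screwDilations hN hD hcomm, ?_⟩
  by_contra! rotations_mem
  refine hc.2 ?_
  have rotation_mem : triple 0 D.1 0 ∈ lorentzAlgebra 𝔥 :=
    h.triple_mem_of_forall_mem_rotationGroup fun t => by
      obtain ⟨f, hf, hft⟩ := rotations_mem ⟨Real.exp t, Real.exp_pos t⟩
      rwa [show expSim 0 (t • D) 0 = f from DilationEquiv.ext fun x => by
        rw [hft, screwDilationHom_apply, Real.log_exp, expSim_apply_zero_right, Real.exp_zero,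
          one_smul, SetLike.val_smul]]
  simpa only [sub_zero, sub_self] using triple_sub_mem hD rotation_mem

end IsConnectedLieSubgroupWith

end ScrewDilations

section ScrewIsometries

variable {E : Type*} [NormedAddCommGroup E]

theorem screwIsometry_apply_zero [InnerProductSpace ℝ E] {U : Submodule ℝ E}
    {Ψ : Multiplicative U →* rotations Uᗮ} {f : Sim E} {u : U}
    (hf : ∀ x, f x = (Ψ (Multiplicative.ofAdd u) : E ≃ₗᵢ[ℝ] E) (x + u)) : f 0 = u := by
  rw [hf, zero_add, apply_eq_self_of_mem_rotations_orthogonal (Ψ _).2 u.2]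

variable [InnerProductSpace ℝ E] {H K : Subgroup (Sim E)} {U W : Submodule ℝ E}
  {Ψ : Multiplicative U →* rotations Uᗮ}

theorem originStabilizer_inf_screwIsometries : originStabilizer E ⊓ screwIsometries U Ψ = ⊥ := by
  refine (Subgroup.eq_bot_iff_forall _).2 fun f ⟨h0, u, hu⟩ => DilationEquiv.ext fun x => ?_
  have u_eq_zero : u = 0 := Subtype.ext ((screwIsometry_apply_zero hu).symm.trans h0)
  rw [hu, u_eq_zero, ofAdd_zero, map_one]
  exact add_zero x

-- Since `η * s = s * η` and `η` fixes the origin, `η * s` moves the origin by a vector of `U`.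
theorem inf_translations_orthogonal_eq_bot (hH : H ≤ originStabilizer E)
    (hK : IsInternalDirect H (screwIsometries U Ψ) K) : K ⊓ translations Uᗮ = ⊥ := by
  refine (Subgroup.eq_bot_iff_forall _).2 fun f ⟨hf, w, hw, hfw⟩ => DilationEquiv.ext fun x => ?_
  obtain ⟨η, hη, s, ⟨u, hu⟩, rfl⟩ := hK.exists_mul_eq hf
  have w_eq : w = u := by
    rw [← zero_add w, ← hfw, hK.1 η hη s ⟨u, hu⟩, DilationEquiv.coe_mul, Function.comp_apply,
      show η 0 = 0 from hH hη, screwIsometry_apply_zero hu]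
  rw [hfw, eq_zero_of_mem_of_mem_orthogonal (w_eq ▸ u.2) hw, add_zero]
  rfl

variable [FiniteDimensional ℝ E]

theorem expSim_neg (a : ℝ) (A : skewOperators E) (X : E) :
    expSim (-a) (-A) (-X) = (expSim a A X)⁻¹ := by
  refine eq_inv_of_mul_eq_one_left ?_
  rw [← expSim_add (Commute.refl A.1).neg_left (by simp [add_comm]), neg_add_cancel, neg_add_cancel,
    neg_add_cancel]
  exact DilationEquiv.ext fun x => (expSim_zero_zero_apply 0 x).trans (add_zero x)

theorem expSim_apply_sub_expSim_apply_zero (a : ℝ) (A : skewOperators E) (X x : E) :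
    expSim a A X x - expSim a A X 0 = expSim a A 0 x := by
  rw [sub_eq_iff_eq_add, ← expSim_zero_zero_apply, ← Function.comp_apply (f := expSim 0 0 _),
    ← DilationEquiv.coe_mul, ← expSim_eq_translation_mul]

theorem expSim_apply_mem {A : skewOperators E} (hA : ∀ x ∈ W, A.1 x ∈ W) (a : ℝ) {X x : E}
    (hX : X ∈ W) (hx : x ∈ W) : expSim a A X x ∈ W := by
  have invariant : ∀ v ∈ W.comap (LinearMap.fst ℝ E ℝ),
      affineField (a • 1 + A.1) X v ∈ W.comap (LinearMap.fst ℝ E ℝ) := fun v hv =>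
    W.add_mem (W.add_mem (W.smul_mem a hv) (hA _ hv)) (W.smul_mem v.2 hX)
  have exp_mem := exp_apply_mem_of_invariant (Submodule.closed_of_finiteDimensional _) invariant
    (v := (x, 1)) hx
  rwa [exp_affineField_eq_expSim] at exp_mem

theorem expSim_mem_normalizer_translations {A : skewOperators E} (hA : ∀ x ∈ W, A.1 x ∈ W)
    (a : ℝ) (X : E) : expSim a A X ∈ Subgroup.normalizer (translations W) := by
  refine mem_normalizer_translations (fun w hw => ?_) fun w hw => ?_
  · rw [expSim_apply_sub_expSim_apply_zero]
    exact expSim_apply_mem hA a W.zero_mem hw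
  · rw [← expSim_neg, expSim_apply_sub_expSim_apply_zero]
    exact expSim_apply_mem (fun x hx => W.neg_mem (hA x hx)) (-a) W.zero_mem hw

end ScrewIsometries

section ScrewSection

variable {E : Type*} [NormedAddCommGroup E] [InnerProductSpace ℝ E] {G : Subgroup (Sim E)}
  {𝔤 : LieSubalgebra ℝ (Mink E →L[ℝ] Mink E)} {U : Submodule ℝ E}
  {σ : U →ₗ[ℝ] skewOperators E}

/-- The data behind the fourth type: `𝔤` contains the translations along `Uᗮ`, its rotational
parts kill `U`, and `u ↦ (0, σ u, u)` is a linear section of `𝔤 → U` whose rotational parts are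
central. -/
structure IsScrewSection (𝔤 : LieSubalgebra ℝ (Mink E →L[ℝ] Mink E)) (U : Submodule ℝ E)
    (σ : U →ₗ[ℝ] skewOperators E) : Prop where
  translation_mem : ∀ X ∈ Uᗮ, triple 0 0 X ∈ 𝔤
  apply_eq_zero : ∀ {a A X}, triple a A X ∈ 𝔤 → ∀ u ∈ U, A u = 0
  triple_mem : ∀ u : U, triple 0 (σ u).1 (u : E) ∈ 𝔤
  commute : ∀ (u : U) {a A X}, triple a A X ∈ 𝔤 → Commute (σ u).1 A

namespace IsScrewSection

theorem section_apply_eq_zero (hs : IsScrewSection 𝔤 U σ) (u : U) : ∀ v ∈ U, (σ u).1 v = 0 :=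
  hs.apply_eq_zero (hs.triple_mem u)

theorem apply_mem_orthogonal (hs : IsScrewSection 𝔤 U σ) {a : ℝ} {A : skewOperators E} {X : E}
    (hT : triple a A.1 X ∈ 𝔤) : ∀ x ∈ Uᗮ, A.1 x ∈ Uᗮ := fun _ hx =>
  apply_mem_orthogonal_of_skew A.2 (fun y hy => hs.apply_eq_zero hT y hy ▸ U.zero_mem) hx

variable [FiniteDimensional ℝ E]

/-- The homomorphism `u ↦ exp (σ u)` that twists the translations along `U`. -/
def screwIsometryHom (hs : IsScrewSection 𝔤 U σ) : Multiplicative U →* rotations Uᗮ :=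
  MonoidHom.mk' (fun u => ⟨expIsometry (σ u.toAdd), expIsometry_mem_rotations <| by
      rw [Submodule.orthogonal_orthogonal]
      exact hs.section_apply_eq_zero _⟩)
    fun u v => Subtype.ext <|
      (congrArg expIsometry (map_add σ u.toAdd v.toAdd)).trans
        (expIsometry_add (hs.commute _ (hs.triple_mem _)))

theorem screwIsometryHom_apply (hs : IsScrewSection 𝔤 U σ) (u : Multiplicative U) (x : E) :
    (hs.screwIsometryHom u : E ≃ₗᵢ[ℝ] E) x = exp (σ u.toAdd).1 x := rfl

theorem continuous_screwIsometryHom (hs : IsScrewSection 𝔤 U σ) (x : E) :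
    Continuous fun u : U =>
      (hs.screwIsometryHom (Multiplicative.ofAdd u) : E ≃ₗᵢ[ℝ] E) x :=
  (continuous_exp.comp (continuous_subtype_val.comp σ.continuous_of_finiteDimensional)).clm_apply
    continuous_const

theorem expSim_eq (hs : IsScrewSection 𝔤 U σ) (u : U) (x : E) :
    expSim 0 (σ u) (u : E) x =
      (hs.screwIsometryHom (Multiplicative.ofAdd u) : E ≃ₗᵢ[ℝ] E) (x + u) := by
  have split : expSim 0 (σ u) (u : E) = expSim 0 (σ u) 0 * expSim 0 0 (u : E) := by
    rw [← expSim_add (Commute.zero_right _) (by simp [hs.section_apply_eq_zero u u u.2]), zero_add,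
      zero_add, add_zero]
  rw [split, DilationEquiv.coe_mul, Function.comp_apply, expSim_zero_zero_apply,
    expSim_apply_zero_right, Real.exp_zero, one_smul, screwIsometryHom_apply, toAdd_ofAdd]

theorem mem_screwIsometries_iff (hs : IsScrewSection 𝔤 U σ) {f : Sim E} :
    f ∈ screwIsometries U hs.screwIsometryHom ↔ ∃ u : U, f = expSim 0 (σ u) (u : E) := by
  refine exists_congr fun u => ⟨fun hf => DilationEquiv.ext fun x => ?_, fun hf x => ?_⟩
  · rw [hf, hs.expSim_eq]
  · rw [hf, hs.expSim_eq]

theorem isInternalDirect (hs : IsScrewSection 𝔤 U σ) :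
    IsInternalDirect (rotationGroup 𝔤) (screwIsometries U hs.screwIsometryHom)
      (rotationGroup 𝔤 ⊔ screwIsometries U hs.screwIsometryHom) := by
  refine ⟨fun k hk l hl => ?_, eq_bot_mono (inf_le_inf_right _ rotationGroup_le_originStabilizer)
    originStabilizer_inf_screwIsometries, rfl⟩
  obtain ⟨u, rfl⟩ := hs.mem_screwIsometries_iff.1 hl
  have le_centralizer : rotationGroup 𝔤 ≤ Subgroup.centralizer {expSim 0 (σ u) (u : E)} :=
    rotationGroup_le_iff.2 fun A hA => Subgroup.mem_centralizer_singleton_iff.2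
      (commute_expSim (hs.commute u hA) (by simp [hs.apply_eq_zero hA u u.2])).eq.symm
  exact Subgroup.mem_centralizer_singleton_iff.1 (le_centralizer hk)

-- With `X = w + u`, `w ∈ Uᗮ`, `u ∈ U`, the flow of `(0, A, X)` is a translation along `Uᗮ`
-- followed by the flows of `(0, A - σ u, 0)` and `(0, σ u, u)`.
theorem expSim_mem_sup (hs : IsScrewSection 𝔤 U σ) {A : skewOperators E} {X : E}
    (hT : triple 0 A.1 X ∈ 𝔤) : expSim 0 A X ∈
      (rotationGroup 𝔤 ⊔ screwIsometries U hs.screwIsometryHom) ⊔ translations Uᗮ := by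
  obtain ⟨w, hw, u, hu, rfl⟩ := Uᗮ.exists_add_mem_mem_orthogonal X
  rw [Submodule.orthogonal_orthogonal] at hu
  lift u to U using hu
  have A_apply : A.1 u = 0 := hs.apply_eq_zero hT u u.2
  have rotation_mem : triple 0 (A - σ u).1 0 ∈ 𝔤 := by
    simpa using triple_sub_mem (triple_sub_mem hT (hs.triple_mem u)) (hs.translation_mem w hw)
  have split : expSim 0 A (w + u) =
      expSim 0 0 (expSim 0 A w 0) * (expSim 0 (A - σ u) 0 * expSim 0 (σ u) (u : E)) := by
    have split_translation {Y : E} : expSim 0 A (Y + u) = expSim 0 A Y * expSim 0 0 (u : E) := by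
      rw [← expSim_add (Commute.zero_right _) (by simp [A_apply]), add_zero, add_zero]
    rw [← expSim_add (hs.commute u rotation_mem).symm
      (by simp [A_apply, hs.section_apply_eq_zero u u u.2]), sub_add_cancel, add_zero,
      split_translation, split_translation, ← mul_assoc, ← expSim_eq_translation_mul]
  rw [split]
  exact Subgroup.mul_mem _
    (Subgroup.mem_sup_right (expSim_mem_translations
      (expSim_apply_mem (hs.apply_mem_orthogonal hT) 0 hw Uᗮ.zero_mem)))
    (Subgroup.mem_sup_left (Subgroup.mul_mem _
      (Subgroup.mem_sup_left (expSim_mem_rotationGroup rotation_mem))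
      (Subgroup.mem_sup_right (hs.mem_screwIsometries_iff.2 ⟨u, rfl⟩))))

end IsScrewSection

namespace IsConnectedLieSubgroupWith

variable [FiniteDimensional ℝ E] [Nontrivial E] {𝔥 : LieSubalgebra ℝ ((E × ℝ) →L[ℝ] (E × ℝ))}

theorem isInternalSemidirect_screwIsometries (h : IsConnectedLieSubgroupWith (homogeneous G) 𝔥)
    (h0 : ∀ a A X, triple a A X ∈ lorentzAlgebra 𝔥 → a = 0)
    (hs : IsScrewSection (lorentzAlgebra 𝔥) U σ) :
    IsInternalSemidirect
      (rotationGroup (lorentzAlgebra 𝔥) ⊔ screwIsometries U hs.screwIsometryHom)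
      (translations Uᗮ) G := by
  have le_normalizer : G ≤ Subgroup.normalizer (translations Uᗮ) :=
    h.le_of_expSim_mem fun a A X hT =>
      expSim_mem_normalizer_translations (hs.apply_mem_orthogonal hT) a X
  refine ⟨Subgroup.le_normalizer_iff.1 le_normalizer, inf_translations_orthogonal_eq_bot
    rotationGroup_le_originStabilizer hs.isInternalDirect, le_antisymm ?_ ?_⟩
  · refine sup_le (sup_le h.rotationGroup_le fun f hf => ?_)
      (h.translations_le_iff.2 hs.translation_mem)
    obtain ⟨u, rfl⟩ := hs.mem_screwIsometries_iff.1 hf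
    exact h.expSim_mem (hs.triple_mem u)
  · refine h.le_of_expSim_mem fun a A X hT => ?_
    obtain rfl := h0 _ _ _ hT
    exact hs.expSim_mem_sup hT

theorem simType_type4 (h : IsConnectedLieSubgroupWith (homogeneous G) 𝔥)
    (hc : TypeCondition (lorentzAlgebra 𝔥) .type4)
    (hs : IsScrewSection (lorentzAlgebra 𝔥) U σ) : SimType G .type4 := by
  refine ⟨_, _, U, hs.screwIsometryHom, rotationGroup_le_linearRotations,
    h.rotationGroup_isConnected, hs.continuous_screwIsometryHom, hs.isInternalDirect,
    h.isInternalSemidirect_screwIsometries hc.1 hs, ?_⟩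
  by_contra! rotations_mem
  have rotation_mem (u : U) : triple 0 (σ u).1 0 ∈ lorentzAlgebra 𝔥 :=
    h.triple_mem_of_forall_mem_rotationGroup fun t => by
      obtain ⟨f, hf, hfu⟩ := rotations_mem (Multiplicative.ofAdd (t • u))
      rwa [show expSim 0 (t • σ u) 0 = f from DilationEquiv.ext fun x => by
        rw [hfu, hs.screwIsometryHom_apply, toAdd_ofAdd, map_smul, expSim_apply_zero_right,
          Real.exp_zero, one_smul]]
  refine hc.2 fun X => ?_
  obtain ⟨u, hu, w, hw, rfl⟩ := U.exists_add_mem_mem_orthogonal X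
  have u_mem := triple_sub_mem (hs.triple_mem ⟨u, hu⟩) (rotation_mem ⟨u, hu⟩)
  simpa [add_triple] using add_mem u_mem (hs.translation_mem w hw)

end IsConnectedLieSubgroupWith

end ScrewSection

section Construction

variable {E : Type*} [NormedAddCommGroup E] [InnerProductSpace ℝ E]
  {𝔤 : LieSubalgebra ℝ (Mink E →L[ℝ] Mink E)} {ℬ : LieSubalgebra ℝ (E →L[ℝ] E)}
  {U : Submodule ℝ E}

theorem commute_of_mem_center {Z : ℬ} (hZ : Z ∈ LieAlgebra.center ℝ ℬ) {A : E →L[ℝ] E}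
    (hA : A ∈ ℬ) : Commute (Z : E →L[ℝ] E) A :=
  (commute_iff_lie_eq.2 (mem_center_iff.1 hZ A hA)).symm

theorem exists_central_dilation_of_mem_iff (hℬ : ℬ ≤ skewOperators E)
    {φ : LieAlgebra.center ℝ ℬ →ₗ[ℝ] ℝ} (hφ : φ ≠ 0)
    (h : ∀ T, T ∈ 𝔤 ↔ ∃ (C : commutant ℬ) (A : LieAlgebra.center ℝ ℬ) (X : E),
      T = triple 0 ((C : ℬ) : E →L[ℝ] E) 0 + triple (φ A) ((A : ℬ) : E →L[ℝ] E) 0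
        + triple 0 0 X) :
    ∃ D : skewOperators E, triple 1 D.1 0 ∈ 𝔤 ∧ ∀ A, triple 0 A 0 ∈ 𝔤 → Commute D.1 A := by
  obtain ⟨Z, hZ⟩ := LinearMap.surjective hφ 1
  refine ⟨⟨(Z : ℬ), hℬ (Z : ℬ).2⟩, (h _).2 ⟨0, Z, 0, by simp [add_triple, hZ]⟩, fun A hA => ?_⟩
  obtain ⟨C, Y, X, hT⟩ := (h _).1 hA
  rw [add_triple, add_triple, triple_inj] at hT
  refine commute_of_mem_center Z.2 ?_
  rw [hT.2.1]
  exact ℬ.add_mem (ℬ.add_mem (C : ℬ).2 (Y : ℬ).2) ℬ.zero_mem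

theorem exists_isScrewSection_of_mem_iff (hℬ : IsSkewOn Uᗮ ℬ)
    {ψ : LieAlgebra.center ℝ ℬ →ₗ[ℝ] U} (hψ : Function.Surjective ψ)
    (h : ∀ T, T ∈ 𝔤 ↔ ∃ (C : commutant ℬ) (A : LieAlgebra.center ℝ ℬ) (X : Uᗮ),
      T = triple 0 ((C : ℬ) : E →L[ℝ] E) 0 + triple 0 ((A : ℬ) : E →L[ℝ] E) (ψ A : E)
        + triple 0 0 (X : E)) : ∃ σ : U →ₗ[ℝ] skewOperators E, IsScrewSection 𝔤 U σ := by
  obtain ⟨ζ, hζ⟩ := ψ.exists_rightInverse_of_surjective (LinearMap.range_eq_top.2 hψ)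
  have le_skewOperators : ℬ ≤ skewOperators E := fun A hA => (hℬ A hA).1
  have mem_ℬ {a : ℝ} {A : E →L[ℝ] E} {X : E} (hT : triple a A X ∈ 𝔤) : A ∈ ℬ := by
    obtain ⟨C, Y, X, hT⟩ := (h _).1 hT
    rw [add_triple, add_triple, triple_inj] at hT
    rw [hT.2.1]
    exact ℬ.add_mem (ℬ.add_mem (C : ℬ).2 (Y : ℬ).2) ℬ.zero_mem
  refine ⟨(LieSubalgebra.inclusion le_skewOperators : ℬ →ₗ[ℝ] skewOperators E) ∘ₗ
    (LieAlgebra.center ℝ ℬ).toSubmodule.subtype ∘ₗ ζ, fun X hX => (h _).2 ⟨0, 0, ⟨X, hX⟩, ?_⟩,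
    fun hT u hu => (hℬ _ (mem_ℬ hT)).2 u (U.le_orthogonal_orthogonal hu),
    fun u => (h _).2 ⟨0, ζ u, 0, ?_⟩,
    fun u {a A X} hT => commute_of_mem_center (ζ u).2 (mem_ℬ hT)⟩
  · simp [add_triple]
  · simp [add_triple, show ψ (ζ u) = u from LinearMap.congr_fun hζ u]

theorem IsConnectedLieSubgroupWith.simType_of_algType [FiniteDimensional ℝ E] [Nontrivial E]
    {G : Subgroup (Sim E)} {𝔥 : LieSubalgebra ℝ ((E × ℝ) →L[ℝ] (E × ℝ))}
    (h : IsConnectedLieSubgroupWith (homogeneous G) 𝔥) {i : FourTypes}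
    (hi : AlgType (lorentzAlgebra 𝔥) i) : SimType G i := by
  have hc := hi.typeCondition
  cases i with
  | type1 =>
    obtain ⟨ℬ, -, mem_iff⟩ := hi
    exact h.simType_type1 (fun X => (mem_iff _).2 ⟨0, 0, X, rfl⟩) hc
  | type2 => exact h.simType_type2 hc
  | type3 =>
    obtain ⟨ℬ, φ, hℬ, hφ, mem_iff⟩ := hi
    obtain ⟨D, hD, hcomm⟩ := exists_central_dilation_of_mem_iff (isSkewOn_top_iff.1 hℬ) hφ
      mem_iff
    exact h.simType_type3 (fun X => (mem_iff _).2 ⟨0, 0, X, by simp [add_triple]⟩) hc hD hcomm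
  | type4 =>
    obtain ⟨U, ℬ, ψ, -, -, hℬ, hψ, mem_iff⟩ := hi
    obtain ⟨σ, hs⟩ := exists_isScrewSection_of_mem_iff hℬ hψ mem_iff
    exact h.simType_type4 hc hs

end Construction

end

theorem theorem5 {E : Type*} [NormedAddCommGroup E] [InnerProductSpace ℝ E]
    [FiniteDimensional ℝ E] [Nontrivial E] (G : Subgroup (Sim E))
    (hG : IsConnectedSimSubgroup G) :
    ∃ 𝔤 : LieSubalgebra ℝ (Mink E →L[ℝ] Mink E),
      IsConnectedLieSubgroupWith (lorentzGroup G) 𝔤 ∧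
      IsSubalgebraOfSOP 𝔤 ∧
      (∀ f ∈ G, ∃! M, M ∈ lorentzGroup G ∧ Induces M f) ∧
      (ActsTransitively G ↔ IsWeaklyIrreducibleAlg 𝔤 ∧ ¬ IsIrreducibleAlg 𝔤) ∧
      (ActsTransitively G →
        (∃! i : FourTypes, SimType G i) ∧ ∀ i : FourTypes, SimType G i ↔ AlgType 𝔤 i) := by
  obtain ⟨𝔥, h⟩ := hG
  have hsub : IsSubalgebraOfSOP (lorentzAlgebra 𝔥) := lorentzAlgebra_isSubalgebraOfSOP
  refine ⟨lorentzAlgebra 𝔥, lorentzGroup_isConnected h, hsub, fun f hf => existsUnique_induces h hf,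
    ⟨fun htr => ⟨htr.isWeaklyIrreducibleAlg h, hsub.not_isIrreducibleAlg⟩, fun hwi => ?_⟩,
    fun htr => ?_⟩
  · obtain ⟨i, hi⟩ := exists_algType hwi.1 hsub
    exact (h.simType_of_algType hi).actsTransitively
  · obtain ⟨i, hi⟩ := exists_algType (htr.isWeaklyIrreducibleAlg h) hsub
    have eq_of_simType {j : FourTypes} (hj : SimType G j) : j = i :=
      (h.typeCondition_of_simType hj).unique hi.typeCondition
    exact ⟨⟨i, h.simType_of_algType hi, fun _ => eq_of_simType⟩,
      fun j => ⟨fun hj => eq_of_simType hj ▸ hi, h.simType_of_algType⟩⟩
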